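/- Let $p$ be a prime, let $\mathcal{O}=\mathcal{O}_{K,\mathfrak p}$ be the completion of the ring of integers of a number field at a prime $\mathfrak p\mid p$ (equivalently, the ring of integers of a finite extension of $\mathbb{Q}_p$), with uniformizer $\pi$, residue field $\mathbb{F}$ and ramification index $e_{\mathfrak p}=e(\mathfrak p/p)<p-1$. Let $Y\to\operatorname{Spec}\mathcal{O}$ be smooth of relative dimension $n$, let $G\to Y$ be a smooth commutative group scheme of relative dimension $m$ with identity section $e$, and let $y\in Y(\mathbb{F})$. For an $\mathcal O$-scheme $X$ and $x\in X(\mathbb F)$ write $X(\mathcal O)_x$ for the set of $\mathcal{O}$-points of $X$ reducing to $x$. Choose $s_1,\dots,s_n\in\mathcal{O}_{Y,y}$ such that $\pi,s_1,\dots,s_n$ generate the maximal ideal, and elements $t_1,\dots,t_m$ of the ideal $I=\ker(e^\#)$ of the identity section in $\mathcal{O}_{G,e(y)}$ which form a basis of $I/I^2$ over $\mathcal{O}_{Y,y}$. Let $\tilde s=(s_i/\pi)_i$ and $\tilde t=(t_j/\pi)_j$. The group law on $G$ is given, on the completion $\mathcal{O}_{Y,y}[[t_1,\dots,t_m]]$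 along the identity section, by a unique $m$-dimensional formal group law $F$ over $\mathcal{O}_{Y,y}$. Its formal logarithm is the unique tuple $L=(L_1,\dots,L_m)$ of power series over $\mathcal{O}_{Y,y}\otimes\mathbb{Q}$ such that $L_i(0)=0$, $L_i$ equals $t_i$ in degree $1$ and $dL_i$ is an invariant differential of $F$ over $\mathcal{O}_{Y,y}$; its formal exponential is the unique tuple $E=(E_1,\dots,E_m)$ with $E_i(L_1,\dots,L_m)=t_i$. Then: (1) The maps $\tilde s: Y(\mathcal{O})_y\to\mathcal{O}^n$ and $(\tilde s,\tilde t): G(\mathcal{O})_{e(y)}\to\mathcal{O}^{n+m}$ are bijective. (2) $L$ and $E$ induce mutually inverse maps $\log,\exp:\mathcal{O}^{n+m}\to\mathcal{O}^{n+m}$. Both are the identity on the first $n$ coordinates, and for $\tilde y\in Y(\mathcal{O})_y$ and $\tilde x\in\mathcal{O}^m$ the last $m$ coordinates of $\log(\tilde s(\tilde y),\tilde x)$ and $\exp(\tilde s(\tilde y),\tilde x)$ are the sums of the convergent series $\pi^{-1}L_i(\pi\tilde x)$ and $\pi^{-1}E_i(\pi\tilde x)$, with coefficients evaluated at $\tilde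 y$. All coordinates of $\log$ and $\exp$ are given by convergent power series, i.e. elements of $\mathcal{O}\langle\tilde Y_1,\dots,\tilde Y_n,\tilde X_1,\dots,\tilde X_m\rangle$ (power series whose coefficients tend to $0$). (3) For $z\in\mathbb{Z}_p$ and $g\in G(\mathcal{O})_{e(y)}$ there is a unique $z\cdot g\in G(\mathcal{O})_{e(y)}$ with the same image as $g$ in $Y(\mathcal{O})_y$ which agrees modulo $p^j$ with the multiple $a\cdot g$ for all $j\ge 0$ and all integers $a\equiv z\pmod{p^j}$. Identifying $G(\mathcal{O})_{e(y)}$ with $\mathcal{O}^{n+m}$ through $(\tilde s,\tilde t)$, one has $$z\cdot g=\exp(z\cdot\log(g)),$$ where on the right $z$ multiplies the last $m$ coordinates and leaves the first $n$ coordinates fixed. (4) Consequently, for every $\mathbb{Z}_p$-basis of $\mathcal{O}$, of size $d$, the action map $\mathbb{Z}_p\times G(\mathcal{O})_{e(y)}\to G(\mathcal{O})_{e(y)}$, viewed in the corresponding coordinates as a map $\mathbb{Z}_p\times\mathbb{Z}_p^{d(n+m)}\to\mathbb{Z}_p^{d(n+m)}$, is given by convergent power series with coefficients in $\mathbb{Z}_p$.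 -/

import Mathlib

open AlgebraicGeometry CategoryTheory MonoidalCategory CartesianMonoidalCategory
open scoped MonObj TensorProduct

universe u

noncomputable section

namespace LogExp

/-! ### Convergent power series over a local ring, with respect to the maximal-adic topology -/

section Convergence

variable {A : Type*} [CommRing A] [IsLocalRing A]

/-- `f` is a convergent power series: its coefficients tend to `0` in the `𝔪`-adic topology.
For `𝔪`-adically complete noetherian `A` these are the elements of `A⟨X⟩`, the `𝔪`-adic
completion of the polynomial ring. -/
def IsConvergent {σ : Type*} (f : MvPowerSeries σ A) : Prop :=
  ∀ N : ℕ, {J : σ →₀ ℕ | MvPowerSeries.coeff J f ∉ IsLocalRing.maximalIdeal A ^ N}.Finite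

/-- The family `a` of elements of the `A`-algebra `B` is (unconditionally) summable with sum `l`,
for the topology on `B` in which the images of the powers of `𝔪` are the basic neighbourhoods
of `0`. -/
def HasAdicSum (A : Type*) [CommRing A] [IsLocalRing A] {B : Type*} [CommRing B] [Algebra A B]
    {κ : Type*} (a : κ → B) (l : B) : Prop :=
  ∀ N : ℕ, ∃ S : Finset κ, ∀ T : Finset κ, S ⊆ T →
    ∃ r ∈ IsLocalRing.maximalIdeal A ^ N, l - ∑ i ∈ T, a i = algebraMap A B r

/-- The power series `f` converges at the point `w`, with value `v`. -/
def HasValue {σ : Type*} (f : MvPowerSeries σ A) (w : σ → A) (v : A) : Prop :=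
  HasAdicSum A (fun J : σ →₀ ℕ => MvPowerSeries.coeff J f * J.prod fun i k => w i ^ k) v

end Convergence

/-! ### Germs -/

/-- Pullback of germs along a morphism `φ` with `φ x = z`. -/
def germPullback {X Z : Scheme.{u}} (φ : X ⟶ Z) {x : X} {z : Z} (h : φ x = z) :
    Z.presheaf.stalk z →+* X.presheaf.stalk x :=
  (Z.presheaf.stalkSpecializes (specializes_of_eq h) ≫ φ.stalkMap x).hom

/-- The germ at `x` of the pullback of a function on an affine base. -/
def scalarGerm {R : Type u} [CommRing R] {X : Scheme.{u}} (f : X ⟶ Spec (.of R)) (x : X) :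
    R →+* X.presheaf.stalk x :=
  ((Scheme.ΓSpecIso (.of R)).inv ≫ f.appTop ≫ X.presheaf.germ ⊤ x trivial).hom

/-! ### Residue disks and their coordinates -/

section Disk

variable {𝒪 : Type u} [CommRing 𝒪] [IsLocalRing 𝒪]

/-- The inclusion of the closed point. -/
abbrev closedPt (𝒪 : Type u) [CommRing 𝒪] [IsLocalRing 𝒪] :
    Spec (.of (IsLocalRing.ResidueField 𝒪)) ⟶ Spec (.of 𝒪) :=
  Spec.map (CommRingCat.ofHom (IsLocalRing.residue 𝒪))

/-- The residue disk `X(𝒪)_x`: the sections of `f` which reduce to the point `x` over the residue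
field. -/
structure ResidueDisk {X : Scheme.{u}} (f : X ⟶ Spec (.of 𝒪))
    (x : Spec (.of (IsLocalRing.ResidueField 𝒪)) ⟶ X) where
  /-- the underlying `𝒪`-point -/
  pt : Spec (.of 𝒪) ⟶ X
  pt_comp : pt ≫ f = 𝟙 _
  red : closedPt 𝒪 ≫ pt = x

/-- The point of the topological space of `X` underlying a point over the residue field. -/
abbrev center {X : Scheme.{u}} (x : Spec (.of (IsLocalRing.ResidueField 𝒪)) ⟶ X) : X :=
  x (IsLocalRing.closedPoint (IsLocalRing.ResidueField 𝒪))

theorem ResidueDisk.pt_closedPoint {X : Scheme.{u}} {f : X ⟶ Spec (.of 𝒪)}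
    {x : Spec (.of (IsLocalRing.ResidueField 𝒪)) ⟶ X} (g : ResidueDisk f x) :
    g.pt (IsLocalRing.closedPoint 𝒪) = center x := by
  obtain ⟨pt, -, rfl⟩ := g
  exact congrArg pt (IsLocalRing.comap_closedPoint (IsLocalRing.residue 𝒪)).symm

/-- The value at `g` of germs of functions at the center of the disk. -/
def ResidueDisk.eval {X : Scheme.{u}} {f : X ⟶ Spec (.of 𝒪)}
    {x : Spec (.of (IsLocalRing.ResidueField 𝒪)) ⟶ X} (g : ResidueDisk f x) :
    X.presheaf.stalk (center x) →+* 𝒪 :=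
  (X.presheaf.stalkSpecializes (specializes_of_eq g.pt_closedPoint) ≫
    Scheme.stalkClosedPointTo g.pt).hom

/-- The image of a point of the residue disk of `x` under a morphism `q` over `𝒪`, a point of the
residue disk of the image of `x`. -/
def ResidueDisk.map {X Z : Scheme.{u}} (q : X ⟶ Z) {f : Z ⟶ Spec (.of 𝒪)}
    {x : Spec (.of (IsLocalRing.ResidueField 𝒪)) ⟶ X}
    {z : Spec (.of (IsLocalRing.ResidueField 𝒪)) ⟶ Z} (h : x ≫ q = z)
    (g : ResidueDisk (q ≫ f) x) : ResidueDisk f z where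
  pt := g.pt ≫ q
  pt_comp := by rw [Category.assoc, g.pt_comp]
  red := by rw [← Category.assoc, g.red, h]

/-- The values at `g` of the functions `s i`, divided by `π`. (`Function.invFun (π * ·) a` is
`a / π` when `π` is a nonzero element of a domain which divides `a`.) -/
def ResidueDisk.coords {X : Scheme.{u}} {f : X ⟶ Spec (.of 𝒪)}
    {x : Spec (.of (IsLocalRing.ResidueField 𝒪)) ⟶ X} (π : 𝒪) {κ : Type*}
    (s : κ → X.presheaf.stalk (center x)) (g : ResidueDisk f x) : κ → 𝒪 :=
  fun i => Function.invFun (fun b : 𝒪 => π * b) (g.eval (s i))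

/-- `π` and the `s i` together generate the maximal ideal of the local ring of `X` at `x`. For `X`
smooth over a discrete valuation ring `𝒪` with uniformizer `π`, of relative dimension the number of
the `s i`, and `x` a point over the residue field, this says that they form a regular system of
parameters. -/
def IsParameterSystem {X : Scheme.{u}} (f : X ⟶ Spec (.of 𝒪)) (π : 𝒪) (x : X) {κ : Type*}
    (s : κ → X.presheaf.stalk x) : Prop :=
  Ideal.span (insert (scalarGerm f x π) (Set.range s)) =
    IsLocalRing.maximalIdeal (X.presheaf.stalk x)

end Disk

/-! ### The formal group of a group scheme along the identity section -/

/-- Let `ε : R → A` be a ring map (structure map), `I` an ideal of `A` and `t` a finite family of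
elements of `I`. The power series `f` over `R` is an expansion of `a : A` in terms of the `t i` if
`a` is the sum of the series `∑ ε (f_J) t ^ J` in the `I`-adic topology. -/
def IsExpansion {R A : Type*} [CommRing R] [CommRing A] (ε : R →+* A) (I : Ideal A)
    {σ : Type*} [Finite σ] (t : σ → A) (a : A) (f : MvPowerSeries σ R) : Prop :=
  ∀ N : ℕ, a - MvPolynomial.eval₂ ε t (MvPowerSeries.truncTotal N f) ∈ I ^ N

section GroupScheme

variable {Y G : Scheme.{u}} (q : G ⟶ Y) [GrpObj (Over.mk q)]

/-- The identity section of the group scheme `q : G ⟶ Y`. -/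
def idSection : Y ⟶ G := η[Over.mk q].left

theorem idSection_comp : idSection q ≫ q = 𝟙 Y := Over.w η[Over.mk q]

/-- The identity section of `G ×_Y G`. -/
def idSection₂ : Y ⟶ (Over.mk q ⊗ Over.mk q).left := (lift η[Over.mk q] η[Over.mk q]).left

theorem idSection₂_hom : idSection₂ q ≫ (Over.mk q ⊗ Over.mk q).hom = 𝟙 Y :=
  Over.w (lift η[Over.mk q] η[Over.mk q])

theorem idSection₂_fst : idSection₂ q ≫ (fst (Over.mk q) (Over.mk q)).left = idSection q := by
  rw [idSection₂, ← Over.comp_left, lift_fst, idSection]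

theorem idSection₂_snd : idSection₂ q ≫ (snd (Over.mk q) (Over.mk q)).left = idSection q := by
  rw [idSection₂, ← Over.comp_left, lift_snd, idSection]

theorem idSection₂_mul : idSection₂ q ≫ μ[Over.mk q].left = idSection q := by
  have h : lift η[Over.mk q] η[Over.mk q] ≫ μ[Over.mk q] = η[Over.mk q] := by
    have h1 : η[Over.mk q] = (1 : 𝟙_ (Over Y) ⟶ Over.mk q) := by
      rw [Hom.one_def, toUnit_unit, Category.id_comp]
    rw [h1, ← Hom.mul_def, one_mul]
  rw [idSection₂, ← Over.comp_left, h, idSection]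

variable (y : Y)

/-- The ideal of the identity section in the local ring of `G` at `e(y)`. -/
def augIdeal : Ideal (G.presheaf.stalk (idSection q y)) :=
  RingHom.ker (germPullback (idSection q) (x := y) rfl)

/-- The functions `t i`, germs at `e(y)`, lie in the ideal `I` of the identity section and form a
basis of `I / I ^ 2` (over the quotient of the local ring by `I`, that is, over `𝒪_{Y, y}`). -/
def IsFormalCoordinates {κ : Type*} (t : κ → G.presheaf.stalk (idSection q y)) : Prop :=
  ∃ h : ∀ i, t i ∈ augIdeal q y,
    LinearIndependent (G.presheaf.stalk (idSection q y) ⧸ augIdeal q y)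
      (fun i => (augIdeal q y).toCotangent ⟨t i, h i⟩) ∧
    Submodule.span (G.presheaf.stalk (idSection q y) ⧸ augIdeal q y)
      (Set.range fun i => (augIdeal q y).toCotangent ⟨t i, h i⟩) = ⊤

/-- `F` is the formal group law of `G` along the identity section in the coordinates `t`: the `i`-th
component is the expansion of the pullback of `t i` under the multiplication
`G ×_Y G ⟶ G`, in terms of the pullbacks `U j`, `V j` of the `t j` under the two projections. -/
def IsFormalGroupLawOf {κ : Type*} [Finite κ] (t : κ → G.presheaf.stalk (idSection q y))
    (F : κ → MvPowerSeries (κ ⊕ κ) (Y.presheaf.stalk y)) : Prop :=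
  ∀ i, IsExpansion
    (germPullback (Over.mk q ⊗ Over.mk q).hom (x := idSection₂ q y) (z := y)
      (by rw [← Scheme.Hom.comp_apply, idSection₂_hom]; rfl))
    (RingHom.ker (germPullback (idSection₂ q) (x := y) rfl))
    (Sum.elim
      (fun j => germPullback (fst (Over.mk q) (Over.mk q)).left (x := idSection₂ q y)
        (by rw [← Scheme.Hom.comp_apply, idSection₂_fst]) (t j))
      (fun j => germPullback (snd (Over.mk q) (Over.mk q)).left (x := idSection₂ q y)
        (by rw [← Scheme.Hom.comp_apply, idSection₂_snd]) (t j)))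
    (germPullback μ[Over.mk q].left (x := idSection₂ q y)
        (by rw [← Scheme.Hom.comp_apply, idSection₂_mul]) (t i))
    (F i)

end GroupScheme

/-! ### Formal logarithm and exponential of a formal group law -/

section FormalLog

variable {R : Type*} [CommRing R] {κ : Type*} [Fintype κ]

/-- The differential form `∑ j, ω j dt_j` is invariant for the formal group law `F(U, V)`: its
pullback under `U ↦ F(U, V)`, for constant `V`, is the form itself. -/
def IsInvariantDifferential (F : κ → MvPowerSeries (κ ⊕ κ) R) (ω : κ → MvPowerSeries κ R) : Prop :=
  ∀ k, ∑ j, MvPowerSeries.subst F (ω j) * MvPowerSeries.pderiv R (Sum.inl k) (F j) =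
    MvPowerSeries.subst (fun i => (MvPowerSeries.X (Sum.inl i) : MvPowerSeries (κ ⊕ κ) R)) (ω k)

/-- `L` is the formal logarithm of `F`, over `R ⊗ ℚ`: there is no constant term, the linear term of
`L i` is `t i`, and `d (L i)` is an invariant differential of `F` over `R`. -/
def IsFormalLog [DecidableEq κ] (F : κ → MvPowerSeries (κ ⊕ κ) R)
    (L : κ → MvPowerSeries κ (R ⊗[ℤ] ℚ)) : Prop :=
  ∀ i, MvPowerSeries.constantCoeff (L i) = 0 ∧
    (∀ j, MvPowerSeries.coeff (Finsupp.single j 1) (L i) = if i = j then 1 else 0) ∧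
    ∃ ω : κ → MvPowerSeries κ R, IsInvariantDifferential F ω ∧
      ∀ j, MvPowerSeries.pderiv (R ⊗[ℤ] ℚ) j (L i) =
        MvPowerSeries.map Algebra.TensorProduct.includeLeftRingHom (ω j)

/-- `E` is the formal exponential, the formal inverse of `L`: `E i (L) = t i`. -/
def IsFormalExp {K : Type*} [CommRing K] (L E : κ → MvPowerSeries κ K) : Prop :=
  ∀ i, MvPowerSeries.subst L (E i) = MvPowerSeries.X i

end FormalLog

section Induced

variable {𝒪 : Type u} [CommRing 𝒪] [IsLocalRing 𝒪]

/-- Evaluation at a point of the residue disk, extended to `𝒪_{X, x} ⊗ ℚ → 𝒪 ⊗ ℚ`. -/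
def ResidueDisk.evalQ {X : Scheme.{u}} {f : X ⟶ Spec (.of 𝒪)}
    {x : Spec (.of (IsLocalRing.ResidueField 𝒪)) ⟶ X} (g : ResidueDisk f x) :
    X.presheaf.stalk (center x) ⊗[ℤ] ℚ →+* 𝒪 ⊗[ℤ] ℚ :=
  (Algebra.TensorProduct.map g.eval.toIntAlgHom (AlgHom.id ℤ ℚ)).toRingHom

/-- Let `P` be power series in `t_1, …, t_m` with coefficients in `𝒪_{Y, y} ⊗ ℚ`. The
self-map `Φ` of `𝒪 ^ (n + m)` is induced by `P` if it is the identity on the first `n` coordinates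
(the coordinates `s` on the disk `Y(𝒪)_y`), and if the last `m` coordinates of `Φ(w)` are
`π⁻¹ P_i(π x)`, where `x` denotes the last `m` coordinates of `w` and the coefficients of `P_i` are
evaluated at the point of `Y(𝒪)_y` which corresponds to the first `n` coordinates. The
series are required to converge, to an element of `π 𝒪`. -/
def IsInducedBy {Y : Scheme.{u}} (f : Y ⟶ Spec (.of 𝒪))
    (y : Spec (.of (IsLocalRing.ResidueField 𝒪)) ⟶ Y) (π : 𝒪) {n m : ℕ}
    (s : Fin n → Y.presheaf.stalk (center y))
    (P : Fin m → MvPowerSeries (Fin m) (Y.presheaf.stalk (center y) ⊗[ℤ] ℚ))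
    (Φ : (Fin n ⊕ Fin m → 𝒪) → (Fin n ⊕ Fin m → 𝒪)) : Prop :=
  (∀ w i, Φ w (Sum.inl i) = w (Sum.inl i)) ∧
  ∀ (c : ResidueDisk f y) (x : Fin m → 𝒪) (i : Fin m),
    HasAdicSum 𝒪
      (fun J : Fin m →₀ ℕ => c.evalQ (MvPowerSeries.coeff J (P i)) *
        algebraMap 𝒪 (𝒪 ⊗[ℤ] ℚ) (J.prod fun j k => (π * x j) ^ k))
      (algebraMap 𝒪 (𝒪 ⊗[ℤ] ℚ) (π * Φ (Sum.elim (c.coords π s) x) (Sum.inr i)))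

/-- The map `Φ` is given by a tuple of convergent power series. -/
def IsGivenByConvergentSeries {A : Type*} [CommRing A] [IsLocalRing A] {σ τ : Type*}
    (Φ : (σ → A) → (τ → A)) : Prop :=
  ∃ P : τ → MvPowerSeries σ A, (∀ i, IsConvergent (P i)) ∧ ∀ w i, HasValue (P i) w (Φ w i)

/-- Multiplication by `z` on the fibres of `𝒪 ^ (n + m) → 𝒪 ^ n`. -/
def fibreSMul {Z : Type*} [SMul Z 𝒪] {σ τ : Type*} (z : Z) (w : σ ⊕ τ → 𝒪) : σ ⊕ τ → 𝒪 :=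
  Sum.elim (fun i => w (Sum.inl i)) (fun j => z • w (Sum.inr j))

end Induced

/-! ### The residue disk along the identity section and the `ℤ_p`-action -/

section Action

variable {𝒪 : Type u} [CommRing 𝒪] [IsLocalRing 𝒪] {Y G : Scheme.{u}} (q : G ⟶ Y)
  [GrpObj (Over.mk q)] (f : Y ⟶ Spec (.of 𝒪)) (y : Spec (.of (IsLocalRing.ResidueField 𝒪)) ⟶ Y)

/-- The residue disk `G(𝒪)_{e(y)}`. -/
abbrev GroupDisk : Type u := ResidueDisk (q ≫ f) (y ≫ idSection q)

variable {q f y}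

/-- The projection `G(𝒪)_{e(y)} → Y(𝒪)_y`. -/
def GroupDisk.proj (g : GroupDisk q f y) : ResidueDisk f y :=
  ResidueDisk.map q (by rw [Category.assoc, idSection_comp, Category.comp_id]) g

/-- The coordinates `(s / π, t / π)` on `G(𝒪)_{e(y)}`, where `s` consists of functions on the
base. -/
def GroupDisk.chart (π : 𝒪) {n m : ℕ} (s : Fin n → Y.presheaf.stalk (center y))
    (t : Fin m → G.presheaf.stalk (idSection q (center y))) (g : GroupDisk q f y) :
    Fin n ⊕ Fin m → 𝒪 :=
  Sum.elim (g.proj.coords π s) (ResidueDisk.coords (x := y ≫ idSection q) π t g)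

/-- The integer multiple `a · g` in the group of sections of `G` over the image of `g` in `Y(𝒪)`;
the group law on points is written multiplicatively in the code. -/
def GroupDisk.zmul (a : ℤ) (g : GroupDisk q f y) : Spec (.of 𝒪) ⟶ G :=
  ((Over.homMk g.pt rfl : Over.mk (g.pt ≫ q) ⟶ Over.mk q) ^ a).left

/-- `h` is the multiple `z · g` of `g` by the `p`-adic integer `z`, in the fibre of
`G(𝒪)_{e(y)} → Y(𝒪)_y` through `g`: for every `j` and every integer `a` which is congruent to `z`
modulo `p ^ j`, the points `h` and `a · g` agree modulo `p ^ j`. -/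
def IsPadicMultiple {p : ℕ} [Fact p.Prime] (z : ℤ_[p]) (g h : GroupDisk q f y) : Prop :=
  h.pt ≫ q = g.pt ≫ q ∧
  ∀ (j : ℕ) (a : ℤ), (p : ℤ_[p]) ^ j ∣ (a : ℤ_[p]) - z →
    Spec.map (CommRingCat.ofHom (Ideal.Quotient.mk (Ideal.span {(p : 𝒪) ^ j}))) ≫ h.pt =
      Spec.map (CommRingCat.ofHom (Ideal.Quotient.mk (Ideal.span {(p : 𝒪) ^ j}))) ≫ g.zmul a

end Action

end LogExp

end

open LogExp

noncomputable section

namespace LogExp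

/-! ### The order filtration on power series, and substitution -/

section Order

open MvPowerSeries

variable {σ τ υ R S : Type*} [CommRing R] [CommRing S]

/-! A point of a residue disk is a homomorphism from the local ring at its center to `𝒪`. Formal
smoothness expands this local ring in power series in the parameters, around a point of the disk of
`Y` or along the identity section of `G`. Parameters take values in `π𝒪` on the disk, where every
power series converges, and the values divided by `π` are arbitrary. This gives the coordinates
(`bijective_coords`, `GroupDisk.bijective_chart`).

The axioms of the formal group law are the group axioms for points with values in power series rings
(`IsFormalCoordinates.exists_isFormalGroupLawOf`). By associativity and commutativity the invariant
vector fields commute. The dual forms are therefore closed and can be integrated after tensoring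
with `ℚ`; the resulting logarithm is additive (`IsFormalGroup.exists_formalLog_formalExp`,
`IsLogOver.subst_eq`).

The arithmetic input is `e < p - 1`. As `dL_i` is integral, a coefficient of `L_i` at `t ^ b` has
denominator at most some `b_j ≤ |b|`, and `π ^ (|b| - 1) / b_j` is integral, tends to `0`, and lies
in `𝔪` for `|b| > 1` (`exists_natCast_mul_eq_pow`, `IsLogOver.exists_isScaling`). So `π⁻¹ L(π T)` is
convergent and congruent to the identity modulo `𝔪`. The exponential needs no estimate of its own:
the formal inverse of such a tuple converges by successive approximation
(`isConvergent_of_inverse`), and it is `π⁻¹ E(π T)` by uniqueness of inverses (`IsScaling.inverse`).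
Coefficients varying over the base are expanded in `π S`, which yields series in all coordinates
(`exists_total_coordinateChange`).

On each fibre `log (a · g) = a log g` for integers `a`, and `exp` preserves congruences. Hence `exp
(z log g)` agrees with `a · g` modulo `p ^ j` when `a ≡ z`, and it is the only such point because
`𝒪` is separated (`exists_action`). In a `ℤ_p`-basis the action is a composite of convergent series;
convergence passes to the coordinates because `𝔪 ^ (e N) = p ^ N 𝒪` (`exists_action_series`). -/

/-- The ideal of power series without terms of degree less than `N`. -/
def ordIdeal (σ R : Type*) [CommRing R] (N : ℕ) : Ideal (MvPowerSeries σ R) where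
  carrier := {f | ∀ J : σ →₀ ℕ, J.degree < N → coeff J f = 0}
  add_mem' hf hg J hJ := by rw [map_add, hf J hJ, hg J hJ, add_zero]
  zero_mem' J _ := map_zero _
  smul_mem' c f hf J hJ := by
    classical
    rw [smul_eq_mul, coeff_mul]
    refine Finset.sum_eq_zero fun x hx => ?_
    rw [hf x.2, mul_zero]
    rw [← Finset.HasAntidiagonal.mem_antidiagonal.mp hx, map_add] at hJ
    omega

theorem mem_ordIdeal {N : ℕ} {f : MvPowerSeries σ R} :
    f ∈ ordIdeal σ R N ↔ ∀ J : σ →₀ ℕ, J.degree < N → coeff J f = 0 := Iff.rfl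

theorem mem_ordIdeal_one {f : MvPowerSeries σ R} :
    f ∈ ordIdeal σ R 1 ↔ constantCoeff f = 0 := by
  rw [mem_ordIdeal]
  refine ⟨fun h => h 0 (by simp), fun h J hJ => ?_⟩
  have : J = 0 := by rw [← Finsupp.degree_eq_zero_iff]; omega
  rw [this]; exact h

theorem degree_eq_one {J : σ →₀ ℕ} (h : J.degree = 1) : ∃ j, J = Finsupp.single j 1 := by
  classical
  have h0 : J ≠ 0 := by rintro rfl; simp at h
  obtain ⟨j, hj⟩ : ∃ j, J j ≠ 0 := by
    by_contra! hc
    exact h0 (Finsupp.ext hc)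
  have h1 : J = (J - Finsupp.single j 1) + Finsupp.single j 1 :=
    (tsub_add_cancel_of_le (by simpa using Nat.one_le_iff_ne_zero.mpr hj)).symm
  refine ⟨j, ?_⟩
  have h2 : (J - Finsupp.single j 1).degree = 0 := by
    have := congrArg Finsupp.degree h1
    rw [map_add, Finsupp.degree_single] at this
    omega
  rw [Finsupp.degree_eq_zero_iff] at h2
  rw [h1, h2, zero_add]

theorem ordIdeal_zero : ordIdeal σ R 0 = ⊤ :=
  eq_top_iff.mpr fun _ _ _ hJ => absurd hJ (Nat.not_lt_zero _)

theorem ordIdeal_anti {M N : ℕ} (h : M ≤ N) : ordIdeal σ R N ≤ ordIdeal σ R M :=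
  fun _ hf J hJ => hf J (hJ.trans_le h)

theorem eq_zero_of_forall_mem_ordIdeal {f : MvPowerSeries σ R} (h : ∀ N, f ∈ ordIdeal σ R N) :
    f = 0 := by
  ext J; exact h (J.degree + 1) J (Nat.lt_succ_self _)

theorem mul_mem_ordIdeal {M N : ℕ} {f g : MvPowerSeries σ R} (hf : f ∈ ordIdeal σ R M)
    (hg : g ∈ ordIdeal σ R N) : f * g ∈ ordIdeal σ R (M + N) := by
  classical
  intro J hJ
  rw [coeff_mul]
  refine Finset.sum_eq_zero fun x hx => ?_
  rw [← Finset.HasAntidiagonal.mem_antidiagonal.mp hx, map_add] at hJ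
  rcases lt_or_ge x.1.degree M with h | h
  · rw [hf _ h, zero_mul]
  · rw [hg _ (by omega), mul_zero]

theorem ordIdeal_pow_le (M N : ℕ) : ordIdeal σ R M ^ N ≤ ordIdeal σ R (M * N) := by
  induction N with
  | zero => simp [ordIdeal_zero]
  | succ n ih =>
    rw [pow_succ, Nat.mul_succ]
    exact Ideal.mul_le.mpr fun f hf g hg => mul_mem_ordIdeal (ih hf) hg

theorem pow_mem_ordIdeal {f : MvPowerSeries σ R} (hf : constantCoeff f = 0) (k : ℕ) :
    f ^ k ∈ ordIdeal σ R k := by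
  have := ordIdeal_pow_le 1 k (Ideal.pow_mem_pow (mem_ordIdeal_one.mpr hf) k)
  rwa [one_mul] at this

theorem map_mem_ordIdeal (h : R →+* S) {N : ℕ} {f : MvPowerSeries σ R} (hf : f ∈ ordIdeal σ R N) :
    MvPowerSeries.map h f ∈ ordIdeal σ S N := fun J hJ => by rw [coeff_map, hf J hJ, map_zero]

theorem sub_truncTotal_mem_ordIdeal [Finite σ] (N : ℕ) (f : MvPowerSeries σ R) :
    f - (truncTotal N f : MvPolynomial σ R) ∈ ordIdeal σ R N := fun J hJ => by
  rw [map_sub, MvPolynomial.coeff_coe, coeff_truncTotal _ hJ, sub_self]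

theorem truncTotal_eq_of_sub_mem [Finite σ] {N : ℕ} {f g : MvPowerSeries σ R}
    (h : f - g ∈ ordIdeal σ R N) : truncTotal N f = truncTotal N g := by
  ext J
  rw [coeff_truncTotal_eq_ite, coeff_truncTotal_eq_ite]
  split_ifs with hJ
  · exact sub_eq_zero.mp (by rw [← map_sub]; exact h J hJ)
  · rfl

variable [Finite σ] [Algebra R S]

theorem hasSubst_of_zero {a : σ → MvPowerSeries τ S} (ha : ∀ i, constantCoeff (a i) = 0) :
    HasSubst a := hasSubst_of_constantCoeff_zero ha

omit [Finite σ] in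
theorem subst_zero_right {a : σ → MvPowerSeries τ S} (ha : HasSubst a) :
    subst a (0 : MvPowerSeries σ R) = 0 := by
  rw [← coe_substAlgHom ha, map_zero]

omit [Finite σ] in
theorem subst_one {a : σ → MvPowerSeries τ S} (ha : HasSubst a) :
    subst a (1 : MvPowerSeries σ R) = 1 := by
  rw [← coe_substAlgHom ha, map_one]

/-- A monomial of degree at least `N` turns into a product of at least `N` series without constant
term. Substitution is thus continuous for the order filtration, and its identities can be checked on
truncations. -/
theorem subst_mem_ordIdeal {a : σ → MvPowerSeries τ S} (ha : ∀ i, constantCoeff (a i) = 0)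
    {N : ℕ} {f : MvPowerSeries σ R} (hf : f ∈ ordIdeal σ R N) : subst a f ∈ ordIdeal τ S N := by
  intro e he
  rw [coeff_subst (hasSubst_of_zero ha)]
  refine finsum_eq_zero_of_forall_eq_zero fun d => ?_
  rcases lt_or_ge d.degree N with h | h
  · rw [hf d h, zero_smul]
  · have : (d.prod fun s k => a s ^ k) ∈ ordIdeal τ S d.degree := by
      classical
      clear h
      induction d using Finsupp.induction_linear with
      | zero => simp [ordIdeal_zero]
      | add d d' h h' =>
        rw [Finsupp.prod_add_index' (by simp) (by intros; rw [pow_add]), map_add]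
        exact mul_mem_ordIdeal h h'
      | single i k => simpa using pow_mem_ordIdeal (ha i) k
    rw [this e (he.trans_le h), smul_zero]

theorem constantCoeff_subst_of_zero {a : σ → MvPowerSeries τ S}
    (ha : ∀ i, constantCoeff (a i) = 0) (f : MvPowerSeries σ R) :
    constantCoeff (subst a f) = algebraMap R S (constantCoeff f) := by
  have h : f - C (constantCoeff f) ∈ ordIdeal σ R 1 := mem_ordIdeal_one.mpr (by simp)
  have h' := mem_ordIdeal_one.mp (subst_mem_ordIdeal ha h)
  rw [subst_sub (hasSubst_of_zero ha), map_sub, sub_eq_zero] at h'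
  rw [h', ← coe_substAlgHom (hasSubst_of_zero ha)]
  have : (C (constantCoeff f) : MvPowerSeries σ R) = algebraMap R _ (constantCoeff f) := rfl
  rw [this, AlgHom.commutes, MvPowerSeries.algebraMap_apply, constantCoeff_C]

theorem subst_subst [Finite τ] {T : Type*} [CommRing T] [Algebra R T] [Algebra S T]
    [IsScalarTower R S T] {a : σ → MvPowerSeries τ S} {b : τ → MvPowerSeries υ T}
    (ha : ∀ i, constantCoeff (a i) = 0) (hb : ∀ i, constantCoeff (b i) = 0)
    (f : MvPowerSeries σ R) :
    subst b (subst a f) = subst (fun i => subst b (a i)) f :=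
  subst_comp_subst_apply (hasSubst_of_zero ha) (hasSubst_of_zero hb) f

/-- A tuple of power series which is the identity up to terms of degree at least two. -/
def IsTangentToId (P : σ → MvPowerSeries σ R) : Prop :=
  ∀ i, P i - X i ∈ ordIdeal σ R 2

/-! ### Formal inversion of tuples tangent to the identity -/

section FormalInverse

variable {P Q : σ → MvPowerSeries σ R}

omit [Finite σ] in
theorem IsTangentToId.constantCoeff (hP : IsTangentToId P) (i : σ) :
    MvPowerSeries.constantCoeff (P i) = 0 := by
  have := mem_ordIdeal_one.mp (ordIdeal_anti one_le_two (hP i))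
  rwa [map_sub, constantCoeff_X, sub_zero] at this

omit [Finite σ] in
theorem isTangentToId_iff [DecidableEq σ] : IsTangentToId P ↔ ∀ i, MvPowerSeries.constantCoeff (P i) = 0 ∧
    ∀ j, coeff (Finsupp.single j 1) (P i) = if i = j then 1 else 0 := by
  refine ⟨fun h i => ⟨h.constantCoeff i, fun j => ?_⟩, fun h i J hJ => ?_⟩
  · have := h i (Finsupp.single j 1) (by simp)
    rw [map_sub, sub_eq_zero] at this
    rw [this, coeff_X]
    simp only [Finsupp.single_left_inj one_ne_zero, eq_comm]
  · have : J.degree = 0 ∨ J.degree = 1 := by omega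
    rcases this with h0 | h1
    · rw [Finsupp.degree_eq_zero_iff] at h0
      subst h0
      simpa using (h i).1
    · obtain ⟨j, rfl⟩ := degree_eq_one h1
      rw [map_sub, (h i).2, coeff_X]
      simp only [Finsupp.single_left_inj one_ne_zero, eq_comm, sub_self]

-- Leading forms multiply, and every error term gains one degree.
omit [Finite σ] in
theorem IsTangentToId.prod_sub_mem (hP : IsTangentToId P) (d : σ →₀ ℕ) :
    (d.prod fun s k => P s ^ k) - monomial d 1 ∈ ordIdeal σ R (d.degree + 1) := by
  have hX : ∀ d : σ →₀ ℕ, (monomial d (1 : R) : MvPowerSeries σ R) ∈ ordIdeal σ R d.degree := by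
    classical
    intro d J hJ
    rw [coeff_monomial, if_neg]
    rintro rfl; exact lt_irrefl _ hJ
  have key : ∀ (M N : ℕ) (f f' g g' : MvPowerSeries σ R), f' ∈ ordIdeal σ R M →
      g' ∈ ordIdeal σ R N → f - f' ∈ ordIdeal σ R (M + 1) → g - g' ∈ ordIdeal σ R (N + 1) →
      f * g - f' * g' ∈ ordIdeal σ R (M + N + 1) := by
    intro M N f f' g g' hf' hg' hf hg
    have e : f * g - f' * g' = (f - f') * g' + f' * (g - g') + (f - f') * (g - g') := by ring
    rw [e]
    refine add_mem (add_mem ?_ ?_) ?_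
    · exact ordIdeal_anti (by omega) (mul_mem_ordIdeal hf hg')
    · exact ordIdeal_anti (by omega) (mul_mem_ordIdeal hf' hg)
    · exact ordIdeal_anti (by omega) (mul_mem_ordIdeal hf hg)
  induction d using Finsupp.induction_linear with
  | zero => simp
  | add d d' h h' =>
    rw [Finsupp.prod_add_index' (by simp) (by intros; rw [pow_add]), map_add, ← one_mul (1 : R),
      ← monomial_mul_monomial]
    exact key _ _ _ _ _ _ (hX d) (hX d') h h'
  | single i k =>
    rw [Finsupp.prod_single_index (by simp), Finsupp.degree_single]
    induction k with
    | zero => simp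
    | succ k ih =>
      rw [Finsupp.single_add, pow_succ, ← one_mul (1 : R), ← monomial_mul_monomial]
      refine key k 1 _ _ _ _ ?_ ?_ ih (hP i)
      · simpa using hX (Finsupp.single i k)
      · simpa using hX (Finsupp.single i 1)

/-- Up to degree `N` the substitution acts as the identity on series starting in degree `N`. So `1 -
subst P` raises the order by one, which makes `subst P` bijective. -/
theorem IsTangentToId.sub_subst_mem (hP : IsTangentToId P) {N : ℕ} {f : MvPowerSeries σ R}
    (hf : f ∈ ordIdeal σ R N) : f - subst P f ∈ ordIdeal σ R (N + 1) := by
  have hs := hasSubst_of_zero hP.constantCoeff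
  intro e he
  rw [map_sub, sub_eq_zero, coeff_subst hs, finsum_eq_single _ e]
  · have := hP.prod_sub_mem e e (Nat.lt_succ_self _)
    rw [map_sub, coeff_monomial_same, sub_eq_zero] at this
    rw [this, smul_eq_mul, mul_one]
  · intro d hd
    rcases lt_or_ge d.degree N with h | h
    · rw [hf d h, zero_smul]
    · have := hP.prod_sub_mem d e (by omega)
      rw [map_sub, coeff_monomial_ne hd.symm, sub_zero] at this
      rw [this, smul_zero]

theorem IsTangentToId.subst_injective (hP : IsTangentToId P) :
    Function.Injective (subst P : MvPowerSeries σ R → MvPowerSeries σ R) := by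
  have hs := hasSubst_of_zero hP.constantCoeff
  intro f g hfg
  rw [← sub_eq_zero]
  refine eq_zero_of_forall_mem_ordIdeal fun N => ?_
  induction N with
  | zero => rw [ordIdeal_zero]; trivial
  | succ N ih => simpa [subst_sub hs, hfg] using hP.sub_subst_mem ih

theorem IsTangentToId.subst_surjective (hP : IsTangentToId P) :
    Function.Surjective (subst P : MvPowerSeries σ R → MvPowerSeries σ R) := by
  have hs := hasSubst_of_zero hP.constantCoeff
  intro f
  -- `D k = (1 - subst P)^k f` has order at least `k`; the preimage of `f` is the Neumann series,
  -- the sum of all `D k`.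
  let D : ℕ → MvPowerSeries σ R := fun k => (fun g => g - subst P g)^[k] f
  have hD : ∀ k, D k ∈ ordIdeal σ R k := by
    intro k
    induction k with
    | zero => rw [ordIdeal_zero]; trivial
    | succ k ih => simp only [D, Function.iterate_succ_apply']; exact hP.sub_subst_mem ih
  -- Only `D 0, …, D |J|` contribute to the coefficient at `J`.
  let q : MvPowerSeries σ R := fun J => coeff J (∑ k ∈ Finset.range (J.degree + 1), D k)
  have hq : ∀ N, q - ∑ k ∈ Finset.range N, D k ∈ ordIdeal σ R N := by
    intro N J hJ
    have e : coeff J q = coeff J (∑ k ∈ Finset.range (J.degree + 1), D k) := rfl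
    rw [map_sub, e, sub_eq_zero, map_sum, map_sum]
    refine Finset.sum_subset (Finset.range_mono hJ) fun k _ hk => ?_
    exact hD k J (by simpa using hk)
  have hsum : ∀ N, subst P (∑ k ∈ Finset.range N, D k) = f - D N := by
    intro N
    induction N with
    | zero => simp [D, subst_zero_right hs]
    | succ N ih =>
      rw [Finset.sum_range_succ, subst_add hs, ih]
      simp only [D, Function.iterate_succ_apply']
      ring
  refine ⟨q, ?_⟩
  rw [← sub_eq_zero]
  refine eq_zero_of_forall_mem_ordIdeal fun N => ?_
  have := subst_mem_ordIdeal hP.constantCoeff (hq N)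
  rw [subst_sub hs, hsum] at this
  have h2 := sub_mem this (hD N)
  convert h2 using 1
  ring

/-- A tuple of power series which is tangent to the identity has a formal inverse. -/
theorem IsTangentToId.exists_inverse (hP : IsTangentToId P) : ∃ Q : σ → MvPowerSeries σ R,
    IsTangentToId Q ∧ (∀ i, subst P (Q i) = X i) ∧ ∀ i, subst Q (P i) = X i := by
  have main : ∀ P : σ → MvPowerSeries σ R, IsTangentToId P →
      ∃ Q : σ → MvPowerSeries σ R, IsTangentToId Q ∧ ∀ i, subst P (Q i) = X i := by
    intro P hP
    choose Q hQ using fun i => hP.subst_surjective (X i)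
    have hs := hasSubst_of_zero hP.constantCoeff
    have h0 : ∀ i, MvPowerSeries.constantCoeff (Q i) = 0 := fun i => by
      have := constantCoeff_subst_of_zero hP.constantCoeff (Q i)
      rw [hQ, constantCoeff_X] at this
      exact this.symm
    refine ⟨Q, fun i => ?_, hQ⟩
    have := hP.sub_subst_mem (mem_ordIdeal_one.mpr (h0 i))
    rwa [hQ] at this
  obtain ⟨Q, hQ, hPQ⟩ := main P hP
  obtain ⟨P', hP', hQP'⟩ := main Q hQ
  refine ⟨Q, hQ, hPQ, fun i => ?_⟩
  -- A left and a right inverse of `Q` agree: substitute `P` into `P'(Q) = X`.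
  have : P' i = P i := by
    have h := subst_subst hQ.constantCoeff hP.constantCoeff (P' i)
    rw [hQP', subst_X (hasSubst_of_zero hP.constantCoeff), funext hPQ, subst_self, id] at h
    exact h.symm
  rw [← this, hQP']

end FormalInverse

/-! ### Partial derivatives and the chain rule -/

section ChainRule

omit [Finite σ]

theorem pderiv_mem_ordIdeal {N : ℕ} {f : MvPowerSeries σ R} (i : σ)
    (hf : f ∈ ordIdeal σ R (N + 1)) : pderiv R i f ∈ ordIdeal σ R N := fun J hJ => by
  rw [coeff_pderiv, hf _ (by rw [map_add, Finsupp.degree_single]; omega), zero_mul]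

theorem pderiv_comm (i j : σ) (f : MvPowerSeries σ R) :
    pderiv R i (pderiv R j f) = pderiv R j (pderiv R i f) := by
  classical
  ext J
  simp only [coeff_pderiv]
  rw [add_right_comm]
  by_cases h : i = j
  · rw [h]
  · simp [h, Ne.symm h]
    ring

omit [Algebra R S] in
theorem pderiv_map (h : R →+* S) (i : σ) (f : MvPowerSeries σ R) :
    pderiv S i (MvPowerSeries.map h f) = MvPowerSeries.map h (pderiv R i f) := by
  ext J
  simp [coeff_pderiv]

/-- The chain rule. -/
theorem pderiv_subst {σ τ R : Type*} [CommRing R] [Fintype σ] [Finite τ]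
    {a : σ → MvPowerSeries τ R}
    (ha : ∀ i, constantCoeff (a i) = 0) (k : τ) (f : MvPowerSeries σ R) :
    pderiv R k (subst a f) = ∑ i, subst a (pderiv R i f) * pderiv R k (a i) := by
  classical
  have hs := hasSubst_of_zero ha
  have poly : ∀ p : MvPolynomial σ R, pderiv R k (subst a (p : MvPowerSeries σ R)) =
      ∑ i, subst a (pderiv R i (p : MvPowerSeries σ R)) * pderiv R k (a i) := by
    intro p
    induction p using MvPolynomial.induction_on with
    | C r =>
      simp [MvPolynomial.coe_C, subst_zero_right hs]
    | add p q hp hq =>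
      simp only [MvPolynomial.coe_add, subst_add hs, map_add, hp, hq, add_mul,
        Finset.sum_add_distrib]
    | mul_X p j hp =>
      simp only [MvPolynomial.coe_mul, MvPolynomial.coe_X, subst_mul hs, subst_X hs,
        Derivation.leibniz, smul_eq_mul, subst_add hs, hp, add_mul, Finset.sum_add_distrib,
        Finset.mul_sum]
      congr 1
      · rw [Finset.sum_eq_single j]
        · rw [pderiv_X_self, subst_one hs, mul_one]
        · intro i _ hi
          rw [pderiv_X_of_ne hi.symm, subst_zero_right hs, mul_zero, zero_mul]
        · simp
      · refine Finset.sum_congr rfl fun i _ => by ring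
  rw [← sub_eq_zero]
  refine eq_zero_of_forall_mem_ordIdeal fun N => ?_
  -- Truncate one degree beyond `N`, since a derivative lowers the order by one; the polynomial part
  -- is the case `poly`.
  have h1 := sub_truncTotal_mem_ordIdeal (N + 1) f
  set p := truncTotal (N + 1) f
  have e : f = (f - (p : MvPowerSeries σ R)) + p := by ring
  set g := f - (p : MvPowerSeries σ R)
  rw [e]
  simp only [subst_add hs, map_add, poly, add_mul, Finset.sum_add_distrib, add_sub_add_right_eq_sub]
  refine sub_mem (pderiv_mem_ordIdeal _ (subst_mem_ordIdeal ha h1)) (sum_mem fun i _ => ?_)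
  exact Ideal.mul_mem_right _ _ (subst_mem_ordIdeal ha (pderiv_mem_ordIdeal _ h1))

/-- Over a `ℚ`-algebra, a power series is determined by its partial derivatives and its constant
term. -/
theorem eq_of_pderiv_eq [Algebra ℚ R] {f g : MvPowerSeries σ R}
    (h : ∀ i, pderiv R i f = pderiv R i g) (h0 : constantCoeff f = constantCoeff g) : f = g := by
  ext J
  by_cases hJ : J = 0
  · rw [hJ]; exact h0
  · obtain ⟨i, hi⟩ : ∃ i, J i ≠ 0 := by
      by_contra! hc
      exact hJ (Finsupp.ext hc)
    obtain ⟨J', h1⟩ : ∃ J', J = J' + Finsupp.single i 1 := ⟨J - Finsupp.single i 1,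
      (tsub_add_cancel_of_le (by simpa using Nat.one_le_iff_ne_zero.mpr hi)).symm⟩
    have h2 := congrArg (coeff J') (h i)
    rw [coeff_pderiv, coeff_pderiv, ← h1] at h2
    have h3 : IsUnit ((J' i + 1 : ℕ) : R) := by
      have := (IsUnit.mk0 ((J' i + 1 : ℕ) : ℚ)
        (by exact_mod_cast Nat.succ_ne_zero (J' i))).map (algebraMap ℚ R)
      simpa using this
    exact h3.mul_right_cancel (by push_cast; exact h2)

end ChainRule

end Order

/-! ### Commutative formal group laws, invariant differentials and the logarithm -/

section FormalGroup

open MvPowerSeries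

variable {R S : Type*} [CommRing R] [CommRing S] {κ τ : Type*}

/-- The variables `X (e i)`. -/
abbrev vars (R : Type*) [CommRing R] {κ τ : Type*} (e : κ → τ) : κ → MvPowerSeries τ R :=
  fun i => X (e i)

/-- Commutative formal group laws. -/
structure IsFormalGroup (F : κ → MvPowerSeries (κ ⊕ κ) R) : Prop where
  zero : ∀ i, constantCoeff (F i) = 0
  zero_left : ∀ i, subst (Sum.elim (fun _ => 0) X : κ ⊕ κ → MvPowerSeries κ R) (F i) = X i
  comm : ∀ i, subst (Sum.elim (vars R Sum.inr) (vars R Sum.inl) :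
    κ ⊕ κ → MvPowerSeries (κ ⊕ κ) R) (F i) = F i
  assoc : ∀ i, subst (Sum.elim
      (fun j => subst (Sum.elim (vars R Sum.inl) (vars R (Sum.inr ∘ Sum.inl)) :
        κ ⊕ κ → MvPowerSeries (κ ⊕ (κ ⊕ κ)) R) (F j))
      (vars R (Sum.inr ∘ Sum.inr)) : κ ⊕ κ → MvPowerSeries (κ ⊕ (κ ⊕ κ)) R) (F i) =
    subst (Sum.elim (vars R Sum.inl)
      (fun j => subst (Sum.elim (vars R (Sum.inr ∘ Sum.inl)) (vars R (Sum.inr ∘ Sum.inr)) :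
        κ ⊕ κ → MvPowerSeries (κ ⊕ (κ ⊕ κ)) R) (F j)) :
          κ ⊕ κ → MvPowerSeries (κ ⊕ (κ ⊕ κ)) R) (F i)

theorem constantCoeff_elim {a b : κ → MvPowerSeries τ R} (ha : ∀ i, constantCoeff (a i) = 0)
    (hb : ∀ i, constantCoeff (b i) = 0) (i : κ ⊕ κ) : constantCoeff (Sum.elim a b i) = 0 := by
  cases i
  · exact ha _
  · exact hb _

theorem constantCoeff_vars (e : κ → τ) (i : κ) : constantCoeff (vars R e i) = 0 :=
  constantCoeff_X _

theorem constantCoeff_elim_zero_X {τ : Type*} (i : τ ⊕ κ) :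
    constantCoeff ((Sum.elim (fun _ => 0) X : τ ⊕ κ → MvPowerSeries κ R) i) = 0 := by
  cases i <;> simp

variable [Fintype κ] [DecidableEq κ] {F : κ → MvPowerSeries (κ ⊕ κ) R}

/-- The matrix `∂F_j / ∂U_k (0, V)`, whose columns are the invariant vector fields. -/
def invariantFields (F : κ → MvPowerSeries (κ ⊕ κ) R) : Matrix κ κ (MvPowerSeries κ R) :=
  Matrix.of fun j k => subst (Sum.elim (fun _ => 0) X : κ ⊕ κ → MvPowerSeries κ R)
    (pderiv R (Sum.inl k) (F j))

omit [Fintype κ] [DecidableEq κ] in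
theorem invariantFields_apply (j k : κ) : invariantFields F j k =
    subst (Sum.elim (fun _ => 0) X : κ ⊕ κ → MvPowerSeries κ R) (pderiv R (Sum.inl k) (F j)) := rfl

/-- The matrix of coefficients of the basic invariant differentials. -/
def invariantForms (F : κ → MvPowerSeries (κ ⊕ κ) R) : Matrix κ κ (MvPowerSeries κ R) :=
  (invariantFields F)⁻¹

omit [Fintype κ] in
theorem pderiv_X_eq_ite (i j : κ) :
    pderiv R i (X j : MvPowerSeries κ R) = if i = j then 1 else 0 := by
  split_ifs with h
  · rw [h, pderiv_X_self]
  · exact pderiv_X_of_ne (Ne.symm h)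

omit [DecidableEq κ] in
theorem pderiv_subst_elim [Finite τ] {a b : κ → MvPowerSeries τ R}
    (ha : ∀ i, constantCoeff (a i) = 0) (hb : ∀ i, constantCoeff (b i) = 0) (k : τ)
    (f : MvPowerSeries (κ ⊕ κ) R) :
    pderiv R k (subst (Sum.elim a b) f) =
      ∑ i, subst (Sum.elim a b) (pderiv R (Sum.inl i) f) * pderiv R k (a i) +
      ∑ i, subst (Sum.elim a b) (pderiv R (Sum.inr i) f) * pderiv R k (b i) := by
  rw [pderiv_subst (constantCoeff_elim ha hb), Fintype.sum_sum_type]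
  rfl

omit [DecidableEq κ] in
/-- The coefficients of a power series substituted at zero. -/
theorem constantCoeff_subst_self {σ : Type*} [Finite σ] {a : σ → MvPowerSeries τ R}
    (ha : ∀ i, constantCoeff (a i) = 0) (f : MvPowerSeries σ R) :
    constantCoeff (subst a f) = constantCoeff f := constantCoeff_subst_of_zero ha f

/-- Restriction to `U = 0` commutes with the derivatives with respect to `V`. -/
theorem pderiv_subst_zero (k : κ) (f : MvPowerSeries (κ ⊕ κ) R) :
    pderiv R k (subst (Sum.elim (fun _ => 0) X : κ ⊕ κ → MvPowerSeries κ R) f) =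
      subst (Sum.elim (fun _ => 0) X : κ ⊕ κ → MvPowerSeries κ R) (pderiv R (Sum.inr k) f) := by
  rw [pderiv_subst_elim (by simp) (by simp)]
  simp [pderiv_X_eq_ite]

/-- Restriction to `U = 0` only gives access to derivatives in `V`; commutativity transfers what the
left unit axiom says about them to the derivatives in `U`. -/
theorem IsFormalGroup.pderiv_inl (hF : IsFormalGroup F) (k j : κ) :
    pderiv R (Sum.inl k) (F j) = subst (Sum.elim (vars R Sum.inr) (vars R Sum.inl) :
      κ ⊕ κ → MvPowerSeries (κ ⊕ κ) R) (pderiv R (Sum.inr k) (F j)) := by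
  conv_lhs => rw [← hF.comm j]
  rw [pderiv_subst_elim (constantCoeff_vars _) (constantCoeff_vars _)]
  simp [pderiv_X_eq_ite]

theorem IsFormalGroup.constantCoeff_pderiv_inl (hF : IsFormalGroup F) (k j : κ) :
    constantCoeff (pderiv R (Sum.inl k) (F j)) = if k = j then 1 else 0 := by
  have h1 := congrArg (fun f => constantCoeff (pderiv R k f)) (hF.zero_left j)
  simp only [pderiv_subst_zero, constantCoeff_subst_self constantCoeff_elim_zero_X,
    pderiv_X_eq_ite] at h1
  rw [hF.pderiv_inl, constantCoeff_subst_self (constantCoeff_elim (constantCoeff_vars _)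
    (constantCoeff_vars _)), h1]
  split_ifs <;> simp

theorem IsFormalGroup.constantCoeff_invariantFields (hF : IsFormalGroup F) :
    (invariantFields F).map (constantCoeff (σ := κ) (R := R)) = 1 := by
  ext j k
  rw [Matrix.map_apply, invariantFields, Matrix.of_apply,
    constantCoeff_subst_self constantCoeff_elim_zero_X, hF.constantCoeff_pderiv_inl,
    Matrix.one_apply]
  simp only [eq_comm]

theorem IsFormalGroup.isUnit_det (hF : IsFormalGroup F) : IsUnit (invariantFields F).det := by
  rw [isUnit_iff_constantCoeff, RingHom.map_det, RingHom.mapMatrix_apply,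
    hF.constantCoeff_invariantFields, Matrix.det_one]
  exact isUnit_one

theorem IsFormalGroup.constantCoeff_invariantForms (hF : IsFormalGroup F) :
    (invariantForms F).map (constantCoeff (σ := κ) (R := R)) = 1 := by
  have h := congrArg (constantCoeff (σ := κ) (R := R)).mapMatrix
    (Matrix.nonsing_inv_mul _ hF.isUnit_det)
  rwa [map_mul, map_one, RingHom.mapMatrix_apply, RingHom.mapMatrix_apply,
    hF.constantCoeff_invariantFields, mul_one] at h

omit [DecidableEq κ] in
theorem IsFormalGroup.subst_zero_left [Finite τ] (hF : IsFormalGroup F)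
    {b : κ → MvPowerSeries τ R}
    (hb : ∀ i, constantCoeff (b i) = 0) (i : κ) : subst (Sum.elim (fun _ => 0) b) (F i) = b i := by
  have hs := hasSubst_of_zero hb
  have h := congrArg (subst b) (hF.zero_left i)
  rw [subst_subst constantCoeff_elim_zero_X hb, subst_X hs] at h
  rw [← h]
  congr 1
  funext t
  rcases t with t | t
  · simp [subst_zero_right hs]
  · simp [subst_X hs]

/-- The invariance of the vector fields, from the associativity of `F`. -/
theorem IsFormalGroup.sum_pderiv_mul (hF : IsFormalGroup F) (i k : κ) :
    ∑ j, pderiv R (Sum.inl j) (F i) *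
        subst (vars R Sum.inl : κ → MvPowerSeries (κ ⊕ κ) R) (invariantFields F j k) =
      subst F (invariantFields F i k) := by
  have hv := @constantCoeff_vars R _
  have h0 : ∀ i : κ ⊕ (κ ⊕ κ), constantCoeff ((Sum.elim (fun _ => 0) X :
    κ ⊕ (κ ⊕ κ) → MvPowerSeries (κ ⊕ κ) R) i) = 0 := constantCoeff_elim_zero_X
  have hs0 := hasSubst_of_zero h0
  have hc : ∀ (a b : κ → MvPowerSeries (κ ⊕ (κ ⊕ κ)) R), (∀ i, constantCoeff (a i) = 0) →
      (∀ i, constantCoeff (b i) = 0) → ∀ i, constantCoeff (subst (Sum.elim a b) (F i)) = 0 :=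
    fun a b ha hb i => by rw [constantCoeff_subst_self (constantCoeff_elim ha hb), hF.zero]
  -- Differentiate `F(F(U,V),W) = F(U,F(V,W))` in `U_k` and set `U = 0`; then `V` and `W` become the
  -- two groups of variables of the statement.
  have h := congrArg (fun f => subst (Sum.elim (fun _ => 0) X :
    κ ⊕ (κ ⊕ κ) → MvPowerSeries (κ ⊕ κ) R) (pderiv R (Sum.inl k) f)) (hF.assoc i)
  beta_reduce at h
  rw [pderiv_subst_elim (hc _ _ (hv _) (hv _)) (hv _),
    pderiv_subst_elim (hv _) (hc _ _ (hv _) (hv _))] at h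
  simp only [pderiv_subst_elim (hv _) (hv _), pderiv_X_eq_ite, Function.comp_apply, reduceCtorEq,
    if_false, mul_zero, Finset.sum_const_zero, add_zero, Sum.inl.injEq, mul_ite, mul_one,
    Finset.sum_ite_eq, Finset.mem_univ, if_true] at h
  rw [← coe_substAlgHom hs0, map_sum] at h
  simp only [map_mul, coe_substAlgHom hs0] at h
  rw [subst_subst (constantCoeff_elim (hv _) (hc _ _ (hv _) (hv _))) h0] at h
  simp only [subst_subst (constantCoeff_elim (hv _) (hv _)) h0,
    subst_subst (constantCoeff_elim (hc _ _ (hv _) (hv _)) (hv _)) h0] at h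
  simp only [invariantFields_apply]
  rw [subst_subst constantCoeff_elim_zero_X hF.zero]
  convert h using 2
  · rename_i j _
    congr 1
    · conv_lhs => rw [← id_eq (pderiv R (Sum.inl j) (F i)), ← subst_self]
      congr 1
      funext s
      rcases s with s | s
      · simp only [Sum.elim_inl]
        rw [subst_subst (constantCoeff_elim (hv _) (hv _)) h0]
        refine (hF.subst_zero_left (hv (Sum.inl : κ → κ ⊕ κ)) s).symm.trans ?_
        congr 1
        funext t
        rcases t with t | t <;> simp [subst_X hs0]
      · simp [subst_X hs0]
    · rw [subst_subst constantCoeff_elim_zero_X (hv _)]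
      congr 1
      funext s
      rcases s with s | s
      · simp [subst_X hs0, subst_zero_right (hasSubst_of_zero (hv _))]
      · simp [subst_X hs0, subst_X (hasSubst_of_zero (hv _))]
  · funext s
    rcases s with s | s
    · simp [subst_X hs0, subst_zero_right (hasSubst_of_zero hF.zero)]
    · simp only [Sum.elim_inr]
      rw [subst_X (hasSubst_of_zero hF.zero), subst_subst (constantCoeff_elim (hv _) (hv _)) h0]
      conv_lhs => rw [← id_eq (F s), ← subst_self]
      congr 1
      funext t
      rcases t with t | t <;> simp [subst_X hs0]

/-- The basic differentials are invariant. -/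
theorem IsFormalGroup.isInvariantDifferential (hF : IsFormalGroup F) (i : κ) :
    IsInvariantDifferential F (invariantForms F i) := by
  have hsF := hasSubst_of_zero hF.zero
  have hsv := hasSubst_of_zero (constantCoeff_vars (R := R) (Sum.inl : κ → κ ⊕ κ))
  let f₁ := (substAlgHom (R := R) hsF).toRingHom.mapMatrix (m := κ)
  let f₂ := (substAlgHom (R := R) hsv).toRingHom.mapMatrix (m := κ)
  let D : Matrix κ κ (MvPowerSeries (κ ⊕ κ) R) :=
    Matrix.of fun j k => pderiv R (Sum.inl k) (F j)
  -- With `M` the matrix of fields, this is `D · M(U) = M(F)`. Inverting both matrices gives `M⁻¹(F)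
  -- · D = M⁻¹(U)`, the invariance of the rows of `M⁻¹`.
  have h1 : D * f₂ (invariantFields F) = f₁ (invariantFields F) := by
    ext1 i k
    simpa [Matrix.mul_apply, D, f₁, f₂] using hF.sum_pderiv_mul i k
  have h2 : f₁ (invariantForms F) * f₁ (invariantFields F) = 1 := by
    rw [← map_mul, invariantForms, Matrix.nonsing_inv_mul _ hF.isUnit_det, map_one]
  have h3 : f₂ (invariantFields F) * f₂ (invariantForms F) = 1 := by
    rw [← map_mul, invariantForms, Matrix.mul_nonsing_inv _ hF.isUnit_det, map_one]
  have h4 : f₁ (invariantForms F) * D = f₂ (invariantForms F) := by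
    rw [← mul_one (_ * D), ← h3, ← mul_assoc, mul_assoc _ D, h1, h2, one_mul]
  intro k
  have h5 := congrFun (congrFun h4 i) k
  simpa [Matrix.mul_apply, D, f₁, f₂] using h5

/-- An invariant differential is determined by its value at the origin. -/
theorem IsFormalGroup.eq_of_isInvariantDifferential (hF : IsFormalGroup F)
    {ω : κ → MvPowerSeries κ R} (hω : IsInvariantDifferential F ω) (k : κ) :
    ω k = ∑ j, C (constantCoeff (ω j)) * invariantForms F j k := by
  have h0 := @constantCoeff_elim_zero_X R _ κ κ
  have hs0 := hasSubst_of_zero h0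
  -- Put `U = 0` in the invariance identity: the pullback becomes the pairing of `ω` with the
  -- invariant fields, and the right side the constant `ω(0)`.
  have h1 : Matrix.vecMul ω (invariantFields F) = fun k => C (constantCoeff (ω k)) := by
    funext k
    have h := congrArg (subst (Sum.elim (fun _ => 0) X : κ ⊕ κ → MvPowerSeries κ R)) (hω k)
    rw [← coe_substAlgHom hs0, map_sum] at h
    simp only [map_mul, coe_substAlgHom hs0] at h
    simp only [subst_subst hF.zero h0, hF.zero_left, subst_subst (constantCoeff_vars _) h0,
      subst_X hs0, Sum.elim_inl] at h
    have e : (fun i : κ => (X i : MvPowerSeries κ R)) = X := rfl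
    rw [e, subst_self] at h
    simp only [id] at h
    have h2 : subst (fun _ : κ => (0 : MvPowerSeries κ R)) (ω k) = C (constantCoeff (ω k)) := by
      exact subst_zero_eq_C_constantCoeff
    rw [← h2, ← h]
    rfl
  have h3 : ω = Matrix.vecMul (fun k => C (constantCoeff (ω k))) (invariantForms F) := by
    rw [← h1, Matrix.vecMul_vecMul, invariantForms, Matrix.mul_nonsing_inv _ hF.isUnit_det,
      Matrix.vecMul_one]
  exact congrFun h3 k

/-- The invariant vector fields commute. -/
theorem IsFormalGroup.sum_pderiv_invariantFields_comm (hF : IsFormalGroup F) (i k l : κ) :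
    ∑ j, pderiv R j (invariantFields F i k) * invariantFields F j l =
      ∑ j, pderiv R j (invariantFields F i l) * invariantFields F j k := by
  have h0 := @constantCoeff_elim_zero_X R _ κ κ
  have hs0 := hasSubst_of_zero h0
  have hc : ∀ k l j, constantCoeff (pderiv R l (invariantFields F j k)) =
      constantCoeff (pderiv R (Sum.inr l) (pderiv R (Sum.inl k) (F j))) := fun k l j => by
    rw [invariantFields_apply, pderiv_subst_zero, constantCoeff_subst_self h0]
  -- The bilinear part of `F` is symmetric because `F` is commutative; otherwise the structure
  -- constants of the Lie algebra would appear here.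
  have hsymm : ∀ k l j, constantCoeff (pderiv R l (invariantFields F j k)) =
      constantCoeff (pderiv R k (invariantFields F j l)) := fun k l j => by
    rw [hc, hc, hF.pderiv_inl, pderiv_subst_elim (constantCoeff_vars _) (constantCoeff_vars _)]
    simp only [pderiv_X_eq_ite, reduceCtorEq, if_false, mul_zero, Finset.sum_const_zero,
      Sum.inr.injEq, mul_ite, mul_one, Finset.sum_ite_eq, Finset.mem_univ, if_true, add_zero]
    rw [constantCoeff_subst_self (constantCoeff_elim (constantCoeff_vars _)
      (constantCoeff_vars _)), pderiv_comm]
  -- Differentiate the invariance of the fields in `U_l` at `U = 0`. Both terms obtained are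
  -- symmetric in `k` and `l`: the first as a second derivative, the second by `hsymm`.
  have main : ∀ k l, ∑ j, pderiv R j (invariantFields F i k) * invariantFields F j l =
      subst (Sum.elim (fun _ => 0) X : κ ⊕ κ → MvPowerSeries κ R)
        (pderiv R (Sum.inl l) (pderiv R (Sum.inl k) (F i))) +
      ∑ j, invariantFields F i j * C (constantCoeff (pderiv R l (invariantFields F j k))) := by
    intro k l
    have h := congrArg (fun f => subst (Sum.elim (fun _ => 0) X : κ ⊕ κ → MvPowerSeries κ R)
      (pderiv R (Sum.inl l) f)) (hF.sum_pderiv_mul i k)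
    beta_reduce at h
    rw [pderiv_subst hF.zero, map_sum, ← coe_substAlgHom hs0, map_sum, map_sum] at h
    simp only [Derivation.leibniz, smul_eq_mul, map_add, map_mul, coe_substAlgHom hs0,
      pderiv_subst (constantCoeff_vars _), subst_subst hF.zero h0, hF.zero_left,
      subst_subst (constantCoeff_vars _) h0, Sum.elim_inl, subst_X hs0,
      pderiv_X_eq_ite, Sum.inl.injEq, mul_ite, mul_one, mul_zero, Finset.sum_ite_eq,
      Finset.mem_univ, if_true] at h
    have e : (fun i : κ => (X i : MvPowerSeries κ R)) = X := rfl
    have e2 : ∀ f : MvPowerSeries κ R, subst (fun _ : κ => (0 : MvPowerSeries κ R)) f =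
      C (constantCoeff f) := fun f => subst_zero_eq_C_constantCoeff
    have e3 : ∀ j, constantCoeff (invariantFields F j k) = if j = k then 1 else 0 := fun j => by
      have := congrFun (congrFun hF.constantCoeff_invariantFields j) k
      rwa [Matrix.map_apply, Matrix.one_apply] at this
    simp only [e, subst_self, id, e2, e3, ← invariantFields_apply] at h
    rw [Finset.sum_add_distrib, add_comm] at h
    rw [← h]
    congr 1
    simp [apply_ite, Finset.sum_ite_eq']
  rw [main, main, pderiv_comm]
  congr 1
  exact Finset.sum_congr rfl fun j _ => by rw [hsymm]

/-- The invariant differentials are closed. -/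
theorem IsFormalGroup.pderiv_invariantForms_comm (hF : IsFormalGroup F) (i a b : κ) :
    pderiv R a (invariantForms F i b) = pderiv R b (invariantForms F i a) := by
  set M := invariantFields F with hM
  set W := invariantForms F with hW
  have hWM : W * M = 1 := Matrix.nonsing_inv_mul _ hF.isUnit_det
  have hMW : M * W = 1 := Matrix.mul_nonsing_inv _ hF.isUnit_det
  have h1 : ∀ a k, ∑ b, pderiv R a (W i b) * M b k = - ∑ b, W i b * pderiv R a (M b k) := by
    intro a k
    have := congrArg (pderiv R a) (congrFun (congrFun hWM i) k)
    rw [Matrix.mul_apply, map_sum] at this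
    simp only [Derivation.leibniz, smul_eq_mul, Finset.sum_add_distrib] at this
    have h2 : pderiv R a ((1 : Matrix κ κ (MvPowerSeries κ R)) i k) = 0 := by
      rw [Matrix.one_apply]
      split_ifs
      · exact pderiv_one
      · exact map_zero _
    rw [h2, add_comm] at this
    rw [← eq_neg_iff_add_eq_zero.mpr this]
    exact Finset.sum_congr rfl fun b _ => mul_comm _ _
  -- `N` is the Jacobian matrix of the `i`-th form. Paired with the invariant fields it becomes
  -- symmetric, by `h1` (the Leibniz rule for `W * M = 1`) and because the fields commute.
  -- Invertibility of `M` carries the symmetry back to `N`.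
  let N : Matrix κ κ (MvPowerSeries κ R) := Matrix.of fun a b => pderiv R a (W i b)
  have h2 : M.transpose * N * M = (M.transpose * N * M).transpose := by
    have h3 : ∀ l k, (M.transpose * N * M) l k =
        - ∑ b, W i b * ∑ a, pderiv R a (M b k) * M a l := by
      intro l k
      rw [mul_assoc, Matrix.mul_apply]
      simp only [Matrix.mul_apply, N, Matrix.of_apply, h1, Matrix.transpose_apply, Finset.mul_sum,
        mul_neg, Finset.sum_neg_distrib]
      rw [Finset.sum_comm]
      congr 1
      exact Finset.sum_congr rfl fun _ _ => Finset.sum_congr rfl fun _ _ => by ring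
    ext1 l k
    rw [Matrix.transpose_apply, h3, h3]
    congr 1
    exact Finset.sum_congr rfl fun b _ => by rw [hF.sum_pderiv_invariantFields_comm]
  have h4 : N = N.transpose := by
    have h5 : ∀ N : Matrix κ κ (MvPowerSeries κ R),
        W.transpose * (M.transpose * N * M) * W = N := fun N => by
      rw [← mul_assoc, ← mul_assoc, ← Matrix.transpose_mul, hMW, Matrix.transpose_one, one_mul,
        mul_assoc, hMW, mul_one]
    have h6 : (M.transpose * N * M).transpose = M.transpose * N.transpose * M := by
      simp only [Matrix.transpose_mul, Matrix.transpose_transpose, mul_assoc]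
    rw [← h5 N.transpose, ← h6, ← h2, h5]
  exact congrFun (congrFun h4 a) b

omit [Fintype κ] [DecidableEq κ] in
theorem map_subst_of_zero {σ : Type*} [Finite σ] {ρ : R →+* S} {a : σ → MvPowerSeries τ R}
    (ha : ∀ i, constantCoeff (a i) = 0) (f : MvPowerSeries σ R) :
    MvPowerSeries.map ρ (subst a f) =
      subst (fun i => MvPowerSeries.map ρ (a i)) (MvPowerSeries.map ρ f) :=
  map_subst (hasSubst_of_zero ha) f

omit [DecidableEq κ] in
/-- Closed differential forms are exact over `ℚ`-algebras. -/
theorem exists_pderiv_eq [Algebra ℚ S] (ω : κ → MvPowerSeries κ S)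
    (h : ∀ a b, pderiv S a (ω b) = pderiv S b (ω a)) :
    ∃ f : MvPowerSeries κ S, constantCoeff f = 0 ∧ ∀ j, pderiv S j f = ω j := by
  classical
  -- Euler's formula: `|J| f_J` is the coefficient of `∑ t_j ω_j` at `J`. Terms with `J j = 0` must
  -- be discarded, since there the subtraction of exponents is truncated.
  let f : MvPowerSeries κ S := fun J => algebraMap ℚ S (J.degree : ℚ)⁻¹ *
    ∑ j, if J j = 0 then 0 else coeff (J - Finsupp.single j 1) (ω j)
  have hf : ∀ J, coeff J f = algebraMap ℚ S (J.degree : ℚ)⁻¹ *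
    ∑ j, if J j = 0 then 0 else coeff (J - Finsupp.single j 1) (ω j) := fun J => rfl
  refine ⟨f, ?_, fun k => ?_⟩
  · rw [← coeff_zero_eq_constantCoeff_apply, hf]
    simp
  · ext J
    rw [coeff_pderiv, hf]
    -- Closedness exchanges `ω j` for `ω k`. All terms become multiples of one coefficient, with
    -- multiplicities adding up to the degree.
    have key : ∀ j, (if (J + Finsupp.single k 1 : κ →₀ ℕ) j = 0 then 0 else
        coeff (J + Finsupp.single k 1 - Finsupp.single j 1) (ω j)) * ((J k : S) + 1) =
        ((J + Finsupp.single k 1 : κ →₀ ℕ) j : S) * coeff J (ω k) := by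
      intro j
      by_cases hjk : j = k
      · subst hjk
        simp [mul_comm]
      · have e1 : (J + Finsupp.single k 1 : κ →₀ ℕ) j = J j := by simp [Ne.symm hjk]
        rw [e1]
        split_ifs with h0
        · simp [h0]
        · obtain ⟨J', rfl⟩ : ∃ J', J = J' + Finsupp.single j 1 := ⟨J - Finsupp.single j 1,
            (tsub_add_cancel_of_le (by simpa using Nat.one_le_iff_ne_zero.mpr h0)).symm⟩
          have h2 := congrArg (coeff J') (h k j)
          rw [coeff_pderiv, coeff_pderiv] at h2
          rw [add_right_comm, add_tsub_cancel_right]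
          have e2 : (J' + Finsupp.single j 1 : κ →₀ ℕ) k = J' k := by simp [hjk]
          rw [e2, h2]
          simp [mul_comm]
    rw [mul_assoc, Finset.sum_mul, Finset.sum_congr rfl fun j _ => key j, ← Finset.sum_mul,
      ← mul_assoc]
    have e : ∑ j, ((J + Finsupp.single k 1 : κ →₀ ℕ) j : S) =
        algebraMap ℚ S ((J + Finsupp.single k 1).degree : ℚ) := by
      rw [Finsupp.degree_eq_sum]
      simp
    have hne : ((J + Finsupp.single k 1).degree : ℚ) ≠ 0 := by
      rw [map_add, Finsupp.degree_single]
      exact_mod_cast Nat.succ_ne_zero J.degree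
    rw [e, ← map_mul, inv_mul_cancel₀ hne, map_one, one_mul]

variable (ρ : R →+* S) [Algebra ℚ S]

/-- `L` is a logarithm over `S` of the formal group law `F` over `R`. -/
def IsLogOver (F : κ → MvPowerSeries (κ ⊕ κ) R) (L : κ → MvPowerSeries κ S) : Prop :=
  ∀ i, constantCoeff (L i) = 0 ∧
    ∀ j, pderiv S j (L i) = MvPowerSeries.map ρ (invariantForms F i j)

theorem IsFormalGroup.exists_isLogOver (hF : IsFormalGroup F) : ∃ L, IsLogOver ρ F L := by
  choose L hL using fun i => exists_pderiv_eq (fun j => MvPowerSeries.map ρ (invariantForms F i j))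
    fun a b => by rw [pderiv_map, pderiv_map, hF.pderiv_invariantForms_comm]
  exact ⟨L, hL⟩

variable {ρ} {L : κ → MvPowerSeries κ S}

omit [Algebra ℚ S] in
theorem IsLogOver.coeff_single (hF : IsFormalGroup F) (hL : IsLogOver ρ F L) (i j : κ) :
    coeff (Finsupp.single j 1) (L i) = if i = j then 1 else 0 := by
  have h := congrArg constantCoeff ((hL i).2 j)
  rw [← coeff_zero_eq_constantCoeff_apply, coeff_pderiv, zero_add, Finsupp.coe_zero, Pi.zero_apply,
    Nat.cast_zero, zero_add, mul_one, constantCoeff_map] at h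
  have e := congrFun (congrFun hF.constantCoeff_invariantForms i) j
  rw [Matrix.map_apply, Matrix.one_apply] at e
  rw [h, e]
  split_ifs <;> simp

omit [Algebra ℚ S] in
theorem IsLogOver.isTangentToId (hF : IsFormalGroup F) (hL : IsLogOver ρ F L) :
    IsTangentToId L :=
  isTangentToId_iff.mpr fun i => ⟨(hL i).1, hL.coeff_single hF i⟩

theorem IsLogOver.unique {L' : κ → MvPowerSeries κ S} (hL : IsLogOver ρ F L)
    (hL' : IsLogOver ρ F L') : L = L' := funext fun i =>
  eq_of_pderiv_eq (fun j => by rw [(hL i).2, (hL' i).2]) (by rw [(hL i).1, (hL' i).1])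

/-- The logarithm is a homomorphism to the additive group. -/
theorem IsLogOver.subst_eq (hF : IsFormalGroup F) (hL : IsLogOver ρ F L) (i : κ) :
    subst (fun j => MvPowerSeries.map ρ (F j)) (L i) =
      subst (vars S (Sum.inl : κ → κ ⊕ κ)) (L i) + subst (vars S (Sum.inr : κ → κ ⊕ κ)) (L i) := by
  have hv := @constantCoeff_vars S _
  have hF0 : ∀ j, constantCoeff (MvPowerSeries.map ρ (F j)) = 0 := fun j => by
    rw [constantCoeff_map, hF.zero, map_zero]
  -- In the `U`-directions this is the invariance of `dL_i`. Both sides are symmetric in `U` and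
  -- `V`, so the `V`-derivatives follow by swapping.
  have h1 : ∀ k, pderiv S (Sum.inl k) (subst (fun j => MvPowerSeries.map ρ (F j)) (L i)) =
      pderiv S (Sum.inl k) (subst (vars S (Sum.inl : κ → κ ⊕ κ)) (L i) +
        subst (vars S (Sum.inr : κ → κ ⊕ κ)) (L i)) := by
    intro k
    rw [pderiv_subst hF0, map_add, pderiv_subst (hv _), pderiv_subst (hv _)]
    simp only [pderiv_X_eq_ite, reduceCtorEq, if_false, mul_zero, Finset.sum_const_zero,
      Sum.inl.injEq, mul_ite, mul_one, Finset.sum_ite_eq, Finset.mem_univ, if_true, add_zero,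
      (hL i).2, pderiv_map]
    have h := congrArg (MvPowerSeries.map ρ) (hF.isInvariantDifferential i k)
    rw [map_sum] at h
    simp only [map_mul, map_subst_of_zero hF.zero, map_subst_of_zero (constantCoeff_vars _),
      map_X] at h
    exact h
  have hsw : ∀ s : κ ⊕ κ, constantCoeff ((Sum.elim (vars S Sum.inr) (vars S Sum.inl) :
    κ ⊕ κ → MvPowerSeries (κ ⊕ κ) S) s) = 0 := constantCoeff_elim (hv _) (hv _)
  have hsw' := hasSubst_of_zero hsw
  have hswap : ∀ (f : MvPowerSeries (κ ⊕ κ) S) (_ : subst (Sum.elim (vars S Sum.inr)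
      (vars S Sum.inl) : κ ⊕ κ → MvPowerSeries (κ ⊕ κ) S) f = f) (k : κ),
      pderiv S (Sum.inr k) f = subst (Sum.elim (vars S Sum.inr) (vars S Sum.inl) :
        κ ⊕ κ → MvPowerSeries (κ ⊕ κ) S) (pderiv S (Sum.inl k) f) := by
    intro f hf k
    conv_lhs => rw [← hf]
    rw [pderiv_subst_elim (hv _) (hv _)]
    simp [pderiv_X_eq_ite]
  refine eq_of_pderiv_eq (fun s => ?_) ?_
  · rcases s with k | k
    · exact h1 k
    · rw [hswap _ _ k, hswap _ _ k, h1]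
      · rw [subst_add hsw', subst_subst (hv _) hsw, subst_subst (hv _) hsw, add_comm]
        simp [subst_X hsw']
      · rw [subst_subst hF0 hsw]
        congr 1
        funext j
        conv_rhs => rw [← hF.comm j, map_subst_of_zero (constantCoeff_elim (constantCoeff_vars _)
          (constantCoeff_vars _))]
        congr 1
        funext s
        rcases s with s | s <;> simp
  · rw [map_add, constantCoeff_subst_self hF0, constantCoeff_subst_self (hv _),
      constantCoeff_subst_self (hv _), (hL i).1, add_zero]

/-- An invariant differential is fixed by its value at the origin, which the linear term of `L i`
prescribes. The comparison is made over `R ⊗ ℚ`: as `R → R ⊗ ℚ` may have a kernel, the form `ω` over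
`R` need not itself be unique. -/
theorem IsFormalGroup.isFormalLog_iff (hF : IsFormalGroup F)
    {L : κ → MvPowerSeries κ (R ⊗[ℤ] ℚ)} :
    IsFormalLog F L ↔ IsLogOver Algebra.TensorProduct.includeLeftRingHom F L := by
  refine ⟨fun h i => ⟨(h i).1, ?_⟩, fun h i => ⟨(h i).1, h.coeff_single hF i, _,
    hF.isInvariantDifferential i, (h i).2⟩⟩
  obtain ⟨-, h1, ω, hω, h2⟩ := h i
  have h3 : ∀ k, (Algebra.TensorProduct.includeLeftRingHom : R →+* R ⊗[ℤ] ℚ)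
      (constantCoeff (ω k)) = if i = k then 1 else 0 := by
    intro k
    have h := congrArg constantCoeff (h2 k)
    rw [← coeff_zero_eq_constantCoeff_apply, coeff_pderiv, zero_add, Finsupp.coe_zero,
      Pi.zero_apply, Nat.cast_zero, zero_add, mul_one, constantCoeff_map, h1] at h
    exact h.symm
  intro j
  rw [h2, hF.eq_of_isInvariantDifferential hω, map_sum]
  simp only [map_mul, map_C, h3]
  rw [Finset.sum_eq_single i (fun b _ hb => by simp [hb.symm]) (by simp)]
  simp

/-- The formal logarithm and the formal exponential exist and are unique. -/
theorem IsFormalGroup.exists_formalLog_formalExp (hF : IsFormalGroup F) :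
    ∃ L E, IsFormalLog F L ∧ IsFormalExp L E ∧ IsTangentToId L ∧
      ∀ L' E', IsFormalLog F L' → IsFormalExp L' E' → L' = L ∧ E' = E := by
  let _ : Algebra ℚ (R ⊗[ℤ] ℚ) := Algebra.TensorProduct.rightAlgebra
  obtain ⟨L, hL⟩ := hF.exists_isLogOver
    (Algebra.TensorProduct.includeLeftRingHom : R →+* R ⊗[ℤ] ℚ)
  have ht := hL.isTangentToId hF
  obtain ⟨E, -, hE, -⟩ := ht.exists_inverse
  refine ⟨L, E, hF.isFormalLog_iff.mpr hL, hE, ht, fun L' E' hL' hE' => ?_⟩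
  obtain rfl : L' = L := (hF.isFormalLog_iff.mp hL').unique hL
  exact ⟨rfl, funext fun i => ht.subst_injective ((hE' i).trans (hE i).symm)⟩

end FormalGroup

/-! ### Points with values in local rings -/

section Points

variable {X Z : Scheme.{u}} {x : X} {z : Z} {C C' : Type u} [CommRing C] [CommRing C']

/-- The point of `X` defined by a homomorphism from the local ring at `x`. -/
def homPt (x : X) (φ : X.presheaf.stalk x →+* C) : Spec (.of C) ⟶ X :=
  Spec.map (CommRingCat.ofHom φ) ≫ X.fromSpecStalk x

/-- The map `Spec 𝒪_{X,x} → X` is a monomorphism. Identities between homomorphisms of local rings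
can therefore be proved by comparing morphisms of schemes. -/
theorem homPt_injective :
    Function.Injective (homPt x : (X.presheaf.stalk x →+* C) → (Spec (.of C) ⟶ X)) := by
  intro φ ψ h
  have := Spec.map_injective ((cancel_mono _).mp h)
  exact congrArg CommRingCat.Hom.hom this

theorem homPt_closedPoint [IsLocalRing C] (φ : X.presheaf.stalk x →+* C) [IsLocalHom φ] :
    homPt x φ (IsLocalRing.closedPoint C) = x := by
  have h : Spec.map (CommRingCat.ofHom φ) (IsLocalRing.closedPoint C) =
    IsLocalRing.closedPoint (X.presheaf.stalk x) := IsLocalRing.comap_closedPoint φ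
  exact ((Scheme.Hom.comp_apply (Spec.map (CommRingCat.ofHom φ)) (X.fromSpecStalk x) _).trans
    (congrArg _ h)).trans Scheme.fromSpecStalk_closedPoint

theorem SpecMap_homPt (ψ : C →+* C') (φ : X.presheaf.stalk x →+* C) :
    Spec.map (CommRingCat.ofHom ψ) ≫ homPt x φ = homPt x (ψ.comp φ) := by
  rw [homPt, homPt, CommRingCat.ofHom_comp, Spec.map_comp, Category.assoc]

theorem homPt_comp (q : X ⟶ Z) (h : q x = z) (φ : X.presheaf.stalk x →+* C) :
    homPt x φ ≫ q = homPt z (φ.comp (germPullback q h)) := by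
  subst h
  rw [← SpecMap_homPt, homPt, Category.assoc, ← Scheme.SpecMap_stalkMap_fromSpecStalk, homPt]
  congr 2
  simp [germPullback]

theorem exists_homPt [IsLocalRing C] (g : Spec (.of C) ⟶ X)
    (h : g (IsLocalRing.closedPoint C) = x) :
    ∃ φ : X.presheaf.stalk x →+* C, IsLocalHom φ ∧ g = homPt x φ := by
  subst h
  refine ⟨(Scheme.stalkClosedPointTo g).hom, inferInstance, ?_⟩
  exact (Scheme.Spec_stalkClosedPointTo_fromSpecStalk g).symm

theorem germPullback_comp {W : Scheme.{u}} {w : W} (q : X ⟶ Z) (r : Z ⟶ W) (h : q x = z)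
    (h' : r z = w) (h'' : (q ≫ r) x = w) :
    germPullback (q ≫ r) h'' = (germPullback q h).comp (germPullback r h') := by
  apply homPt_injective
  rw [← RingHom.id_comp (germPullback (q ≫ r) h''), ← homPt_comp, ← Category.assoc, homPt_comp q h,
    homPt_comp r h', RingHom.id_comp]

theorem germPullback_congr {q q' : X ⟶ Z} (e : q = q') (h : q x = z) (h' : q' x = z) :
    germPullback q h = germPullback q' h' := by subst e; rfl

theorem homPt_comp_toSpec {R : Type u} [CommRing R] (f : X ⟶ Spec (.of R))
    (φ : X.presheaf.stalk x →+* C) :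
    homPt x φ ≫ f = Spec.map (CommRingCat.ofHom (φ.comp (scalarGerm f x))) := by
  have h1 : f = X.toSpecΓ ≫ Spec.map ((Scheme.ΓSpecIso (.of R)).inv ≫ f.appTop) := by
    rw [Spec.map_comp, ← Scheme.toSpecΓ_naturality_assoc]
    simp
  conv_lhs => rw [h1]
  rw [homPt, Category.assoc, Scheme.fromSpecStalk_toSpecΓ_assoc, ← Spec.map_comp, ← Spec.map_comp]
  rfl

theorem germPullback_section {e : Z ⟶ X} {q : X ⟶ Z} (h : e ≫ q = 𝟙 Z) (h₁ : e z = x)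
    (h₂ : q x = z) : (germPullback e h₁).comp (germPullback q h₂) = RingHom.id _ := by
  apply homPt_injective
  rw [← homPt_comp, ← RingHom.id_comp (germPullback e h₁), ← homPt_comp, Category.assoc, h,
    Category.comp_id]

end Points

/-! ### Products of points of a group scheme -/

section Mul

variable {Y G : Scheme.{u}} (q : G ⟶ Y) [GrpObj (Over.mk q)] (y : Y)

theorem idSection_apply : q (idSection q y) = y := by
  rw [← Scheme.Hom.comp_apply, idSection_comp]; rfl

theorem hom_idSection₂_apply : (Over.mk q ⊗ Over.mk q).hom (idSection₂ q y) = y := by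
  rw [← Scheme.Hom.comp_apply, idSection₂_hom]; rfl

/-- The structure map of the local ring of `G` at the origin. -/
abbrev structHom : Y.presheaf.stalk y →+* G.presheaf.stalk (idSection q y) :=
  germPullback q (idSection_apply q y)

/-- Restriction to the identity section. -/
abbrev augHom : G.presheaf.stalk (idSection q y) →+* Y.presheaf.stalk y :=
  germPullback (idSection q) (x := y) rfl

/-- The structure map of the local ring of `G ×_Y G` at the origin. -/
abbrev structHom₂ : Y.presheaf.stalk y →+*
    (Over.mk q ⊗ Over.mk q).left.presheaf.stalk (idSection₂ q y) :=
  germPullback (Over.mk q ⊗ Over.mk q).hom (hom_idSection₂_apply q y)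

/-- Restriction to the identity section of `G ×_Y G`. -/
abbrev augHom₂ : (Over.mk q ⊗ Over.mk q).left.presheaf.stalk (idSection₂ q y) →+*
    Y.presheaf.stalk y :=
  germPullback (idSection₂ q) (x := y) rfl

/-- Pullback under the first projection. -/
abbrev fstHom : G.presheaf.stalk (idSection q y) →+*
    (Over.mk q ⊗ Over.mk q).left.presheaf.stalk (idSection₂ q y) :=
  germPullback (fst (Over.mk q) (Over.mk q)).left (x := idSection₂ q y)
    (by rw [← Scheme.Hom.comp_apply, idSection₂_fst])

/-- Pullback under the second projection. -/
abbrev sndHom : G.presheaf.stalk (idSection q y) →+*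
    (Over.mk q ⊗ Over.mk q).left.presheaf.stalk (idSection₂ q y) :=
  germPullback (snd (Over.mk q) (Over.mk q)).left (x := idSection₂ q y)
    (by rw [← Scheme.Hom.comp_apply, idSection₂_snd])

/-- Pullback under the multiplication. -/
abbrev mulHom : G.presheaf.stalk (idSection q y) →+*
    (Over.mk q ⊗ Over.mk q).left.presheaf.stalk (idSection₂ q y) :=
  germPullback μ[Over.mk q].left (x := idSection₂ q y)
    (by rw [← Scheme.Hom.comp_apply, idSection₂_mul])

theorem augHom_comp_structHom : (augHom q y).comp (structHom q y) = RingHom.id _ :=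
  germPullback_section (idSection_comp q) _ _

theorem augHom₂_comp_structHom₂ : (augHom₂ q y).comp (structHom₂ q y) = RingHom.id _ :=
  germPullback_section (idSection₂_hom q) _ _

theorem augHom₂_comp_fstHom : (augHom₂ q y).comp (fstHom q y) = augHom q y := by
  rw [← germPullback_comp (idSection₂ q) _ rfl _ (by rw [idSection₂_fst])]
  exact germPullback_congr (idSection₂_fst q) _ _

theorem augHom₂_comp_sndHom : (augHom₂ q y).comp (sndHom q y) = augHom q y := by
  rw [← germPullback_comp (idSection₂ q) _ rfl _ (by rw [idSection₂_snd])]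
  exact germPullback_congr (idSection₂_snd q) _ _

theorem augHom₂_comp_mulHom : (augHom₂ q y).comp (mulHom q y) = augHom q y := by
  rw [← germPullback_comp (idSection₂ q) _ rfl _ (by rw [idSection₂_mul])]
  exact germPullback_congr (idSection₂_mul q) _ _

theorem fstHom_comp_structHom : (fstHom q y).comp (structHom q y) = structHom₂ q y := by
  rw [← germPullback_comp _ q _ _ (by
    rw [show (fst (Over.mk q) (Over.mk q)).left ≫ q = (Over.mk q ⊗ Over.mk q).hom from Over.w _]
    exact hom_idSection₂_apply q y)]
  exact germPullback_congr (Over.w (fst (Over.mk q) (Over.mk q))) _ _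

theorem sndHom_comp_structHom : (sndHom q y).comp (structHom q y) = structHom₂ q y := by
  rw [← germPullback_comp _ q _ _ (by
    rw [show (snd (Over.mk q) (Over.mk q)).left ≫ q = (Over.mk q ⊗ Over.mk q).hom from Over.w _]
    exact hom_idSection₂_apply q y)]
  exact germPullback_congr (Over.w (snd (Over.mk q) (Over.mk q))) _ _

theorem mulHom_comp_structHom : (mulHom q y).comp (structHom q y) = structHom₂ q y := by
  rw [← germPullback_comp _ q _ _ (by
    rw [show μ[Over.mk q].left ≫ q = (Over.mk q ⊗ Over.mk q).hom from Over.w _]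
    exact hom_idSection₂_apply q y)]
  exact germPullback_congr (Over.w μ[Over.mk q]) _ _

variable {q y}

theorem sub_structHom_mem (a : G.presheaf.stalk (idSection q y)) :
    a - structHom q y (augHom q y a) ∈ augIdeal q y := by
  rw [augIdeal, RingHom.mem_ker, map_sub, sub_eq_zero]
  exact (RingHom.congr_fun (augHom_comp_structHom q y) _).symm

variable {C : Type u} [CommRing C] {c : Y.presheaf.stalk y →+* C}

/-- Two homomorphisms from the local ring of `G ×_Y G` at the origin agree if they agree after
pullback under the projections. -/
theorem hom_ext₂ {δ δ' : (Over.mk q ⊗ Over.mk q).left.presheaf.stalk (idSection₂ q y) →+* C}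
    (h₁ : δ.comp (fstHom q y) = δ'.comp (fstHom q y))
    (h₂ : δ.comp (sndHom q y) = δ'.comp (sndHom q y)) : δ = δ' := by
  apply homPt_injective
  let c := δ.comp (structHom₂ q y)
  have hc : c = δ'.comp (structHom₂ q y) := by
    rw [← fstHom_comp_structHom, ← RingHom.comp_assoc, ← h₁, RingHom.comp_assoc,
      fstHom_comp_structHom]
  let g : Over.mk (homPt y c) ⟶ Over.mk q ⊗ Over.mk q :=
    Over.homMk (homPt _ δ) (homPt_comp _ (hom_idSection₂_apply q y) _)
  let g' : Over.mk (homPt y c) ⟶ Over.mk q ⊗ Over.mk q :=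
    Over.homMk (homPt _ δ') (by rw [hc]; exact homPt_comp _ (hom_idSection₂_apply q y) _)
  have hg : g = g' := by
    apply CartesianMonoidalCategory.hom_ext
    · ext1
      rw [Over.comp_left, Over.comp_left]
      exact (homPt_comp _ _ _).trans ((congrArg _ h₁).trans (homPt_comp _ _ _).symm)
    · ext1
      rw [Over.comp_left, Over.comp_left]
      exact (homPt_comp _ _ _).trans ((congrArg _ h₂).trans (homPt_comp _ _ _).symm)
  exact congrArg (fun k => k.left) hg

theorem homPt_structure_comp (φ : G.presheaf.stalk (idSection q y) →+* C)
    (h : φ.comp (structHom q y) = c) : homPt _ φ ≫ q = homPt y c := by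
  rw [homPt_comp q (idSection_apply q y), h]

/-- Every germ equals the pullback of its restriction to `Y`, modulo the ideal of the identity
section. A point sending that ideal into `𝔞` is thus on the identity section modulo `𝔞`. -/
theorem comp_eq_of_augIdeal_le {𝔞 : Ideal C}
    {φ : G.presheaf.stalk (idSection q y) →+* C}
    (h : φ.comp (structHom q y) = c) (hI : ∀ a ∈ augIdeal q y, φ a ∈ 𝔞) :
    (Ideal.Quotient.mk 𝔞).comp φ = ((Ideal.Quotient.mk 𝔞).comp c).comp (augHom q y) := by
  ext a
  have := hI _ (sub_structHom_mem a)
  rw [map_sub, ← Ideal.Quotient.eq] at this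
  exact this.trans (congrArg _ (RingHom.congr_fun h _))

/-- The ideal of the identity section of `G ×_Y G` is generated, up to its square, by the pullbacks
of generators, up to the square, of the ideal of the identity section of `G`. -/
theorem ker_augHom₂_le {J : Ideal (G.presheaf.stalk (idSection q y))}
    (hJ : augIdeal q y ≤ J ⊔ augIdeal q y ^ 2) :
    RingHom.ker (augHom₂ q y) ≤
      (J.map (fstHom q y) ⊔ J.map (sndHom q y)) ⊔ RingHom.ker (augHom₂ q y) ^ 2 := by
  set K := (J.map (fstHom q y) ⊔ J.map (sndHom q y)) ⊔ RingHom.ker (augHom₂ q y) ^ 2 with hK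
  have key : ∀ (pr : G.presheaf.stalk (idSection q y) →+* _)
      (_ : (augHom₂ q y).comp pr = augHom q y) (_ : pr.comp (structHom q y) = structHom₂ q y)
      (_ : J.map pr ≤ K), (Ideal.Quotient.mk K).comp pr =
        ((Ideal.Quotient.mk K).comp ((structHom₂ q y).comp (augHom₂ q y))).comp pr := by
    intro pr h₁ h₂ h₃
    ext a
    rw [RingHom.comp_apply, RingHom.comp_apply, RingHom.comp_apply, Ideal.Quotient.eq,
      RingHom.comp_apply, ← RingHom.comp_apply _ pr, h₁, ← h₂, RingHom.comp_apply, ← map_sub]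
    have h₄ : (J ⊔ augIdeal q y ^ 2).map pr ≤ K := by
      rw [Ideal.map_sup, Ideal.map_pow]
      refine sup_le h₃ (le_sup_of_le_right (Ideal.pow_right_mono ?_ 2))
      rw [Ideal.map_le_iff_le_comap]
      intro x hx
      rw [Ideal.mem_comap, RingHom.mem_ker, ← RingHom.comp_apply, h₁]
      exact hx
    exact h₄ (Ideal.mem_map_of_mem _ (hJ (sub_structHom_mem a)))
  -- Reduction modulo `K`, with or without prior restriction to the identity section, gives the same
  -- map on both factors, hence on the product by its universal property.
  have h := hom_ext₂ (key _ (augHom₂_comp_fstHom q y) (fstHom_comp_structHom q y)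
    (le_sup_of_le_left le_sup_left)) (key _ (augHom₂_comp_sndHom q y) (sndHom_comp_structHom q y)
    (le_sup_of_le_left le_sup_right))
  intro x hx
  have := RingHom.congr_fun h x
  rw [RingHom.comp_apply, RingHom.comp_apply, RingHom.mem_ker.mp hx, map_zero, map_zero] at this
  exact Ideal.Quotient.eq_zero_iff_mem.mp this

variable [IsLocalRing C] [IsLocalHom c]

/-- The two points define a point of `G ×_Y G`. Modulo the proper ideal `𝔞` both lie on the identity
section, so the closed point goes to the origin and the point factors through the local ring there.
Restricting the resulting `δ` along `mulHom` gives the product. -/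
theorem exists_lift_eq {𝔞 : Ideal C} (h𝔞 : 𝔞 ≠ ⊤)
    {φ₁ φ₂ : G.presheaf.stalk (idSection q y) →+* C}
    (h₁ : φ₁.comp (structHom q y) = c) (h₂ : φ₂.comp (structHom q y) = c)
    (hI₁ : ∀ a ∈ augIdeal q y, φ₁ a ∈ 𝔞) (hI₂ : ∀ a ∈ augIdeal q y, φ₂ a ∈ 𝔞) :
    ∃ δ : (Over.mk q ⊗ Over.mk q).left.presheaf.stalk (idSection₂ q y) →+* C,
      δ.comp (fstHom q y) = φ₁ ∧ δ.comp (sndHom q y) = φ₂ ∧ δ.comp (structHom₂ q y) = c ∧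
      (∀ a ∈ RingHom.ker (augHom₂ q y), δ a ∈ 𝔞) ∧
      ∀ g₁ g₂ : Over.mk (homPt y c) ⟶ Over.mk q, g₁.left = homPt _ φ₁ → g₂.left = homPt _ φ₂ →
        (g₁ * g₂).left = homPt _ (δ.comp (mulHom q y)) := by
  let g₁ : Over.mk (homPt y c) ⟶ Over.mk q := Over.homMk (homPt _ φ₁) (homPt_structure_comp _ h₁)
  let g₂ : Over.mk (homPt y c) ⟶ Over.mk q := Over.homMk (homPt _ φ₂) (homPt_structure_comp _ h₂)
  let π := Ideal.Quotient.mk 𝔞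
  have : Nontrivial (C ⧸ 𝔞) := Ideal.Quotient.nontrivial_iff.mpr h𝔞
  have : IsLocalRing (C ⧸ 𝔞) := IsLocalRing.of_surjective' π Ideal.Quotient.mk_surjective
  have : IsLocalHom π := IsLocalHom.of_surjective π Ideal.Quotient.mk_surjective
  let r : Over.mk (homPt y (π.comp c)) ⟶ Over.mk (homPt y c) :=
    Over.homMk (Spec.map (CommRingCat.ofHom π)) (SpecMap_homPt _ _)
  have hη : ∀ (φ : G.presheaf.stalk (idSection q y) →+* C) (h : φ.comp (structHom q y) = c)
      (_ : ∀ a ∈ augIdeal q y, φ a ∈ 𝔞), r ≫ (Over.homMk (homPt _ φ) (homPt_structure_comp _ h) :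
        Over.mk (homPt y c) ⟶ Over.mk q) = toUnit _ ≫ η[Over.mk q] := by
    intro φ h hI
    ext1
    rw [Over.comp_left, Over.comp_left]
    refine (SpecMap_homPt _ _).trans ?_
    rw [comp_eq_of_augIdeal_le h hI, ← homPt_comp]
    rfl
  have hl : r ≫ lift g₁ g₂ = toUnit _ ≫ lift η[Over.mk q] η[Over.mk q] := by
    rw [comp_lift, comp_lift, hη φ₁ h₁ hI₁, hη φ₂ h₂ hI₂]
  have hl' : Spec.map (CommRingCat.ofHom π) ≫ (lift g₁ g₂).left =
      homPt y (π.comp c) ≫ idSection₂ q := congrArg (fun k => k.left) hl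
  have hcl : (lift g₁ g₂).left (IsLocalRing.closedPoint C) = idSection₂ q y := by
    have e1 : Spec.map (CommRingCat.ofHom π) (IsLocalRing.closedPoint (C ⧸ 𝔞)) =
      IsLocalRing.closedPoint C := IsLocalRing.comap_closedPoint π
    have e2 := congrArg (fun k : Spec (.of (C ⧸ 𝔞)) ⟶ _ => k (IsLocalRing.closedPoint (C ⧸ 𝔞))) hl'
    refine (congrArg _ e1.symm).trans (e2.trans (congrArg (idSection₂ q) ?_))
    exact homPt_closedPoint (π.comp c)
  obtain ⟨δ, hδ, e⟩ := exists_homPt _ hcl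
  have d₁ : δ.comp (fstHom q y) = φ₁ := by
    apply homPt_injective
    rw [← homPt_comp, ← e, ← Over.comp_left, lift_fst]
    rfl
  have d₂ : δ.comp (sndHom q y) = φ₂ := by
    apply homPt_injective
    rw [← homPt_comp, ← e, ← Over.comp_left, lift_snd]
    rfl
  refine ⟨δ, d₁, d₂, ?_, ?_, ?_⟩
  · rw [← fstHom_comp_structHom, ← RingHom.comp_assoc, d₁, h₁]
  · intro a ha
    have : π.comp δ = (π.comp c).comp (augHom₂ q y) := by
      apply homPt_injective
      rw [← SpecMap_homPt, ← homPt_comp, ← hl', e]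
    have := RingHom.congr_fun this a
    rw [RingHom.comp_apply, RingHom.comp_apply, RingHom.mem_ker.mp ha, map_zero] at this
    exact Ideal.Quotient.eq_zero_iff_mem.mp this
  · intro g₁' g₂' e₁ e₂
    obtain rfl : g₁' = g₁ := by ext1; exact e₁
    obtain rfl : g₂' = g₂ := by ext1; exact e₂
    rw [Hom.mul_def, Over.comp_left, e, homPt_comp]

end Mul

/-! ### Expansions along a section -/

section Expansion

open MvPowerSeries

variable {R A σ : Type*} [CommRing R] [CommRing A] [Finite σ] {ε : R →+* A} {aug : A →+* R}
  {t : σ → A}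

omit [Finite σ] in
theorem eval₂_mem_pow {I : Ideal A} (ht : ∀ i, t i ∈ I) {N : ℕ} {P : MvPolynomial σ R}
    (hP : ∀ J : σ →₀ ℕ, J.degree < N → P.coeff J = 0) : MvPolynomial.eval₂ ε t P ∈ I ^ N := by
  have h1 : P ∈ MvPolynomial.idealOfVars σ R ^ N :=
    (MvPolynomial.mem_pow_idealOfVars_iff' N P).mpr hP
  have h2 : (MvPolynomial.idealOfVars σ R).map (MvPolynomial.eval₂Hom ε t) ≤ I := by
    rw [MvPolynomial.idealOfVars, Ideal.map_span, Ideal.span_le]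
    rintro _ ⟨_, ⟨i, rfl⟩, rfl⟩
    simpa using ht i
  have h3 := Ideal.mem_map_of_mem (MvPolynomial.eval₂Hom ε t) h1
  rw [Ideal.map_pow] at h3
  exact Ideal.pow_right_mono h2 N h3

/-- `ε : R → A` has the retraction `aug`, whose kernel is generated by the `t i` up to its square. -/
structure IsGeneratedBy (ε : R →+* A) (aug : A →+* R) (t : σ → A) : Prop where
  comp_eq : aug.comp ε = RingHom.id R
  mem : ∀ i, t i ∈ RingHom.ker aug
  le_sup : RingHom.ker aug ≤ Ideal.span (Set.range t) ⊔ RingHom.ker aug ^ 2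

omit [Finite σ] in
theorem IsGeneratedBy.sub_apply_mem (h : IsGeneratedBy ε aug t) (a : A) :
    a - ε (aug a) ∈ RingHom.ker aug := by
  rw [RingHom.mem_ker, map_sub, ← RingHom.comp_apply aug ε, h.comp_eq, RingHom.id_apply, sub_self]

/-- If `t` generates the augmentation ideal up to its square, then every element is a polynomial in
`t` modulo any power of the augmentation ideal. -/
theorem IsGeneratedBy.exists_sub_eval₂_mem (h : IsGeneratedBy ε aug t) (N : ℕ) (a : A) :
    ∃ P : MvPolynomial σ R, a - MvPolynomial.eval₂ ε t P ∈ RingHom.ker aug ^ N := by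
  cases nonempty_fintype σ
  set I := RingHom.ker aug
  induction N generalizing a with
  | zero => exact ⟨0, by simp⟩
  | succ N ih =>
    -- Exponent one is treated separately: the product argument `mul` needs approximations whose
    -- error already lies in `I`.
    rcases N with _ | N
    · exact ⟨MvPolynomial.C (aug a), by
        rw [MvPolynomial.eval₂_C, pow_one]; exact h.sub_apply_mem a⟩
    suffices key : ∀ a ∈ I, ∃ P : MvPolynomial σ R,
        a - MvPolynomial.eval₂ ε t P ∈ I ^ (N + 1 + 1) by
      obtain ⟨P, hP⟩ := key _ (h.sub_apply_mem a)
      exact ⟨MvPolynomial.C (aug a) + P, by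
        rwa [MvPolynomial.eval₂_add, MvPolynomial.eval₂_C, ← sub_sub]⟩
    intro a ha
    obtain ⟨b, hb, d, hd, rfl⟩ := Submodule.mem_sup.mp (h.le_sup ha)
    have add : ∀ a b, (∃ P : MvPolynomial σ R, a - MvPolynomial.eval₂ ε t P ∈ I ^ (N + 1 + 1)) →
        (∃ P : MvPolynomial σ R, b - MvPolynomial.eval₂ ε t P ∈ I ^ (N + 1 + 1)) →
        ∃ P : MvPolynomial σ R, a + b - MvPolynomial.eval₂ ε t P ∈ I ^ (N + 1 + 1) := by
      rintro a b ⟨P, hP⟩ ⟨Q, hQ⟩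
      refine ⟨P + Q, ?_⟩
      rw [MvPolynomial.eval₂_add, add_sub_add_comm]
      exact add_mem hP hQ
    have mul : ∀ x y, x ∈ I → y ∈ I →
        ∃ P : MvPolynomial σ R, x * y - MvPolynomial.eval₂ ε t P ∈ I ^ (N + 1 + 1) := by
      intro x y hx hy
      obtain ⟨P, hP⟩ := ih x
      obtain ⟨Q, hQ⟩ := ih y
      have hQI : MvPolynomial.eval₂ ε t Q ∈ I := by
        have := sub_mem hy (Ideal.pow_le_self (Nat.succ_ne_zero N) hQ)
        rwa [sub_sub_cancel] at this
      refine ⟨P * Q, ?_⟩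
      rw [MvPolynomial.eval₂_mul]
      have e : x * y - MvPolynomial.eval₂ ε t P * MvPolynomial.eval₂ ε t Q =
        (y - MvPolynomial.eval₂ ε t Q) * x +
          (x - MvPolynomial.eval₂ ε t P) * MvPolynomial.eval₂ ε t Q := by ring
      rw [e]
      exact add_mem (Ideal.mul_mem_mul hQ hx) (Ideal.mul_mem_mul hP hQI)
    refine add _ _ ?_ ?_
    · obtain ⟨c, rfl⟩ := Ideal.mem_span_range_iff_exists_fun.mp hb
      refine Finset.sum_induction _ (fun a => ∃ P : MvPolynomial σ R,
        a - MvPolynomial.eval₂ ε t P ∈ I ^ (N + 1 + 1)) add ⟨0, by simp⟩ fun i _ => ?_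
      obtain ⟨P, hP⟩ := ih (c i)
      refine ⟨P * MvPolynomial.X i, ?_⟩
      rw [MvPolynomial.eval₂_mul, MvPolynomial.eval₂_X, ← sub_mul]
      exact Ideal.mul_mem_mul hP (h.mem i)
    · rw [pow_two] at hd
      exact Submodule.mul_induction_on hd (fun x hx y hy => mul x y hx hy) add

/-- A homomorphism to power series which expands in terms of the `t i`. -/
structure IsExpansionHom (ε : R →+* A) (aug : A →+* R) (t : σ → A)
    (φ : A →+* MvPowerSeries σ R) : Prop where
  comp_eq : φ.comp ε = C
  apply_eq : ∀ i, φ (t i) = X i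
  constantCoeff_comp : constantCoeff.comp φ = aug

variable {φ : A →+* MvPowerSeries σ R}

omit [Finite σ] in
theorem IsExpansionHom.apply_eval₂ (hφ : IsExpansionHom ε aug t φ) (P : MvPolynomial σ R) :
    φ (MvPolynomial.eval₂ ε t P) = P := by
  have : φ.comp (MvPolynomial.eval₂Hom ε t) = MvPolynomial.coeToMvPowerSeries.ringHom := by
    refine MvPolynomial.ringHom_ext (fun r => ?_) fun i => ?_
    · simpa using RingHom.congr_fun hφ.comp_eq r
    · simpa using hφ.apply_eq i
  exact RingHom.congr_fun this P

omit [Finite σ] in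
theorem IsExpansionHom.mem_ordIdeal (hφ : IsExpansionHom ε aug t φ) {N : ℕ} {a : A}
    (ha : a ∈ RingHom.ker aug ^ N) : φ a ∈ ordIdeal σ R N := by
  have h1 : (RingHom.ker aug).map φ ≤ ordIdeal σ R 1 := by
    rw [Ideal.map_le_iff_le_comap]
    intro x hx
    rw [Ideal.mem_comap, mem_ordIdeal_one, ← RingHom.comp_apply, hφ.constantCoeff_comp]
    exact hx
  have h2 := Ideal.mem_map_of_mem φ ha
  rw [Ideal.map_pow] at h2
  simpa using ordIdeal_pow_le 1 N (Ideal.pow_right_mono h1 N h2)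

/-- A polynomial approximating `a` modulo `I ^ N` has the same terms of degree below `N` as `φ a`,
because `φ` maps `I ^ N` to order `N`. So the truncation of `φ a` approximates `a` equally well. -/
theorem IsExpansionHom.isExpansion (hφ : IsExpansionHom ε aug t φ) (h : IsGeneratedBy ε aug t)
    (a : A) : IsExpansion ε (RingHom.ker aug) t a (φ a) := by
  intro N
  obtain ⟨P, hP⟩ := h.exists_sub_eval₂_mem N a
  have h1 := hφ.mem_ordIdeal hP
  rw [map_sub, hφ.apply_eval₂] at h1
  have h2 : MvPolynomial.eval₂ ε t (P - truncTotal N (φ a)) ∈ RingHom.ker aug ^ N := by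
    refine eval₂_mem_pow h.mem fun J hJ => ?_
    rw [truncTotal_eq_of_sub_mem h1, MvPolynomial.coeff_sub, coeff_truncTotal _ hJ,
      MvPolynomial.coeff_coe, sub_self]
  have h3 := add_mem hP h2
  rwa [MvPolynomial.eval₂_sub, sub_add_sub_cancel] at h3

theorem IsExpansionHom.eq_of_isExpansion (hφ : IsExpansionHom ε aug t φ) {a : A}
    {f : MvPowerSeries σ R} (hf : IsExpansion ε (RingHom.ker aug) t a f) : f = φ a := by
  rw [← sub_eq_zero]
  refine eq_zero_of_forall_mem_ordIdeal fun N => ?_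
  have h1 := hφ.mem_ordIdeal (hf N)
  rw [map_sub, hφ.apply_eval₂] at h1
  have h2 := add_mem h1 (neg_mem (sub_truncTotal_mem_ordIdeal N f))
  rw [← neg_mem_iff]
  convert h2 using 1
  ring

/-- Formal smoothness yields an expansion homomorphism, for coordinates which are independent modulo
the square of the augmentation ideal. -/
theorem IsGeneratedBy.exists_isExpansionHom [Fintype σ] [Algebra R A] [Algebra.FormallySmooth R A]
    {aug : A →+* R} (h : IsGeneratedBy (algebraMap R A) aug t)
    (hind : ∀ r : σ → R, ∑ i, algebraMap R A (r i) * t i ∈ RingHom.ker aug ^ 2 → r = 0) :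
    ∃ φ : A →+* MvPowerSeries σ R, IsExpansionHom (algebraMap R A) aug t φ := by
  classical
  set I := RingHom.ker aug with hI
  set V := MvPolynomial.idealOfVars σ R with hV
  let ev : MvPolynomial σ R →ₐ[R] A := MvPolynomial.aeval t
  have hev : ∀ P, ev P = MvPolynomial.eval₂ (algebraMap R A) t P := fun P => rfl
  have haug : ∀ P, aug (ev P) = P.coeff 0 := by
    intro P
    have : aug.comp ev.toRingHom = MvPolynomial.constantCoeff := by
      refine MvPolynomial.ringHom_ext (fun r => ?_) fun i => ?_
      · simpa [ev] using RingHom.congr_fun h.comp_eq r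
      · simpa [ev] using h.mem i
    exact RingHom.congr_fun this P
  have hVI : V ^ 2 ≤ (I ^ 2).comap ev := fun P hP =>
    eval₂_mem_pow h.mem ((MvPolynomial.mem_pow_idealOfVars_iff' 2 P).mp hP)
  have hker : ∀ P, ev P ∈ I ^ 2 → P ∈ V ^ 2 := by
    intro P hP
    have h0 : P.coeff 0 = 0 := by
      rw [← haug]
      exact Ideal.pow_le_self two_ne_zero hP
    let r : σ → R := fun i => P.coeff (Finsupp.single i 1)
    let P₁ : MvPolynomial σ R := ∑ i, MvPolynomial.C (r i) * MvPolynomial.X i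
    have hP₁ : ∀ J : σ →₀ ℕ, J.degree < 2 → (P - P₁).coeff J = 0 := by
      intro J hJ
      rw [MvPolynomial.coeff_sub, MvPolynomial.coeff_sum]
      simp only [MvPolynomial.coeff_C_mul, MvPolynomial.coeff_X]
      have : J.degree = 0 ∨ J.degree = 1 := by omega
      rcases this with hJ0 | hJ1
      · rw [Finsupp.degree_eq_zero_iff] at hJ0
        subst hJ0
        simp [h0]
      · obtain ⟨j, rfl⟩ := degree_eq_one hJ1
        simp [Finsupp.single_left_inj, r]
    have h1 : ev P₁ ∈ I ^ 2 := by
      have := sub_mem hP (eval₂_mem_pow (I := I) (ε := algebraMap R A) h.mem hP₁)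
      rwa [← hev, map_sub, sub_sub_cancel] at this
    have h2 : r = 0 := hind r (by simpa [P₁, ev] using h1)
    have h3 : P₁ = 0 := Finset.sum_eq_zero fun i _ => by rw [h2]; simp
    rw [MvPolynomial.mem_pow_idealOfVars_iff']
    simpa [h3] using hP₁
  -- Generation and independence of the `t i` modulo squares identify `A / I ^ 2` with polynomials
  -- modulo `V ^ 2`.
  let β : (MvPolynomial σ R ⧸ V ^ 2) →ₐ[R] A ⧸ I ^ 2 := Ideal.quotientMapₐ (I ^ 2) ev hVI
  have hβ : Function.Bijective β := by
    refine ⟨(injective_iff_map_eq_zero β).mpr fun x hx => ?_, fun x => ?_⟩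
    · obtain ⟨P, rfl⟩ := Ideal.Quotient.mk_surjective x
      exact Ideal.Quotient.eq_zero_iff_mem.mpr (hker P (Ideal.Quotient.eq_zero_iff_mem.mp hx))
    · obtain ⟨a, rfl⟩ := Ideal.Quotient.mk_surjective x
      obtain ⟨P, hP⟩ := h.exists_sub_eval₂_mem 2 a
      exact ⟨Ideal.Quotient.mk _ P, (Ideal.Quotient.eq.mpr hP).symm⟩
  let b := AlgEquiv.ofBijective β hβ
  let ψ₂ : A →ₐ[R] MvPolynomial σ R ⧸ V ^ 2 :=
    b.symm.toAlgHom.comp (Ideal.Quotient.mkₐ R (I ^ 2))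
  have hψ₂ : ∀ P, ψ₂ (ev P) = Ideal.Quotient.mk _ P := fun P =>
    b.symm_apply_eq.mpr rfl
  -- Formal smoothness lifts `ψ₂` to the completion for `V ^ 2`, of which the target of `ψ₂` is the
  -- first stage; the maps `f n` return to the `V`-adic tower.
  obtain ⟨g, hg⟩ := Algebra.FormallySmooth.exists_adicCompletionEvalOneₐ_comp_eq ψ₂
  have hVn : ∀ n, (V ^ 2) ^ n ≤ V ^ n := fun n => by
    rw [← pow_mul]; exact Ideal.pow_le_pow_right (by omega)
  let f : (n : ℕ) → A →ₐ[R] MvPolynomial σ R ⧸ V ^ n := fun n =>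
    (Ideal.Quotient.factorₐ R (hVn n)).comp
      (((AdicCompletion.evalₐ (V ^ 2) n).restrictScalars R).comp g)
  have hf : ∀ {m n : ℕ} (hle : m ≤ n),
      (Ideal.Quotient.factorₐ R (Ideal.pow_le_pow_right hle)).comp (f n) = f m := by
    intro m n hle
    ext a
    obtain ⟨x, hx⟩ := AdicCompletion.mk_surjective _ _ (g a)
    have e : ∀ n, f n a = Ideal.Quotient.mk (V ^ n) (x.val n) := fun n => by
      simp [f, ← hx]
    rw [AlgHom.comp_apply, e, e]
    refine Ideal.Quotient.eq.mpr (hVn m ?_)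
    exact Ideal.Quotient.eq.mp (AdicCompletion.Ideal.mk_eq_mk (V ^ 2) hle x)
  let ψ : A →ₐ[R] MvPowerSeries σ R :=
    ((toAdicCompletionAlgEquiv σ R).symm.toAlgHom.restrictScalars R).comp
      (AdicCompletion.liftAlgHom V f hf)
  have hψ : ∀ n a, Ideal.Quotient.mk (V ^ n) (truncTotal n (ψ a)) = f n a := by
    intro n a
    have e1 : toAdicCompletionAlgEquiv σ R (ψ a) = AdicCompletion.liftAlgHom V f hf a :=
      (toAdicCompletionAlgEquiv σ R).apply_symm_apply _
    have e2 := congrArg (AdicCompletion.evalₐ V n) e1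
    rw [AdicCompletion.evalₐ_liftAlgHom] at e2
    rw [← e2]
    have compat : ∀ {m n : ℕ} (hle : m ≤ n),
        (Ideal.Quotient.factorₐ (MvPolynomial σ R) (Ideal.pow_le_pow_right hle)).comp
          (truncTotalAlgHom σ R n) = truncTotalAlgHom σ R m := fun hle ↦ AlgHom.ext fun x ↦
      Ideal.Quotient.eq.mpr (truncTotal_sub_truncTotal_mem_pow_idealOfVars hle le_rfl x)
    exact (AdicCompletion.evalₐ_liftAlgHom V (truncTotalAlgHom σ R) compat n (ψ a)).symm
  have hψ' : ∀ (a : A) (P : MvPolynomial σ R), a - ev P ∈ I ^ 2 → ψ a - P ∈ ordIdeal σ R 2 := by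
    intro a P haP
    obtain ⟨x, hx⟩ := AdicCompletion.mk_surjective _ _ (g a)
    have e0 : ψ₂ a = ψ₂ (ev P) := congrArg b.symm (Ideal.Quotient.eq.mpr haP)
    have e1 : Ideal.Quotient.mk (V ^ 2) (x.val 1) = Ideal.Quotient.mk (V ^ 2) P := by
      have := AlgHom.congr_fun hg a
      rw [AlgHom.comp_apply, e0, hψ₂, ← hx] at this
      simpa [AdicCompletion.evalOneₐ] using this
    have e2 : Ideal.Quotient.mk (V ^ 2) (truncTotal 2 (ψ a)) =
        Ideal.Quotient.mk (V ^ 2) (x.val 2) := by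
      rw [hψ]; simp [f, ← hx]
    have e3 := AdicCompletion.Ideal.mk_eq_mk (V ^ 2) (show 1 ≤ 2 by norm_num) x
    rw [pow_one] at e3
    have e4 := Ideal.Quotient.eq.mp (e2.trans (e3.trans e1))
    intro J hJ
    have e5 := (MvPolynomial.mem_pow_idealOfVars_iff' 2 _).mp e4 J hJ
    rwa [MvPolynomial.coeff_sub, coeff_truncTotal _ hJ, ← MvPolynomial.coeff_coe, ← map_sub] at e5
  have hψC : ∀ r, ψ (algebraMap R A r) = C r := fun r => ψ.commutes r
  have hψ0 : ∀ a, constantCoeff (ψ a) = aug a := by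
    intro a
    obtain ⟨P, hP⟩ := h.exists_sub_eval₂_mem 2 a
    have h1 := hψ' a P hP 0 (by simp)
    have h2 : aug a - aug (ev P) = 0 := by
      rw [← map_sub]
      exact Ideal.pow_le_self two_ne_zero hP
    rw [coeff_zero_eq_constantCoeff_apply, map_sub, sub_eq_zero] at h1
    rw [h1, sub_eq_zero.mp h2, haug, ← coeff_zero_eq_constantCoeff_apply, MvPolynomial.coeff_coe]
  -- The lift is prescribed only up to order two, so `t i` goes to a series tangent to `X i`; the
  -- formal inverse of this tuple corrects it.
  have htan : IsTangentToId fun i => ψ (t i) := fun i => by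
    simpa [ev] using hψ' (t i) (MvPolynomial.X i) (by simp [ev])
  obtain ⟨Q, hQ, -, hQ'⟩ := htan.exists_inverse
  have hs := hasSubst_of_zero hQ.constantCoeff
  refine ⟨(substAlgHom hs).toRingHom.comp ψ.toRingHom, ?_, fun i => ?_, ?_⟩
  · ext1 r
    simp [hψC]
  · simpa using hQ' i
  · ext1 a
    simp [constantCoeff_subst_of_zero hQ.constantCoeff, hψ0]

end Expansion

/-! ### The formal group law of a smooth commutative group scheme -/

section ExpansionMap

open MvPowerSeries

variable {R A C σ τ : Type*} [CommRing R] [CommRing A] [CommRing C] [Finite σ] {ε : R →+* A}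
  {aug : A →+* R} {t : σ → A}

theorem IsExpansion.map {I : Ideal A} {a : A} {f : MvPowerSeries σ R} (h : IsExpansion ε I t a f)
    (θ : A →+* C) {𝔞 : Ideal C} (hθ : ∀ a ∈ I, θ a ∈ 𝔞) (N : ℕ) :
    θ a - MvPolynomial.eval₂ (θ.comp ε) (θ ∘ t) (truncTotal N f) ∈ 𝔞 ^ N := by
  have h1 := Ideal.mem_map_of_mem θ (h N)
  rw [Ideal.map_pow, map_sub, MvPolynomial.hom_eval₂] at h1
  exact Ideal.pow_right_mono (Ideal.map_le_iff_le_comap.mpr hθ) N h1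

theorem subst_sub_eval₂_mem_ordIdeal {p : σ → MvPowerSeries τ R}
    (hp : ∀ i, constantCoeff (p i) = 0) (f : MvPowerSeries σ R) (N : ℕ) :
    subst p f - MvPolynomial.eval₂ MvPowerSeries.C p (truncTotal N f) ∈ ordIdeal τ R N := by
  have h1 := subst_mem_ordIdeal (S := R) hp (sub_truncTotal_mem_ordIdeal N f)
  rwa [subst_sub (hasSubst_of_zero hp), subst_coe, MvPolynomial.aeval_def] at h1

/-- Homomorphisms to rings of power series are determined by their values at coordinates. -/
theorem IsExpansion.eq_subst {I : Ideal A} {a : A} {f : MvPowerSeries σ R}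
    (h : IsExpansion ε I t a f) {θ : A →+* MvPowerSeries τ R}
    (hC : θ.comp ε = MvPowerSeries.C) (hθ : ∀ a ∈ I, constantCoeff (θ a) = 0)
    (ht : ∀ i, t i ∈ I) : θ a = subst (θ ∘ t) f := by
  rw [← sub_eq_zero]
  refine eq_zero_of_forall_mem_ordIdeal fun N => ?_
  have h1 := h.map θ (𝔞 := ordIdeal τ R 1) (fun a ha => mem_ordIdeal_one.mpr (hθ a ha)) N
  have h2 := ordIdeal_pow_le 1 N h1
  rw [one_mul, hC] at h2
  have h3 := sub_mem h2 (subst_sub_eval₂_mem_ordIdeal (p := θ ∘ t) (fun i => hθ _ (ht i)) f N)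
  rwa [sub_sub_sub_cancel_right] at h3

end ExpansionMap

/-! ### Formal coordinates, formal points and the axioms of the group law -/

section FormalGroupLaw

variable {Y G : Scheme.{u}} {q : G ⟶ Y} [GrpObj (Over.mk q)] {y : Y} {κ : Type} [Fintype κ]
  {t : κ → G.presheaf.stalk (idSection q y)}

theorem IsFormalCoordinates.isGeneratedBy (ht : IsFormalCoordinates q y t) :
    IsGeneratedBy (structHom q y) (augHom q y) t := by
  obtain ⟨h, -, hspan⟩ := ht
  refine ⟨augHom_comp_structHom q y, h, fun a ha => ?_⟩
  have h1 : (augIdeal q y).toCotangent ⟨a, ha⟩ ∈ Submodule.span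
      (G.presheaf.stalk (idSection q y) ⧸ augIdeal q y)
      (Set.range fun i => (augIdeal q y).toCotangent ⟨t i, h i⟩) := hspan ▸ Submodule.mem_top
  obtain ⟨c, hc⟩ := (Submodule.mem_span_range_iff_exists_fun _).mp h1
  choose b hb using fun i => Ideal.Quotient.mk_surjective (c i)
  have h2 : (augIdeal q y).toCotangent (⟨a, ha⟩ - ∑ i, b i • ⟨t i, h i⟩) = 0 := by
    rw [map_sub, map_sum, sub_eq_zero, ← hc]
    refine Finset.sum_congr rfl fun i _ => ?_
    rw [map_smul, ← hb]
    rfl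
  rw [Ideal.toCotangent_eq_zero] at h2
  have h3 : a - ∑ i, b i * t i ∈ augIdeal q y ^ 2 := by simpa using h2
  rw [← sub_add_cancel a (∑ i, b i * t i), add_comm]
  refine Submodule.add_mem_sup (Ideal.sum_mem _ fun i _ => ?_) h3
  exact Ideal.mul_mem_left _ _ (Ideal.subset_span ⟨i, rfl⟩)

theorem IsFormalCoordinates.eq_zero_of_sum_mem (ht : IsFormalCoordinates q y t)
    (r : κ → Y.presheaf.stalk y) (hr : ∑ i, structHom q y (r i) * t i ∈ augIdeal q y ^ 2) :
    r = 0 := by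
  obtain ⟨h, hind, -⟩ := ht
  have h1 : (augIdeal q y).toCotangent (∑ i, structHom q y (r i) • ⟨t i, h i⟩) = 0 := by
    rw [Ideal.toCotangent_eq_zero]
    simpa using hr
  rw [map_sum] at h1
  have h2 := Fintype.linearIndependent_iff.mp hind
    (fun i => Ideal.Quotient.mk _ (structHom q y (r i))) (by
      rw [← h1]
      refine Finset.sum_congr rfl fun i _ => ?_
      rw [map_smul]
      rfl)
  funext i
  have h3 : structHom q y (r i) ∈ augIdeal q y := Ideal.Quotient.eq_zero_iff_mem.mp (h2 i)
  have h4 := RingHom.congr_fun (augHom_comp_structHom q y) (r i)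
  exact h4.symm.trans h3

theorem formallySmooth_germPullback {X Z : Scheme.{u}} (q : X ⟶ Z) [Smooth q] {x : X} {z : Z}
    (h : q x = z) : (germPullback q h).FormallySmooth := by
  subst h
  have : germPullback q (rfl : q x = q x) = (q.stalkMap x).hom := by simp [germPullback]
  rw [this, ← Scheme.Hom.mem_smoothLocus, Scheme.Hom.smoothLocus_eq_top]
  trivial

theorem IsFormalCoordinates.exists_isExpansionHom [Smooth q] (ht : IsFormalCoordinates q y t) :
    ∃ φ, IsExpansionHom (structHom q y) (augHom q y) t φ := by
  algebraize [structHom q y]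
  have : Algebra.FormallySmooth (Y.presheaf.stalk y) (G.presheaf.stalk (idSection q y)) :=
    formallySmooth_germPullback q _
  exact ht.isGeneratedBy.exists_isExpansionHom ht.eq_zero_of_sum_mem

theorem IsFormalCoordinates.isGeneratedBy₂ (ht : IsFormalCoordinates q y t) :
    IsGeneratedBy (structHom₂ q y) (augHom₂ q y)
      (Sum.elim (fun j => fstHom q y (t j)) fun j => sndHom q y (t j)) := by
  refine ⟨augHom₂_comp_structHom₂ q y, ?_, ?_⟩
  · rintro (i | i)
    · exact (RingHom.congr_fun (augHom₂_comp_fstHom q y) (t i)).trans (ht.isGeneratedBy.mem i)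
    · exact (RingHom.congr_fun (augHom₂_comp_sndHom q y) (t i)).trans (ht.isGeneratedBy.mem i)
  · refine (ker_augHom₂_le ht.isGeneratedBy.le_sup).trans (sup_le_sup_right (le_of_eq ?_) _)
    rw [Ideal.map_span, Ideal.map_span, ← Ideal.span_union, Set.Sum.elim_range, ← Set.range_comp,
      ← Set.range_comp]
    rfl

/-- The product of two points is computed by the formal group law. -/
theorem IsFormalGroupLawOf.exists_mul {C : Type u} [CommRing C] {c : Y.presheaf.stalk y →+* C}
    [IsLocalRing C] [IsLocalHom c] {F : κ → MvPowerSeries (κ ⊕ κ) (Y.presheaf.stalk y)}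
    (hF : IsFormalGroupLawOf q y t F) {𝔞 : Ideal C} (h𝔞 : 𝔞 ≠ ⊤)
    {φ₁ φ₂ : G.presheaf.stalk (idSection q y) →+* C}
    (h₁ : φ₁.comp (structHom q y) = c) (h₂ : φ₂.comp (structHom q y) = c)
    (hI₁ : ∀ a ∈ augIdeal q y, φ₁ a ∈ 𝔞) (hI₂ : ∀ a ∈ augIdeal q y, φ₂ a ∈ 𝔞) :
    ∃ θ : G.presheaf.stalk (idSection q y) →+* C,
      θ.comp (structHom q y) = c ∧ (∀ a ∈ augIdeal q y, θ a ∈ 𝔞) ∧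
      (∀ i N, θ (t i) - MvPolynomial.eval₂ c (Sum.elim (φ₁ ∘ t) (φ₂ ∘ t))
        (MvPowerSeries.truncTotal N (F i)) ∈ 𝔞 ^ N) ∧
      ∀ g₁ g₂ : Over.mk (homPt y c) ⟶ Over.mk q, g₁.left = homPt _ φ₁ → g₂.left = homPt _ φ₂ →
        (g₁ * g₂).left = homPt _ θ := by
  obtain ⟨δ, d₁, d₂, dc, dI, dmul⟩ := exists_lift_eq h𝔞 h₁ h₂ hI₁ hI₂
  refine ⟨δ.comp (mulHom q y), ?_, fun a ha => dI _ ?_, fun i N => ?_, dmul⟩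
  · rw [RingHom.comp_assoc, mulHom_comp_structHom, dc]
  · exact (RingHom.congr_fun (augHom₂_comp_mulHom q y) a).trans ha
  · have := (hF i).map δ dI N
    have e : Sum.elim (φ₁ ∘ t) (φ₂ ∘ t) =
        δ ∘ Sum.elim (fun j => fstHom q y (t j)) fun j => sndHom q y (t j) := by
      rw [← d₁, ← d₂]
      ext (j | j) <;> rfl
    rw [e, ← dc]
    exact this

open MvPowerSeries

variable {τ : Type}

instance isLocalHom_C {R : Type*} [CommRing R] : IsLocalHom (C : R →+* MvPowerSeries τ R) :=
  ⟨fun a ha => by simpa using ha.map (constantCoeff (σ := τ) (R := R))⟩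

/-- The point with values in power series with given coordinates. -/
def formalPt (φ : G.presheaf.stalk (idSection q y) →+* MvPowerSeries κ (Y.presheaf.stalk y))
    (hφ : IsExpansionHom (structHom q y) (augHom q y) t φ)
    (p : κ → MvPowerSeries τ (Y.presheaf.stalk y)) (hp : ∀ i, constantCoeff (p i) = 0) :
    Over.mk (homPt y (C : _ →+* MvPowerSeries τ (Y.presheaf.stalk y))) ⟶ Over.mk q :=
  Over.homMk (homPt _ ((substAlgHom (hasSubst_of_zero hp)).toRingHom.comp φ))
    (homPt_structure_comp _ (by
      rw [RingHom.comp_assoc, hφ.comp_eq]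
      ext1 r
      simp))

section

variable {φ : G.presheaf.stalk (idSection q y) →+* MvPowerSeries κ (Y.presheaf.stalk y)}
    {hφ : IsExpansionHom (structHom q y) (augHom q y) t φ}
    {p p' : κ → MvPowerSeries τ (Y.presheaf.stalk y)} {hp : ∀ i, constantCoeff (p i) = 0}
    {hp' : ∀ i, constantCoeff (p' i) = 0}
    {F : κ → MvPowerSeries (κ ⊕ κ) (Y.presheaf.stalk y)}

/-- The coordinates are recovered as the values of the `t i`. Identities between formal points thus
become identities of power series. -/
theorem formalPt_injective (h : formalPt φ hφ p hp = formalPt φ hφ p' hp') : p = p' := by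
  funext i
  have h1 := homPt_injective (congrArg (fun k => k.left) h)
  have h2 := RingHom.congr_fun h1 (t i)
  simpa [hφ.apply_eq, subst_X (hasSubst_of_zero hp), subst_X (hasSubst_of_zero hp')] using h2

theorem formalPt_zero : formalPt φ hφ (0 : κ → MvPowerSeries τ (Y.presheaf.stalk y))
    (fun _ => map_zero _) = 1 := by
  rw [Hom.one_def]
  ext1
  rw [Over.comp_left]
  refine Eq.trans (congrArg (homPt _) (?_ : _ = (C : _ →+* _).comp (augHom q y)))
    (homPt_comp (idSection q) rfl (C : _ →+* MvPowerSeries τ (Y.presheaf.stalk y))).symm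
  ext1 a
  have h0 : ∀ f : MvPowerSeries κ (Y.presheaf.stalk y),
      subst (0 : κ → MvPowerSeries τ (Y.presheaf.stalk y)) f = C (constantCoeff f) := by
    intro f
    rw [← sub_eq_zero]
    refine eq_zero_of_forall_mem_ordIdeal fun N => ?_
    have h1 := subst_sub_eval₂_mem_ordIdeal
      (p := (0 : κ → MvPowerSeries τ (Y.presheaf.stalk y))) (fun _ => map_zero _) f (N + 1)
    have h2 : MvPolynomial.constantCoeff (truncTotal (N + 1) f) = constantCoeff f :=
      coeff_truncTotal f (by simp)
    rw [MvPolynomial.eval₂_zero_apply, h2] at h1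
    exact ordIdeal_anti N.le_succ h1
  simp [h0, ← hφ.constantCoeff_comp]

/-- Take for `𝔞` the series without constant term. Its powers lie in the order filtration, so the
approximations of `exists_mul` determine the coordinates of the product, and these determine the
point. -/
theorem formalPt_mul (hF : IsFormalGroupLawOf q y t F) (hg : IsGeneratedBy (structHom q y) (augHom q y) t)
    (hF0 : ∀ i, constantCoeff (F i) = 0) :
    formalPt φ hφ p hp * formalPt φ hφ p' hp' =
      formalPt φ hφ (fun i => subst (Sum.elim p p') (F i))
        fun i => by rw [constantCoeff_subst_of_zero (constantCoeff_elim hp hp'), hF0, map_zero] := by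
  have hpt : ∀ p : κ → MvPowerSeries τ (Y.presheaf.stalk y), ∀ hp : ∀ i, constantCoeff (p i) = 0,
      ∀ a ∈ augIdeal q y, ((substAlgHom (hasSubst_of_zero hp)).toRingHom.comp φ) a ∈
        ordIdeal τ (Y.presheaf.stalk y) 1 := by
    intro p hp a ha
    rw [mem_ordIdeal_one]
    have : constantCoeff (φ a) = 0 := (RingHom.congr_fun hφ.constantCoeff_comp a).trans ha
    simp [constantCoeff_subst_of_zero hp, this]
  have hpc : ∀ p : κ → MvPowerSeries τ (Y.presheaf.stalk y), ∀ hp : ∀ i, constantCoeff (p i) = 0,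
      ((substAlgHom (hasSubst_of_zero hp)).toRingHom.comp φ).comp (structHom q y) = C := by
    intro p hp
    rw [RingHom.comp_assoc, hφ.comp_eq]
    ext1 r
    simp
  have hne : ordIdeal τ (Y.presheaf.stalk y) 1 ≠ ⊤ := by
    rw [Ne, Ideal.eq_top_iff_one, mem_ordIdeal_one, map_one]
    exact one_ne_zero
  obtain ⟨θ, θc, θI, θF, θm⟩ := hF.exists_mul hne (hpc p hp) (hpc p' hp') (hpt p hp) (hpt p' hp')
  ext1
  refine (θm _ _ rfl rfl).trans (congrArg _ ?_)
  have ep : ∀ p : κ → MvPowerSeries τ (Y.presheaf.stalk y), ∀ hp : ∀ i, constantCoeff (p i) = 0,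
      ((substAlgHom (hasSubst_of_zero hp)).toRingHom.comp φ) ∘ t = p := by
    intro p hp
    funext i
    simp [hφ.apply_eq, subst_X (hasSubst_of_zero hp)]
  have et : θ ∘ t = fun i => subst (Sum.elim p p') (F i) := by
    funext i
    rw [← sub_eq_zero]
    refine eq_zero_of_forall_mem_ordIdeal fun N => ?_
    have h1 := ordIdeal_pow_le 1 N (θF i N)
    rw [one_mul, ep p hp, ep p' hp'] at h1
    have h2 := sub_mem h1 (subst_sub_eval₂_mem_ordIdeal (constantCoeff_elim hp hp') (F i) N)
    rwa [sub_sub_sub_cancel_right] at h2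
  ext1 a
  have := (hφ.isExpansion hg a).eq_subst θc (fun a ha => mem_ordIdeal_one.mp (θI a ha)) hg.mem
  rw [this, et]
  simp

end

/-- The formal group law of a smooth commutative group scheme along the identity section. -/
theorem IsFormalCoordinates.exists_isFormalGroupLawOf [Smooth q] [IsCommMonObj (Over.mk q)]
    (ht : IsFormalCoordinates q y t) :
    ∃ F : κ → MvPowerSeries (κ ⊕ κ) (Y.presheaf.stalk y), IsFormalGroup F ∧
      IsFormalGroupLawOf q y t F ∧ ∀ F', IsFormalGroupLawOf q y t F' → F' = F := by
  obtain ⟨φ, hφ⟩ := ht.exists_isExpansionHom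
  have hg := ht.isGeneratedBy
  have hne : ordIdeal (κ ⊕ κ) (Y.presheaf.stalk y) 1 ≠ ⊤ := by
    rw [Ne, Ideal.eq_top_iff_one, mem_ordIdeal_one, map_one]
    exact one_ne_zero
  let pr : (κ → κ ⊕ κ) → G.presheaf.stalk (idSection q y) →+*
      MvPowerSeries (κ ⊕ κ) (Y.presheaf.stalk y) := fun e =>
    (substAlgHom (hasSubst_of_zero (constantCoeff_vars (R := Y.presheaf.stalk y) e))).toRingHom.comp φ
  have prc : ∀ e, (pr e).comp (structHom q y) = C := by
    intro e
    rw [RingHom.comp_assoc, hφ.comp_eq]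
    ext1 r
    simp
  have prI : ∀ e, ∀ a ∈ augIdeal q y, pr e a ∈ ordIdeal (κ ⊕ κ) (Y.presheaf.stalk y) 1 := by
    intro e a ha
    rw [mem_ordIdeal_one]
    have : constantCoeff (φ a) = 0 := (RingHom.congr_fun hφ.constantCoeff_comp a).trans ha
    simp [pr, constantCoeff_subst_of_zero (constantCoeff_vars (R := Y.presheaf.stalk y) e), this]
  have prt : ∀ e i, pr e (t i) = X (e i) := by
    intro e i
    simp [pr, hφ.apply_eq, subst_X (hasSubst_of_zero (constantCoeff_vars (R := Y.presheaf.stalk y) e)),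
      vars]
  -- The pair of generic points with coordinates `U` and `V` is an expansion homomorphism for `G ×_Y
  -- G`; applied to the pullback of `t i` under multiplication it gives `F i`.
  obtain ⟨δ, d₁, d₂, dc, dI, -⟩ := exists_lift_eq hne (prc Sum.inl) (prc Sum.inr) (prI _) (prI _)
  have hδ : IsExpansionHom (structHom₂ q y) (augHom₂ q y)
      (Sum.elim (fun j => fstHom q y (t j)) fun j => sndHom q y (t j)) δ := by
    refine ⟨dc, ?_, ?_⟩
    · rintro (i | i)
      · exact (RingHom.congr_fun d₁ (t i)).trans (prt _ i)
      · exact (RingHom.congr_fun d₂ (t i)).trans (prt _ i)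
    · ext1 a
      have h1 := mem_ordIdeal_one.mp (dI _ (ht.isGeneratedBy₂.sub_apply_mem a))
      rw [map_sub, map_sub, sub_eq_zero] at h1
      refine h1.trans ?_
      rw [← RingHom.comp_apply δ, dc, constantCoeff_C]
  have hF : IsFormalGroupLawOf q y t fun i => δ (mulHom q y (t i)) :=
    fun i => hδ.isExpansion ht.isGeneratedBy₂ _
  have hF0 : ∀ i, constantCoeff (δ (mulHom q y (t i))) = 0 := fun i =>
    (RingHom.congr_fun hδ.constantCoeff_comp _).trans
      ((RingHom.congr_fun (augHom₂_comp_mulHom q y) (t i)).trans (hg.mem i))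
  refine ⟨_, ⟨hF0, ?_, ?_, ?_⟩, hF, fun F' hF' => funext fun i => hδ.eq_of_isExpansion (hF' i)⟩
  -- The three axioms are the unit law, commutativity and associativity for formal points whose
  -- coordinates are the variables themselves.
  · have h1 := one_mul (formalPt φ hφ X fun i => constantCoeff_X i)
    rw [← formalPt_zero (φ := φ) (hφ := hφ), formalPt_mul hF hg hF0] at h1
    exact fun i => congrFun (formalPt_injective h1) i
  · have h1 := mul_comm (formalPt φ hφ _ (constantCoeff_vars Sum.inr))
      (formalPt φ hφ _ (constantCoeff_vars Sum.inl))
    rw [formalPt_mul hF hg hF0, formalPt_mul hF hg hF0] at h1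
    intro i
    refine (congrFun (formalPt_injective h1) i).trans ?_
    have : Sum.elim (vars (Y.presheaf.stalk y) Sum.inl) (vars (Y.presheaf.stalk y) Sum.inr) =
        (X : κ ⊕ κ → MvPowerSeries (κ ⊕ κ) (Y.presheaf.stalk y)) := by ext1 (j | j) <;> rfl
    rw [this, subst_self, id]
  · have h1 := mul_assoc
      (formalPt φ hφ _ (constantCoeff_vars (τ := κ ⊕ (κ ⊕ κ)) Sum.inl))
      (formalPt φ hφ _ (constantCoeff_vars (Sum.inr ∘ Sum.inl)))
      (formalPt φ hφ _ (constantCoeff_vars (Sum.inr ∘ Sum.inr)))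
    rw [formalPt_mul hF hg hF0, formalPt_mul hF hg hF0, formalPt_mul hF hg hF0,
      formalPt_mul hF hg hF0] at h1
    exact fun i => congrFun (formalPt_injective h1) i

end FormalGroupLaw

/-! ### Values of convergent power series -/

section Values

open MvPowerSeries IsLocalRing

variable {A : Type*} [CommRing A] [IsLocalRing A] {σ τ : Type*}

/-- The power series `f` is congruent to the polynomial `P` modulo `𝔪 ^ N`. -/
def IsApprox (N : ℕ) (f : MvPowerSeries σ A) (P : MvPolynomial σ A) : Prop :=
  MvPowerSeries.map (Ideal.Quotient.mk (maximalIdeal A ^ N)) f =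
    MvPowerSeries.map (Ideal.Quotient.mk (maximalIdeal A ^ N)) (P : MvPowerSeries σ A)

/-- The power series `f` is convergent, and its value at `w` is `v`. -/
def ConvergesTo (f : MvPowerSeries σ A) (w : σ → A) (v : A) : Prop :=
  ∀ N, ∃ P : MvPolynomial σ A, IsApprox N f P ∧ v - MvPolynomial.eval w P ∈ maximalIdeal A ^ N

variable {N : ℕ} {f g : MvPowerSeries σ A} {P Q : MvPolynomial σ A} {w w' : σ → A} {v v' : A}

omit [IsLocalRing A] in
theorem map_mk_eq_iff {I : Ideal A} {f g : MvPowerSeries σ A} :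
    MvPowerSeries.map (Ideal.Quotient.mk I) f = MvPowerSeries.map (Ideal.Quotient.mk I) g ↔
      ∀ J, coeff J f - coeff J g ∈ I := by
  simp only [MvPowerSeries.ext_iff, coeff_map, Ideal.Quotient.eq]

theorem isApprox_iff : IsApprox N f P ↔ ∀ J, coeff J f - P.coeff J ∈ maximalIdeal A ^ N :=
  map_mk_eq_iff

theorem IsApprox.add (hf : IsApprox N f P) (hg : IsApprox N g Q) : IsApprox N (f + g) (P + Q) := by
  rw [IsApprox, MvPolynomial.coe_add, map_add, map_add, hf, hg]

theorem IsApprox.mul (hf : IsApprox N f P) (hg : IsApprox N g Q) : IsApprox N (f * g) (P * Q) := by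
  rw [IsApprox, MvPolynomial.coe_mul, map_mul, map_mul, hf, hg]

theorem isApprox_coe (P : MvPolynomial σ A) : IsApprox N (P : MvPowerSeries σ A) P := rfl

theorem isApprox_sum_monomial {T : Finset (σ →₀ ℕ)}
    (hT : ∀ J ∉ T, coeff J f ∈ maximalIdeal A ^ N) :
    IsApprox N f (∑ J ∈ T, MvPolynomial.monomial J (coeff J f)) := by
  classical
  rw [isApprox_iff]
  intro J
  rw [MvPolynomial.coeff_sum]
  simp only [MvPolynomial.coeff_monomial, Finset.sum_ite_eq']
  split_ifs with hJ
  · rw [sub_self]; exact zero_mem _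
  · rw [sub_zero]; exact hT J hJ

theorem isConvergent_iff : IsConvergent f ↔ ∀ N, ∃ P, IsApprox N f P := by
  refine forall_congr' fun N => ⟨fun h => ⟨_, isApprox_sum_monomial (T := h.toFinset)
    fun J hJ => by_contra fun hc => hJ (h.mem_toFinset.mpr hc)⟩, ?_⟩
  · rintro ⟨P, hP⟩
    refine P.support.finite_toSet.subset fun J hJ => ?_
    by_contra hc
    have := isApprox_iff.mp hP J
    rw [MvPolynomial.notMem_support_iff.mp hc, sub_zero] at this
    exact hJ this

theorem IsApprox.eval_sub_mem (hP : IsApprox N f P) (hQ : IsApprox N f Q) (w : σ → A) :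
    MvPolynomial.eval w P - MvPolynomial.eval w Q ∈ maximalIdeal A ^ N := by
  have h : MvPolynomial.map (Ideal.Quotient.mk (maximalIdeal A ^ N)) P =
      MvPolynomial.map (Ideal.Quotient.mk (maximalIdeal A ^ N)) Q := by
    ext J
    have := congrArg (coeff J) (hP.symm.trans hQ)
    simpa [MvPolynomial.coeff_map] using! this
  rw [← Ideal.Quotient.eq, ← MvPolynomial.eval₂_id, ← MvPolynomial.eval₂_id,
    MvPolynomial.hom_eval₂, MvPolynomial.hom_eval₂, RingHom.comp_id, MvPolynomial.eval₂_eq_eval_map, MvPolynomial.eval₂_eq_eval_map, h]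

theorem ConvergesTo.sub_eval_mem (h : ConvergesTo f w v) (hP : IsApprox N f P) :
    v - MvPolynomial.eval w P ∈ maximalIdeal A ^ N := by
  obtain ⟨Q, hQ, hv⟩ := h N
  have := add_mem hv (hQ.eval_sub_mem hP w)
  rwa [sub_add_sub_cancel] at this

theorem ConvergesTo.isConvergent (h : ConvergesTo f w v) : IsConvergent f :=
  isConvergent_iff.mpr fun N => ⟨_, (h N).choose_spec.1⟩

theorem ConvergesTo.hasValue (h : ConvergesTo f w v) : HasValue f w v := by
  classical
  intro N
  have hfin := h.isConvergent N
  refine ⟨hfin.toFinset, fun T hT => ⟨_, ?_, rfl⟩⟩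
  have hT' := isApprox_sum_monomial (f := f) (N := N) (T := T)
    fun J hJ => by_contra fun hc => hJ (hT (hfin.mem_toFinset.mpr hc))
  have := h.sub_eval_mem hT'
  rw [map_sum] at this
  simp only [MvPolynomial.eval_monomial] at this
  exact this

theorem ConvergesTo.of_finset (h : ∀ N, ∃ T : Finset (σ →₀ ℕ),
    (∀ J ∉ T, coeff J f ∈ maximalIdeal A ^ N) ∧
      v - ∑ J ∈ T, coeff J f * J.prod (fun i k => w i ^ k) ∈ maximalIdeal A ^ N) :
    ConvergesTo f w v := by
  classical
  intro N
  obtain ⟨T, hT, hv⟩ := h N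
  refine ⟨_, isApprox_sum_monomial hT, ?_⟩
  rw [map_sum]
  simpa only [MvPolynomial.eval_monomial] using hv

theorem eq_of_forall_sub_mem_pow [IsHausdorff (maximalIdeal A) A] {a b : A}
    (h : ∀ N, a - b ∈ maximalIdeal A ^ N) : a = b := by
  rw [← sub_eq_zero]
  refine IsHausdorff.haus ‹_› _ fun N => ?_
  rw [SModEq.sub_mem, sub_zero, smul_eq_mul, Ideal.mul_top]
  exact h N

theorem ConvergesTo.unique [IsHausdorff (maximalIdeal A) A] (h : ConvergesTo f w v)
    (h' : ConvergesTo f w v') : v = v' := by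
  refine eq_of_forall_sub_mem_pow fun N => ?_
  obtain ⟨P, hP, hv⟩ := h N
  have := sub_mem hv (h'.sub_eval_mem hP)
  rwa [sub_sub_sub_cancel_right] at this

theorem IsConvergent.exists_convergesTo [IsAdicComplete (maximalIdeal A) A] (h : IsConvergent f)
    (w : σ → A) : ∃ v, ConvergesTo f w v := by
  choose P hP using isConvergent_iff.mp h
  have mono : ∀ {m n}, m ≤ n → IsApprox m f (P n) := fun {m n} hmn => by
    rw [isApprox_iff]
    exact fun J => Ideal.pow_le_pow_right hmn (isApprox_iff.mp (hP n) J)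
  obtain ⟨v, hv⟩ := IsPrecomplete.prec (IsAdicComplete.toIsPrecomplete (I := maximalIdeal A)
    (M := A)) (f := fun n => MvPolynomial.eval w (P n)) (fun {m n} hmn => by
      rw [SModEq.sub_mem, smul_eq_mul, Ideal.mul_top]
      exact (hP m).eval_sub_mem (mono hmn) w)
  refine ⟨v, fun N => ⟨P N, hP N, ?_⟩⟩
  have := (hv N).symm
  rwa [SModEq.sub_mem, smul_eq_mul, Ideal.mul_top] at this

theorem ConvergesTo.add (hf : ConvergesTo f w v) (hg : ConvergesTo g w v') :
    ConvergesTo (f + g) w (v + v') := fun N => by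
  obtain ⟨P, hP, hv⟩ := hf N
  obtain ⟨Q, hQ, hv'⟩ := hg N
  refine ⟨P + Q, hP.add hQ, ?_⟩
  rw [map_add, add_sub_add_comm]
  exact add_mem hv hv'

theorem ConvergesTo.mul (hf : ConvergesTo f w v) (hg : ConvergesTo g w v') :
    ConvergesTo (f * g) w (v * v') := fun N => by
  obtain ⟨P, hP, hv⟩ := hf N
  obtain ⟨Q, hQ, hv'⟩ := hg N
  refine ⟨P * Q, hP.mul hQ, ?_⟩
  rw [map_mul, show v * v' - MvPolynomial.eval w P * MvPolynomial.eval w Q =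
    v' * (v - MvPolynomial.eval w P) + MvPolynomial.eval w P * (v' - MvPolynomial.eval w Q) by ring]
  exact add_mem (Ideal.mul_mem_left _ _ hv) (Ideal.mul_mem_left _ _ hv')

theorem convergesTo_coe (P : MvPolynomial σ A) (w : σ → A) :
    ConvergesTo (P : MvPowerSeries σ A) w (MvPolynomial.eval w P) := fun _ =>
  ⟨P, isApprox_coe P, by rw [sub_self]; exact zero_mem _⟩

theorem convergesTo_C (a : A) (w : σ → A) : ConvergesTo (C a) w a := by
  simpa using convergesTo_coe (MvPolynomial.C a) w

theorem convergesTo_X (i : σ) (w : σ → A) : ConvergesTo (X i) w (w i) := by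
  simpa using convergesTo_coe (MvPolynomial.X i) w

/-- Modulo `𝔪 ^ N` the series is a polynomial over `A`, and polynomials preserve congruences. -/
theorem ConvergesTo.sub_mem (hf : ConvergesTo f w v) (hf' : ConvergesTo f w' v')
    (h : ∀ i, w i - w' i ∈ maximalIdeal A ^ N) : v - v' ∈ maximalIdeal A ^ N := by
  obtain ⟨P, hP, hv⟩ := hf N
  have h1 := hf'.sub_eval_mem hP
  rw [← Ideal.Quotient.eq] at hv h1 ⊢
  rw [hv, h1, ← MvPolynomial.eval₂_id, ← MvPolynomial.eval₂_id, MvPolynomial.hom_eval₂,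
    MvPolynomial.hom_eval₂]
  congr 1
  exact funext fun i => Ideal.Quotient.eq.mpr (h i)

theorem IsApprox.subst [Finite σ] {a : σ → MvPowerSeries τ A} (ha : ∀ i, constantCoeff (a i) = 0)
    {Q : σ → MvPolynomial τ A} (hf : IsApprox N f P) (hQ : ∀ i, IsApprox N (a i) (Q i)) :
    IsApprox N (subst a f) (MvPolynomial.bind₁ Q P) := by
  rw [IsApprox, map_subst_of_zero ha, hf, ← map_subst_of_zero ha, subst_coe]
  have : ((MvPowerSeries.map (Ideal.Quotient.mk (maximalIdeal A ^ N))).comp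
      (MvPolynomial.aeval a).toRingHom) =
      ((MvPowerSeries.map (Ideal.Quotient.mk (maximalIdeal A ^ N))).comp
        MvPolynomial.coeToMvPowerSeries.ringHom).comp (MvPolynomial.bind₁ Q).toRingHom := by
    refine MvPolynomial.ringHom_ext (fun r => ?_) fun i => ?_
    · simp [MvPowerSeries.algebraMap_apply]
    · simpa using! hQ i
  exact RingHom.congr_fun this P

/-- Modulo `𝔪 ^ N` all series involved are polynomials, for which evaluation is compatible with
composition. -/
theorem ConvergesTo.subst [Finite σ] {a : σ → MvPowerSeries τ A}
    (ha : ∀ i, constantCoeff (a i) = 0) {x : τ → A} (hw : ∀ i, ConvergesTo (a i) x (w i))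
    (hf : ConvergesTo f w v) : ConvergesTo (subst a f) x v := fun N => by
  obtain ⟨P, hP, hv⟩ := hf N
  choose Q hQ hQ' using fun i => hw i N
  refine ⟨_, hP.subst ha hQ, ?_⟩
  rw [← Ideal.Quotient.eq] at hv ⊢
  rw [hv, MvPolynomial.eval, MvPolynomial.eval, MvPolynomial.eval₂Hom_bind₁,
    MvPolynomial.coe_eval₂Hom, MvPolynomial.coe_eval₂Hom, MvPolynomial.hom_eval₂, MvPolynomial.hom_eval₂]
  congr 1
  exact funext fun i => Ideal.Quotient.eq.mpr (hQ' i)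

variable (A) in
/-- The convergent power series. -/
def convergentSubring (σ : Type*) : Subring (MvPowerSeries σ A) where
  carrier := {f | IsConvergent f}
  mul_mem' hf hg := isConvergent_iff.mpr fun N => by
    obtain ⟨P, hP⟩ := isConvergent_iff.mp hf N
    obtain ⟨Q, hQ⟩ := isConvergent_iff.mp hg N
    exact ⟨_, hP.mul hQ⟩
  one_mem' := isConvergent_iff.mpr fun N => ⟨1, by simpa using isApprox_coe (1 : MvPolynomial σ A)⟩
  add_mem' hf hg := isConvergent_iff.mpr fun N => by
    obtain ⟨P, hP⟩ := isConvergent_iff.mp hf N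
    obtain ⟨Q, hQ⟩ := isConvergent_iff.mp hg N
    exact ⟨_, hP.add hQ⟩
  zero_mem' := isConvergent_iff.mpr fun N => ⟨0, by simpa using isApprox_coe (0 : MvPolynomial σ A)⟩
  neg_mem' hf N := by simpa using hf N

/-- Evaluation of convergent power series. -/
def valueHom [IsAdicComplete (maximalIdeal A) A] (w : σ → A) : convergentSubring A σ →+* A :=
  have H := fun f : convergentSubring A σ => (f.2.exists_convergesTo w).choose_spec
  { toFun f := (f.2.exists_convergesTo w).choose
    map_one' := (H 1).unique (by simpa using convergesTo_C 1 w)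
    map_mul' f g := (H (f * g)).unique ((H f).mul (H g))
    map_zero' := (H 0).unique (by simpa using convergesTo_C 0 w)
    map_add' f g := (H (f + g)).unique ((H f).add (H g)) }

theorem convergesTo_valueHom [IsAdicComplete (maximalIdeal A) A] (w : σ → A)
    (f : convergentSubring A σ) : ConvergesTo f.1 w (valueHom w f) :=
  (f.2.exists_convergesTo w).choose_spec

/-- The formal inverse of a tuple of convergent power series, congruent to the identity modulo `𝔪`,
is convergent. -/
theorem isConvergent_of_inverse [Finite σ] {P E : σ → MvPowerSeries σ A}
    (hE : IsTangentToId E) (hPE : ∀ i, MvPowerSeries.subst E (P i) = X i)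
    (hconv : ∀ i, IsConvergent (P i)) (hmod : ∀ i J, coeff J (P i - X i) ∈ maximalIdeal A) (i : σ) :
    IsConvergent (E i) := by
  classical
  have hE0 := hE.constantCoeff
  rw [isConvergent_iff]
  intro N
  induction N generalizing i with
  | zero => exact ⟨0, isApprox_iff.mpr fun J => by simp⟩
  | succ N ih =>
    choose Q hQ using ih
    have hh : IsConvergent (P i - X i) :=
      (convergentSubring A σ).sub_mem (hconv i) (convergesTo_X i 0).isConvergent
    have hfin := hh (N + 1)
    have hp := isApprox_sum_monomial (T := hfin.toFinset)
      fun J hJ => by_contra fun hc => hJ (hfin.mem_toFinset.mpr hc)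
    set p : MvPolynomial σ A := ∑ J ∈ hfin.toFinset, MvPolynomial.monomial J (coeff J (P i - X i))
    -- The fixed point equation `E = X - h(E)` with `h = P - X`. The coefficients of `h` lie in `𝔪`,
    -- so an approximation of `E` modulo `𝔪 ^ N` yields one modulo `𝔪 ^ (N + 1)`.
    have h1 : E i = X i - MvPowerSeries.subst E (P i - X i) := by
      rw [subst_sub (hasSubst_of_zero hE0), hPE, subst_X (hasSubst_of_zero hE0), sub_sub_cancel]
    refine ⟨MvPolynomial.X i - MvPolynomial.bind₁ Q p, isApprox_iff.mpr fun J => ?_⟩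
    have h2 : MvPowerSeries.map (Ideal.Quotient.mk (maximalIdeal A ^ (N + 1)))
        (MvPowerSeries.subst E (P i - X i)) = MvPowerSeries.map
          (Ideal.Quotient.mk (maximalIdeal A ^ (N + 1))) (MvPowerSeries.subst E (p : MvPowerSeries σ A)) := by
      rw [map_subst_of_zero hE0, hp, ← map_subst_of_zero hE0]
    have h3 := map_mk_eq_iff.mp h2 J
    have h4 : coeff J (MvPowerSeries.subst E (p : MvPowerSeries σ A)) -
        (MvPolynomial.bind₁ Q p).coeff J ∈ maximalIdeal A ^ (N + 1) := by
      rw [map_sum, subst_coe, map_sum, map_sum, MvPolynomial.coeff_sum, ← Finset.sum_sub_distrib]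
      refine sum_mem fun K _ => ?_
      rw [MvPolynomial.monomial_eq, map_mul (MvPolynomial.aeval E),
        map_mul (MvPolynomial.bind₁ Q), MvPolynomial.aeval_C,
        MvPolynomial.bind₁_C_right, MvPowerSeries.algebraMap_apply, Algebra.algebraMap_self,
        RingHom.id_apply, coeff_C_mul, MvPolynomial.coeff_C_mul, ← mul_sub, pow_succ']
      refine Ideal.mul_mem_mul (hmod i K) ?_
      have h5 : IsApprox N (MvPowerSeries.subst E ((K.prod fun i k => MvPolynomial.X i ^ k :
        MvPolynomial σ A) : MvPowerSeries σ A)) _ := (isApprox_coe _).subst hE0 hQ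
      rw [subst_coe] at h5
      exact isApprox_iff.mp h5 J
    rw [h1, map_sub, MvPolynomial.coeff_sub]
    have h6 : coeff J (X i : MvPowerSeries σ A) = (MvPolynomial.X i : MvPolynomial σ A).coeff J := by
      rw [← MvPolynomial.coe_X, MvPolynomial.coeff_coe]
    rw [h6, sub_sub_sub_cancel_left, ← neg_mem_iff, neg_sub]
    have := add_mem h3 h4
    rwa [sub_add_sub_cancel] at this

end Values

/-! ### Parameters of smooth local algebras with a section -/

section Parameters

variable {𝒪 B : Type*} [CommRing 𝒪] [CommRing B] [Algebra 𝒪 B] {n : ℕ}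
  {g : MvPolynomial (Fin n) 𝒪 →+* B} {c : B →+* 𝒪}

/-- Modulo `K` the identity of `B` and the retraction through `c` agree on the polynomial ring and
differ by a square-zero ideal. Formal unramifiedness forces them to coincide. -/
theorem ker_le_span_of_formallyUnramified (hgC : g.comp MvPolynomial.C = algebraMap 𝒪 B)
    (hg : g.FormallyEtale) (hc : c.comp (algebraMap 𝒪 B) = RingHom.id 𝒪) :
    RingHom.ker c ≤ Ideal.span (Set.range fun j =>
      g (MvPolynomial.X j) - algebraMap 𝒪 B (c (g (MvPolynomial.X j)))) ⊔ RingHom.ker c ^ 2 := by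
  set K := Ideal.span (Set.range fun j =>
      g (MvPolynomial.X j) - algebraMap 𝒪 B (c (g (MvPolynomial.X j)))) ⊔ RingHom.ker c ^ 2 with hK
  have hcc : ∀ r, c (algebraMap 𝒪 B r) = r := fun r => RingHom.congr_fun hc r
  let _ : Algebra (MvPolynomial (Fin n) 𝒪) B := g.toAlgebra
  have : Algebra.FormallyEtale (MvPolynomial (Fin n) 𝒪) B := hg
  let f₁ : B →ₐ[MvPolynomial (Fin n) 𝒪] B ⧸ K := Ideal.Quotient.mkₐ _ K
  let f₂ : B →ₐ[MvPolynomial (Fin n) 𝒪] B ⧸ K :=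
    { ((Ideal.Quotient.mk K).comp (algebraMap 𝒪 B)).comp c with
      commutes' := by
        have : (((Ideal.Quotient.mk K).comp (algebraMap 𝒪 B)).comp c).comp g =
            (Ideal.Quotient.mk K).comp g := by
          refine MvPolynomial.ringHom_ext (fun r => ?_) fun j => ?_
          · have : g (MvPolynomial.C r) = algebraMap 𝒪 B r := RingHom.congr_fun hgC r
            simp [this, hcc]
          · refine (Ideal.Quotient.eq.mpr ?_).symm
            exact Ideal.mem_sup_left (Ideal.subset_span ⟨j, rfl⟩)
        exact fun P => RingHom.congr_fun this P }
  have hsub : ∀ b, b - algebraMap 𝒪 B (c b) ∈ RingHom.ker c := fun b => by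
    rw [RingHom.mem_ker, map_sub, hcc, sub_self]
  have h : f₁ = f₂ := by
    refine Algebra.FormallyUnramified.ext ((RingHom.ker c).map (Ideal.Quotient.mk K)) ⟨2, ?_⟩
      fun b => ?_
    · rw [← Ideal.map_pow, Ideal.zero_eq_bot, Ideal.map_eq_bot_iff_le_ker, Ideal.mk_ker]
      exact le_sup_right
    · rw [Ideal.Quotient.eq]
      change Ideal.Quotient.mk K b - Ideal.Quotient.mk K (algebraMap 𝒪 B (c b)) ∈ _
      rw [← map_sub]
      exact Ideal.mem_map_of_mem _ (hsub b)
  intro b hb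
  have := AlgHom.congr_fun h b
  have h2 : b - algebraMap 𝒪 B (c b) ∈ K := Ideal.Quotient.eq.mp this
  rwa [RingHom.mem_ker.mp hb, map_zero, sub_zero] at h2

/-- The linear terms of the expansion along a section, in étale coordinates. -/
theorem exists_linearTerm (hgC : g.comp MvPolynomial.C = algebraMap 𝒪 B)
    (hg : g.FormallyEtale) (hc : c.comp (algebraMap 𝒪 B) = RingHom.id 𝒪) :
    ∃ l : B →+ (Fin n → 𝒪), (∀ a b, l (a * b) = c a • l b + c b • l a) ∧
      (∀ r, l (algebraMap 𝒪 B r) = 0) ∧ ∀ j, l (g (MvPolynomial.X j)) = Pi.single j 1 := by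
  have hcc : ∀ r, c (algebraMap 𝒪 B r) = r := fun r => RingHom.congr_fun hc r
  have hgC' : ∀ r, g (MvPolynomial.C r) = algebraMap 𝒪 B r := fun r => RingHom.congr_fun hgC r
  -- Move the `j`-th variable in the `j`-th infinitesimal direction. Formal smoothness extends this
  -- lift of `c` to `B`, and the infinitesimal part of the extension is `l`.
  let e : MvPolynomial (Fin n) 𝒪 →+* TrivSqZeroExt 𝒪 (Fin n → 𝒪) := MvPolynomial.eval₂Hom (TrivSqZeroExt.inlHom 𝒪 _)
    fun j => TrivSqZeroExt.inl (c (g (MvPolynomial.X j))) + TrivSqZeroExt.inr (Pi.single j 1)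
  let fst : TrivSqZeroExt 𝒪 (Fin n → 𝒪) →+* 𝒪 := (TrivSqZeroExt.fstHom 𝒪 𝒪 (Fin n → 𝒪)).toRingHom
  let _ : Algebra (MvPolynomial (Fin n) 𝒪) B := g.toAlgebra
  have : Algebra.FormallyEtale (MvPolynomial (Fin n) 𝒪) B := hg
  let _ : Algebra (MvPolynomial (Fin n) 𝒪) (TrivSqZeroExt 𝒪 (Fin n → 𝒪)) := e.toAlgebra
  let _ : Algebra (MvPolynomial (Fin n) 𝒪) 𝒪 := (c.comp g).toAlgebra
  have he : fst.comp e = c.comp g := by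
    refine MvPolynomial.ringHom_ext (fun r => ?_) fun j => ?_
    · simp [e, fst, hgC', hcc]
    · simp [e, fst]
  let c' : B →ₐ[MvPolynomial (Fin n) 𝒪] 𝒪 := { c with commutes' := fun P => rfl }
  let fst' : TrivSqZeroExt 𝒪 (Fin n → 𝒪) →ₐ[MvPolynomial (Fin n) 𝒪] 𝒪 :=
    { fst with commutes' := fun P => RingHom.congr_fun he P }
  have hf : Function.Surjective fst' := fun r => ⟨TrivSqZeroExt.inl r, rfl⟩
  have hnil : IsNilpotent (RingHom.ker (fst' : TrivSqZeroExt 𝒪 (Fin n → 𝒪) →+* 𝒪)) := by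
    have h : (RingHom.ker fst : Ideal (TrivSqZeroExt 𝒪 (Fin n → 𝒪))) ^ 2 = ⊥ := by
      rw [pow_two, eq_bot_iff, Ideal.mul_le]
      intro a ha b hb
      have ha' : a.fst = 0 := ha
      have hb' : b.fst = 0 := hb
      rw [Ideal.mem_bot]
      ext <;> simp [ha', hb']
    exact ⟨2, h⟩
  let ψ := Algebra.FormallySmooth.liftOfSurjective c' fst' hf hnil
  have hψ : ∀ b, (ψ b).fst = c b := fun b =>
    Algebra.FormallySmooth.liftOfSurjective_apply c' fst' hf hnil b
  have hψg : ∀ P, ψ (g P) = e P := fun P => ψ.commutes P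
  refine ⟨⟨⟨fun b => (ψ b).snd, by simp⟩, fun a b => by simp⟩, fun a b => ?_, fun r => ?_,
    fun j => ?_⟩
  · change (ψ (a * b)).snd = _
    rw [map_mul, TrivSqZeroExt.snd_mul, hψ, hψ, op_smul_eq_smul]
    rfl
  · change (ψ (algebraMap 𝒪 B r)).snd = _
    rw [← hgC', hψg]
    simp [e]
  · change (ψ (g (MvPolynomial.X j))).snd = _
    rw [hψg]
    simp [e]

variable [IsLocalRing 𝒪] [IsLocalRing B] {π : 𝒪} {s : Fin n → B}

/-- In a formally étale algebra over a polynomial ring, functions which generate the maximal ideal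
together with a parameter of the base are coordinates along any section. -/
theorem isGeneratedBy_of_span_eq_maximalIdeal (hπ : IsLocalRing.maximalIdeal 𝒪 = Ideal.span {π})
    (hπ0 : π ∈ nonZeroDivisors 𝒪)
    (hgC : g.comp MvPolynomial.C = algebraMap 𝒪 B)
    (hg : g.FormallyEtale) (hc : c.comp (algebraMap 𝒪 B) = RingHom.id 𝒪)
    (hs : Ideal.span (insert (algebraMap 𝒪 B π) (Set.range s)) = IsLocalRing.maximalIdeal B) :
    IsGeneratedBy (algebraMap 𝒪 B) c (fun i => s i - algebraMap 𝒪 B (c (s i))) ∧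
      ∀ r : Fin n → 𝒪, ∑ i, algebraMap 𝒪 B (r i) * (s i - algebraMap 𝒪 B (c (s i))) ∈
        RingHom.ker c ^ 2 → r = 0 := by
  have hcc : ∀ r, c (algebraMap 𝒪 B r) = r := fun r => RingHom.congr_fun hc r
  have : IsLocalHom c := IsLocalHom.of_surjective c fun r => ⟨_, hcc r⟩
  obtain ⟨l, lmul, lalg, lX⟩ := exists_linearTerm hgC hg hc
  set I := RingHom.ker c
  let d : Fin n → B := fun i => s i - algebraMap 𝒪 B (c (s i))
  let ξ : Fin n → B := fun j => g (MvPolynomial.X j) - algebraMap 𝒪 B (c (g (MvPolynomial.X j)))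
  have hsub : ∀ b, b - algebraMap 𝒪 B (c b) ∈ I := fun b => by
    rw [RingHom.mem_ker, map_sub, hcc, sub_self]
  have hI : I ≤ IsLocalRing.maximalIdeal B := by
    refine IsLocalRing.le_maximalIdeal fun h => ?_
    have h1 : (1 : B) ∈ I := h ▸ Submodule.mem_top
    rw [RingHom.mem_ker, map_one] at h1
    exact one_ne_zero h1
  -- The `d i` differ from the `s i` by constants in `π𝒪`, so with `π` they still generate the
  -- maximal ideal. Applying `c` shows that the cofactor `b` of `π` lies in `I`, as `π` is not a
  -- zero divisor.
  have hgen : ∀ a ∈ I, ∃ b ∈ I, ∃ β : Fin n → B, a = algebraMap 𝒪 B π * b + ∑ i, β i * d i := by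
    intro a ha
    have h1 : Ideal.span (insert (algebraMap 𝒪 B π) (Set.range s)) ≤
        Ideal.span (insert (algebraMap 𝒪 B π) (Set.range d)) := by
      have hπm := Ideal.subset_span (Set.mem_insert (algebraMap 𝒪 B π) (Set.range d))
      rw [Ideal.span_le, Set.insert_subset_iff, Set.range_subset_iff]
      refine ⟨hπm, fun i => ?_⟩
      have h2 : c (s i) ∈ IsLocalRing.maximalIdeal 𝒪 := by
        rw [← Ideal.mem_comap, IsLocalRing.maximalIdeal_comap, ← hs]
        exact Ideal.subset_span (Set.mem_insert_of_mem _ ⟨i, rfl⟩)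
      obtain ⟨v, hv⟩ := Ideal.mem_span_singleton'.mp (hπ ▸ h2)
      rw [← sub_add_cancel (s i) (algebraMap 𝒪 B (c (s i)))]
      refine Ideal.add_mem _ (Ideal.subset_span (Set.mem_insert_of_mem _ ⟨i, rfl⟩)) ?_
      rw [← hv, map_mul]
      exact Ideal.mul_mem_left _ _ hπm
    obtain ⟨b, z, hz, hab⟩ := Ideal.mem_span_insert.mp (h1 (hs ▸ hI ha))
    obtain ⟨β, rfl⟩ := Ideal.mem_span_range_iff_exists_fun.mp hz
    refine ⟨b, ?_, β, by rw [hab, mul_comm]⟩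
    have h3 := congrArg c hab
    have h4 : ∑ i, β i * d i ∈ I := sum_mem fun i _ => Ideal.mul_mem_left _ _ (hsub (s i))
    rw [RingHom.mem_ker.mp ha, map_add, RingHom.mem_ker.mp h4, add_zero, map_mul, hcc] at h3
    exact (mem_nonZeroDivisors_iff_right.mp hπ0) _ h3.symm
  have lI : ∀ a b, b ∈ I → l (a * b) = c a • l b := fun a b hb => by
    rw [lmul, RingHom.mem_ker.mp hb, zero_smul, add_zero]
  have lξ : ∀ j, l (ξ j) = Pi.single j 1 := fun j => by rw [map_sub, lX, lalg, sub_zero]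
  have lsq : ∀ a ∈ I ^ 2, l a = 0 := by
    intro a ha
    rw [pow_two] at ha
    refine Submodule.mul_induction_on ha (fun x hx y hy => ?_) fun x y hx hy => ?_
    · rw [lI _ _ hy, RingHom.mem_ker.mp hx, zero_smul]
    · rw [map_add, hx, hy, add_zero]
  have lsum : ∀ β x : Fin n → B, (∀ i, x i ∈ I) → l (∑ i, β i * x i) = ∑ i, c (β i) • l (x i) := by
    intro β x hx
    rw [map_sum]
    exact Finset.sum_congr rfl fun i _ => lI _ _ (hx i)
  let M : Matrix (Fin n) (Fin n) 𝒪 := Matrix.of fun i => l (d i)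
  have hM : IsUnit M.det := by
    choose b hb β hβ using fun j => hgen (ξ j) (hsub _)
    let V : Matrix (Fin n) (Fin n) 𝒪 := Matrix.of fun j => l (b j)
    let W : Matrix (Fin n) (Fin n) 𝒪 := Matrix.of fun j i => c (β j i)
    -- Apply `l` to the expressions of the `ξ j` by the `d i`. Modulo `π` the matrix `W` inverts
    -- `M`, and `𝒪` is local, so `M` is invertible.
    have e : (1 : Matrix (Fin n) (Fin n) 𝒪) = π • V + W * M := by
      ext j k
      have h1 := congrFun (congrArg l (hβ j)) k
      rw [lξ, map_add, lI _ _ (hb j), hcc, lsum _ _ fun i => hsub (s i)] at h1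
      rw [Matrix.one_apply, Matrix.add_apply, Matrix.smul_apply, Matrix.mul_apply]
      rw [Pi.single_apply] at h1
      simp only [Pi.add_apply, Pi.smul_apply, Finset.sum_apply] at h1
      simp only [eq_comm (a := j) (b := k)]
      exact h1
    have h2 := congrArg (fun A => ((IsLocalRing.residue 𝒪).mapMatrix A).det) e
    have h3 : IsLocalRing.residue 𝒪 π = 0 := (IsLocalRing.residue_eq_zero_iff π).mpr
      (hπ ▸ Ideal.mem_span_singleton_self π)
    have h4 : (IsLocalRing.residue 𝒪).mapMatrix (π • V) = 0 := by
      ext i j; simp [h3]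
    simp only [map_add, map_one, h4, zero_add, map_mul, Matrix.det_one, Matrix.det_mul] at h2
    have h5 : IsUnit ((IsLocalRing.residue 𝒪).mapMatrix M).det := IsUnit.of_mul_eq_one_right _ h2.symm
    rw [← RingHom.map_det] at h5
    exact isUnit_of_map_unit _ _ h5
  refine ⟨⟨hc, fun i => hsub (s i), ?_⟩, fun r hr => ?_⟩
  -- The étale coordinates `ξ j` generate `I` up to `I ^ 2`, so an element of `I` with zero linear
  -- term lies in `I ^ 2`. It remains to match linear terms by a combination of the `d i`.
  · have key : ∀ a ∈ I, l a = 0 → a ∈ I ^ 2 := by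
      intro a ha h0
      obtain ⟨x, hx, y, hy, rfl⟩ :=
        Submodule.mem_sup.mp (ker_le_span_of_formallyUnramified hgC hg hc ha)
      obtain ⟨β, rfl⟩ := Ideal.mem_span_range_iff_exists_fun.mp hx
      refine add_mem (sum_mem fun j _ => ?_) hy
      rw [map_add, lsq y hy, add_zero, lsum β ξ fun i => hsub _] at h0
      have h1 := congrFun h0 j
      simp [lξ, Finset.sum_apply, Pi.single_apply] at h1
      rw [pow_two]
      exact Ideal.mul_mem_mul h1 (hsub _)
    intro a ha
    let r : Fin n → 𝒪 := Matrix.vecMul (l a) M⁻¹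
    have h1 : a - ∑ i, algebraMap 𝒪 B (r i) * d i ∈ I :=
      sub_mem ha (sum_mem fun i _ => Ideal.mul_mem_left _ _ (hsub _))
    have h2 : l (a - ∑ i, algebraMap 𝒪 B (r i) * d i) = 0 := by
      rw [map_sub, lsum _ _ fun i => hsub _, sub_eq_zero]
      have h3 : Matrix.vecMul r M = l a := by
        rw [Matrix.vecMul_vecMul, Matrix.nonsing_inv_mul _ hM, Matrix.vecMul_one]
      rw [← h3]
      ext k
      simp [Matrix.vecMul, dotProduct, hcc, M, d]
    rw [← sub_add_cancel a (∑ i, algebraMap 𝒪 B (r i) * d i), add_comm]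
    exact Submodule.add_mem_sup
      (sum_mem fun i _ => Ideal.mul_mem_left _ _ (Ideal.subset_span ⟨i, rfl⟩)) (key _ h1 h2)
  · have h1 := lsq _ hr
    rw [lsum _ _ fun i => hsub (s i)] at h1
    have h2 : Matrix.vecMul r M = 0 := by
      rw [← h1]
      ext k
      simp [Matrix.vecMul, dotProduct, hcc, M, d]
    have h3 := congrArg (fun v => Matrix.vecMul v M⁻¹) h2
    simpa [Matrix.vecMul_vecMul, Matrix.mul_nonsing_inv _ hM] using h3

end Parameters

/-! ### Étale coordinates on local rings of smooth schemes -/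

section SmoothStalk

variable {𝒪 : Type u} [CommRing 𝒪] [IsLocalRing 𝒪] {X : Scheme.{u}}

/-- The local rings of a smooth scheme over a local ring are formally étale over a polynomial ring. -/
theorem exists_formallyEtale_mvPolynomial (f : X ⟶ Spec (.of 𝒪)) (n : ℕ)
    [SmoothOfRelativeDimension n f] (x : X) (hx : f x = IsLocalRing.closedPoint 𝒪) :
    ∃ g : MvPolynomial (Fin n) 𝒪 →+* X.presheaf.stalk x,
      g.comp MvPolynomial.C = scalarGerm f x ∧ g.FormallyEtale := by
  obtain ⟨U, hU, V, hV, hxV, e, hstd⟩ :=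
    SmoothOfRelativeDimension.exists_isStandardSmoothOfRelativeDimension (n := n) (f := f) x
  obtain rfl : U = ⊤ := IsLocalRing.closed_point_mem_iff.mp (hx ▸ e hxV)
  have h1 : ((f.appLE ⊤ V e).hom.comp (Scheme.ΓSpecIso (.of 𝒪)).inv.hom).IsStandardSmoothOfRelativeDimension
      (n + 0) := RingHom.IsStandardSmoothOfRelativeDimension.comp hstd
        (RingHom.IsStandardSmoothOfRelativeDimension.equiv
          (Scheme.ΓSpecIso (.of 𝒪)).symm.commRingCatIsoToRingEquiv)
  obtain ⟨g, hg, hget⟩ := h1.exists_etale_mvPolynomial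
  refine ⟨(X.presheaf.germ V x hxV).hom.comp g, ?_, ?_⟩
  · rw [RingHom.comp_assoc, hg, scalarGerm, ← CommRingCat.hom_comp, ← CommRingCat.hom_comp,
      Scheme.Hom.appLE, Category.assoc, Category.assoc, TopCat.Presheaf.germ_res]
    rfl
  · refine RingHom.FormallyEtale.comp ?_ ?_
    · algebraize [g]
      exact inferInstanceAs (Algebra.FormallyEtale (MvPolynomial (Fin n) 𝒪) Γ(X, V))
    · let _ := X.presheaf.algebra_section_stalk ⟨x, hxV⟩
      have := hV.isLocalization_stalk ⟨x, hxV⟩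
      exact RingHom.formallyEtale_algebraMap.mpr
        (Algebra.FormallyEtale.of_isLocalization (hV.primeIdealOf ⟨x, hxV⟩).asIdeal.primeCompl)

end SmoothStalk

/-! ### Evaluation of power series at multiples of `π` -/

section Evaluation

open MvPowerSeries IsLocalRing

variable {A : Type*} [CommRing A] [IsLocalRing A] {σ : Type*} [Finite σ] {π : A}

theorem isConvergent_of_forall_coeff_mem {f : MvPowerSeries σ A}
    (h : ∀ J : σ →₀ ℕ, coeff J f ∈ maximalIdeal A ^ J.degree) : IsConvergent f := fun N => by
  refine (Finsupp.finite_of_degree_le N).subset fun J hJ => ?_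
  by_contra hc
  exact hJ (Ideal.pow_le_pow_right (le_of_lt (not_le.mp hc)) (h J))

omit [IsLocalRing A] [Finite σ] in
theorem coeff_rescale_const (f : MvPowerSeries σ A) (J : σ →₀ ℕ) :
    coeff J (rescale (fun _ => π) f) = π ^ J.degree * coeff J f := by
  rw [coeff_rescale, Finsupp.prod, Finset.prod_pow_eq_pow_sum]
  rfl

theorem isConvergent_rescale (hπ : π ∈ maximalIdeal A) (f : MvPowerSeries σ A) :
    IsConvergent (rescale (fun _ => π) f) :=
  isConvergent_of_forall_coeff_mem fun J => by
    rw [coeff_rescale_const]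
    exact Ideal.mul_mem_right _ _ (Ideal.pow_mem_pow hπ _)

omit [IsLocalRing A] [Finite σ] in
theorem rescale_coe (a : σ → A) (p : MvPolynomial σ A) : rescale a (p : MvPowerSeries σ A) =
    (MvPolynomial.bind₁ (fun i => MvPolynomial.C (a i) * MvPolynomial.X i) p : MvPolynomial σ A) := by
  have : (rescale a).comp MvPolynomial.coeToMvPowerSeries.ringHom =
      MvPolynomial.coeToMvPowerSeries.ringHom.comp
        (MvPolynomial.bind₁ fun i => MvPolynomial.C (a i) * MvPolynomial.X i).toRingHom := by
    classical
    refine MvPolynomial.ringHom_ext (fun r => ?_) fun i => ?_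
    · ext J
      simp only [RingHom.comp_apply, MvPolynomial.coeToMvPowerSeries.ringHom_apply,
        MvPolynomial.coe_C, coeff_rescale, coeff_C, AlgHom.toRingHom_eq_coe, RingHom.coe_coe,
        MvPolynomial.bind₁_C_right]
      split_ifs with h <;> simp [h]
    · ext J
      simp only [RingHom.comp_apply, MvPolynomial.coeToMvPowerSeries.ringHom_apply,
        MvPolynomial.coe_C, MvPolynomial.coe_X, MvPolynomial.coe_mul, coeff_rescale, coeff_X,
        AlgHom.toRingHom_eq_coe, RingHom.coe_coe, MvPolynomial.bind₁_X_right, coeff_C_mul]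
      split_ifs with h <;> simp [h]
  exact RingHom.congr_fun this p

/-- The value of a power series at the point `π w`. -/
def evalScaled [IsAdicComplete (maximalIdeal A) A] (hπ : π ∈ maximalIdeal A) (w : σ → A) :
    MvPowerSeries σ A →+* A :=
  (valueHom w).comp ((rescale fun _ => π).codRestrict (convergentSubring A σ)
    (isConvergent_rescale hπ))

variable [IsAdicComplete (maximalIdeal A) A] {hπ : π ∈ maximalIdeal A} {w : σ → A}

theorem convergesTo_evalScaled (f : MvPowerSeries σ A) :
    ConvergesTo (rescale (fun _ => π) f) w (evalScaled hπ w f) :=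
  convergesTo_valueHom w ⟨_, isConvergent_rescale hπ f⟩

/-- Rescaling puts `π ^ d` in front of the terms of degree `d`, so those of degree at least `N`
vanish modulo `𝔪 ^ N`. -/
theorem evalScaled_sub_mem (f : MvPowerSeries σ A) (N : ℕ) :
    evalScaled hπ w f - MvPolynomial.eval (fun i => π * w i) (truncTotal N f) ∈
      maximalIdeal A ^ N := by
  have h1 : IsApprox N (rescale (fun _ => π) f)
      (MvPolynomial.bind₁ (fun i => MvPolynomial.C π * MvPolynomial.X i) (truncTotal N f)) := by
    rw [isApprox_iff]
    intro J
    rw [← MvPolynomial.coeff_coe, ← rescale_coe fun _ => π, ← map_sub, ← map_sub,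
      coeff_rescale_const]
    rcases lt_or_ge J.degree N with h | h
    · rw [sub_truncTotal_mem_ordIdeal N f J h, mul_zero]
      exact zero_mem _
    · exact Ideal.mul_mem_right _ _ (Ideal.pow_le_pow_right h (Ideal.pow_mem_pow hπ _))
  have h2 := (convergesTo_evalScaled (hπ := hπ) (w := w) f).sub_eval_mem h1
  convert h2 using 2
  rw [MvPolynomial.eval, MvPolynomial.eval, MvPolynomial.eval₂Hom_bind₁]
  simp

theorem evalScaled_C (r : A) : evalScaled hπ w (C r) = r :=
  (convergesTo_evalScaled _).unique (by
    have := rescale_coe (fun _ => π) (MvPolynomial.C r : MvPolynomial σ A)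
    rw [MvPolynomial.coe_C] at this
    rw [this]
    simpa using convergesTo_C r w)

theorem evalScaled_X (i : σ) : evalScaled hπ w (X i) = π * w i :=
  (convergesTo_evalScaled _).unique (by
    have := rescale_coe (fun _ => π) (MvPolynomial.X i : MvPolynomial σ A)
    rw [MvPolynomial.coe_X] at this
    rw [this]
    simpa using (convergesTo_C π w).mul (convergesTo_X i w))

theorem truncTotal_map {R S : Type*} [CommRing R] [CommRing S] (c : R →+* S) (N : ℕ)
    (f : MvPowerSeries σ R) :
    truncTotal N (MvPowerSeries.map c f) = MvPolynomial.map c (truncTotal N f) := by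
  ext J
  rw [MvPolynomial.coeff_map, coeff_truncTotal_eq_ite, coeff_truncTotal_eq_ite, coeff_map]
  split_ifs <;> simp

/-- A homomorphism is determined by its restriction to the base and the values at coordinates. -/
theorem IsExpansion.eq_evalScaled {R B : Type*} [CommRing R] [CommRing B] {ε : R →+* B}
    {I : Ideal B} {t : σ → B} {b : B} {f : MvPowerSeries σ R} (h : IsExpansion ε I t b f)
    {θ : B →+* A} (hI : ∀ a ∈ I, θ a ∈ maximalIdeal A) (ht : ∀ i, θ (t i) = π * w i) :
    θ b = evalScaled hπ w (MvPowerSeries.map (θ.comp ε) f) := by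
  refine eq_of_forall_sub_mem_pow fun N => ?_
  have h1 := h.map θ hI N
  have h2 := evalScaled_sub_mem (hπ := hπ) (w := w) (MvPowerSeries.map (θ.comp ε) f) N
  rw [truncTotal_map, MvPolynomial.eval_map, ← funext ht] at h2
  have := sub_mem h1 h2
  rwa [Function.comp_def, sub_sub_sub_cancel_right] at this

end Evaluation

/-! ### Residue disks as sets of homomorphisms -/

section ResidueDisk

open IsLocalRing

variable {𝒪 : Type u} [CommRing 𝒪] [IsLocalRing 𝒪] {X : Scheme.{u}} {f : X ⟶ Spec (.of 𝒪)}
  {x : Spec (.of (ResidueField 𝒪)) ⟶ X}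

theorem eq_homPt_stalkClosedPointTo {z : X} (p : Spec (.of 𝒪) ⟶ X) (h : p (closedPoint 𝒪) = z) :
    p = homPt z (X.presheaf.stalkSpecializes (specializes_of_eq h) ≫
      Scheme.stalkClosedPointTo p).hom := by
  subst h
  rw [TopCat.Presheaf.stalkSpecializes_refl, Category.id_comp]
  exact (Scheme.Spec_stalkClosedPointTo_fromSpecStalk p).symm

theorem ResidueDisk.pt_eq (g : ResidueDisk f x) : g.pt = homPt (center x) g.eval :=
  eq_homPt_stalkClosedPointTo g.pt g.pt_closedPoint

theorem ResidueDisk.ext_eval {g h : ResidueDisk f x} (e : g.eval = h.eval) : g = h := by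
  have := g.pt_eq.trans ((congrArg _ e).trans h.pt_eq.symm)
  cases g; cases h
  cases this
  rfl

theorem ResidueDisk.eval_comp_scalarGerm (g : ResidueDisk f x) :
    g.eval.comp (scalarGerm f (center x)) = RingHom.id 𝒪 := by
  have h := g.pt_comp
  rw [g.pt_eq, homPt_comp_toSpec] at h
  have h2 : Spec.map (CommRingCat.ofHom (g.eval.comp (scalarGerm f (center x)))) =
      Spec.map (CommRingCat.ofHom (RingHom.id 𝒪)) := h.trans (Spec.map_id _).symm
  exact congrArg CommRingCat.Hom.hom (Spec.map_injective h2)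

theorem ResidueDisk.eval_scalarGerm (g : ResidueDisk f x) (r : 𝒪) :
    g.eval (scalarGerm f (center x) r) = r :=
  RingHom.congr_fun g.eval_comp_scalarGerm r

instance ResidueDisk.isLocalHom_eval (g : ResidueDisk f x) : IsLocalHom g.eval :=
  IsLocalHom.of_surjective _ fun r => ⟨_, g.eval_scalarGerm r⟩

theorem ResidueDisk.homPt_residue_eval (g : ResidueDisk f x) :
    homPt (center x) ((residue 𝒪).comp g.eval) = x := by
  rw [← SpecMap_homPt, ← g.pt_eq]
  exact g.red

theorem exists_homPt_center (x : Spec (.of (ResidueField 𝒪)) ⟶ X) :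
    ∃ φ : X.presheaf.stalk (center x) →+* ResidueField 𝒪, IsLocalHom φ ∧ x = homPt (center x) φ :=
  exists_homPt x rfl

theorem apply_center (hx : x ≫ f = closedPt 𝒪) : f (center x) = closedPoint 𝒪 := by
  have h : (x ≫ f) (closedPoint (ResidueField 𝒪)) = closedPt 𝒪 (closedPoint (ResidueField 𝒪)) := by
    rw [hx]
  exact h.trans (comap_closedPoint (residue 𝒪))

theorem comp_scalarGerm_of_eq_homPt (hx : x ≫ f = closedPt 𝒪)
    {φ : X.presheaf.stalk (center x) →+* ResidueField 𝒪} (hφ : x = homPt (center x) φ) :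
    φ.comp (scalarGerm f (center x)) = residue 𝒪 := by
  have h : homPt (center x) φ ≫ f = closedPt 𝒪 := by rw [← hφ, hx]
  rw [homPt_comp_toSpec] at h
  exact congrArg CommRingCat.Hom.hom (Spec.map_injective h)

/-- Sections of the structure map of the local ring at the center are points of the disk. -/
def ResidueDisk.ofHom (hx : x ≫ f = closedPt 𝒪) (c : X.presheaf.stalk (center x) →+* 𝒪)
    (hc : c.comp (scalarGerm f (center x)) = RingHom.id 𝒪) : ResidueDisk f x where
  pt := homPt (center x) c
  pt_comp := by
    rw [homPt_comp_toSpec, hc]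
    exact Spec.map_id _
  red := by
    obtain ⟨φ, hφ, hxφ⟩ := exists_homPt_center x
    have hcc : ∀ r, c (scalarGerm f (center x) r) = r := RingHom.congr_fun hc
    have : IsLocalHom c := IsLocalHom.of_surjective _ fun r => ⟨_, hcc r⟩
    refine (SpecMap_homPt _ _).trans (Eq.trans (congrArg _ ?_) hxφ.symm)
    have h1 := comp_scalarGerm_of_eq_homPt hx hxφ
    ext b
    -- Since `c` is local, `b` differs from the constant `c b` by an element of the maximal ideal,
    -- which `φ` kills. So `φ` is the reduction of `c`.
    have h2 : b - scalarGerm f (center x) (c b) ∈ maximalIdeal (X.presheaf.stalk (center x)) := by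
      rw [← maximalIdeal_comap c, Ideal.mem_comap, map_sub, hcc, sub_self]
      exact zero_mem _
    have h3 : φ (b - scalarGerm f (center x) (c b)) = 0 := by
      have := (maximalIdeal_comap φ).symm ▸ h2
      rw [Ideal.mem_comap, maximalIdeal_eq_bot] at this
      exact this
    rw [map_sub, sub_eq_zero, ← RingHom.comp_apply φ, h1] at h3
    exact h3.symm

theorem ResidueDisk.eval_ofHom (hx : x ≫ f = closedPt 𝒪)
    (c : X.presheaf.stalk (center x) →+* 𝒪)
    (hc : c.comp (scalarGerm f (center x)) = RingHom.id 𝒪) :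
    (ResidueDisk.ofHom hx c hc).eval = c :=
  homPt_injective (ResidueDisk.pt_eq (ResidueDisk.ofHom hx c hc)).symm

theorem ResidueDisk.mul_coords {π : 𝒪} {κ : Type*} {s : κ → X.presheaf.stalk (center x)}
    (hπ : maximalIdeal 𝒪 = Ideal.span {π})
    (hs : ∀ i, s i ∈ maximalIdeal (X.presheaf.stalk (center x))) (g : ResidueDisk f x) (i : κ) :
    π * g.coords π s i = g.eval (s i) := by
  have h1 : g.eval (s i) ∈ maximalIdeal 𝒪 := by
    rw [← Ideal.mem_comap, maximalIdeal_comap]; exact hs i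
  rw [hπ, Ideal.mem_span_singleton'] at h1
  obtain ⟨b, hb⟩ := h1
  exact Function.invFun_eq (f := fun b : 𝒪 => π * b) ⟨b, by rw [mul_comm, hb]⟩

end ResidueDisk

/-! ### The coordinates on the residue disk of a smooth scheme -/

section SmoothDisk

open IsLocalRing

variable {𝒪 : Type u} [CommRing 𝒪] [IsDomain 𝒪] [IsDiscreteValuationRing 𝒪]
  [IsAdicComplete (maximalIdeal 𝒪) 𝒪] {Y : Scheme.{u}} {f : Y ⟶ Spec (.of 𝒪)}
  {y : Spec (.of (ResidueField 𝒪)) ⟶ Y} {π : 𝒪} {n : ℕ} [SmoothOfRelativeDimension n f]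
  {s : Fin n → Y.presheaf.stalk (center y)}

omit [IsDomain 𝒪] [IsDiscreteValuationRing 𝒪] [IsAdicComplete (maximalIdeal 𝒪) 𝒪] in
theorem formallySmooth_scalarGerm [IsLocalRing 𝒪] (n : ℕ) {X : Scheme.{u}} (f : X ⟶ Spec (.of 𝒪))
    [SmoothOfRelativeDimension n f] (x : X) (hx : f x = closedPoint 𝒪) :
    (scalarGerm f x).FormallySmooth := by
  obtain ⟨g, hgC, hg⟩ := exists_formallyEtale_mvPolynomial f n x hx
  let _ : Algebra 𝒪 (X.presheaf.stalk x) := (scalarGerm f x).toAlgebra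
  let _ : Algebra (MvPolynomial (Fin n) 𝒪) (X.presheaf.stalk x) := g.toAlgebra
  have : Algebra.FormallyEtale (MvPolynomial (Fin n) 𝒪) (X.presheaf.stalk x) := hg
  have : IsScalarTower 𝒪 (MvPolynomial (Fin n) 𝒪) (X.presheaf.stalk x) :=
    IsScalarTower.of_algebraMap_eq' hgC.symm
  exact Algebra.FormallySmooth.comp 𝒪 (MvPolynomial (Fin n) 𝒪) _

-- Hensel's lemma: formal smoothness lifts the given residue point to the complete ring `𝒪`.
variable (n) in
include n in
theorem nonempty_residueDisk (hy : y ≫ f = closedPt 𝒪) : Nonempty (ResidueDisk f y) := by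
  let _ : Algebra 𝒪 (Y.presheaf.stalk (center y)) := (scalarGerm f (center y)).toAlgebra
  have : Algebra.FormallySmooth 𝒪 (Y.presheaf.stalk (center y)) :=
    formallySmooth_scalarGerm n f (center y) (apply_center hy)
  obtain ⟨φ, hφ, hyφ⟩ := exists_homPt_center y
  have h1 := comp_scalarGerm_of_eq_homPt hy hyφ
  let φ' : Y.presheaf.stalk (center y) →ₐ[𝒪] 𝒪 ⧸ maximalIdeal 𝒪 :=
    { φ with commutes' := fun r => RingHom.congr_fun h1 r }
  obtain ⟨c, -⟩ := Algebra.FormallySmooth.exists_mkₐ_comp_eq_of_isAdicComplete φ'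
  exact ⟨ResidueDisk.ofHom hy c.toRingHom (RingHom.ext c.commutes)⟩

omit [IsDomain 𝒪] [IsDiscreteValuationRing 𝒪] [IsAdicComplete (maximalIdeal 𝒪) 𝒪] in
theorem IsParameterSystem.mem [IsLocalRing 𝒪] {κ : Type*} {X : Scheme.{u}} {f : X ⟶ Spec (.of 𝒪)} {x : X}
    {s : κ → X.presheaf.stalk x} (hs : IsParameterSystem f π x s) (i : κ) :
    s i ∈ maximalIdeal (X.presheaf.stalk x) := by
  rw [← hs]
  exact Ideal.subset_span (Set.mem_insert_of_mem _ ⟨i, rfl⟩)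

variable (hπ : Irreducible π) (hy : y ≫ f = closedPt 𝒪) (hs : IsParameterSystem f π (center y) s)
include hπ hy hs

omit [IsAdicComplete (maximalIdeal 𝒪) 𝒪] in
/-- The expansion of germs at the center of the disk, around a point of the disk. -/
theorem exists_isExpansionHom_eval (c : ResidueDisk f y) :
    IsGeneratedBy (scalarGerm f (center y)) c.eval
        (fun i => s i - scalarGerm f (center y) (c.eval (s i))) ∧
      ∃ φ, IsExpansionHom (scalarGerm f (center y)) c.eval
        (fun i => s i - scalarGerm f (center y) (c.eval (s i))) φ := by
  obtain ⟨g, hgC, hg⟩ := exists_formallyEtale_mvPolynomial f n (center y) (apply_center hy)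
  let _ : Algebra 𝒪 (Y.presheaf.stalk (center y)) := (scalarGerm f (center y)).toAlgebra
  obtain ⟨h1, h2⟩ := isGeneratedBy_of_span_eq_maximalIdeal (hπ.maximalIdeal_eq)
    (mem_nonZeroDivisors_of_ne_zero hπ.ne_zero) hgC hg c.eval_comp_scalarGerm hs
  have : Algebra.FormallySmooth 𝒪 (Y.presheaf.stalk (center y)) :=
    formallySmooth_scalarGerm n f (center y) (apply_center hy)
  exact ⟨h1, h1.exists_isExpansionHom h2⟩

/-- There is a point of the disk on which the parameters take given values. -/
theorem exists_eval_eq (a : Fin n → 𝒪) : ∃ c : ResidueDisk f y, ∀ i, c.eval (s i) = π * a i := by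
  obtain ⟨c₀⟩ := nonempty_residueDisk n hy
  obtain ⟨-, φ, hφ⟩ := exists_isExpansionHom_eval hπ hy hs c₀
  have hπm : π ∈ maximalIdeal 𝒪 := hπ.maximalIdeal_eq ▸ Ideal.mem_span_singleton_self π
  have h1 := c₀.mul_coords hπ.maximalIdeal_eq hs.mem
  -- The expansion is around `c₀`, and `π w` is the displacement from `c₀` to the wanted point.
  let w : Fin n → 𝒪 := fun i => a i - c₀.coords π s i
  have hc : ((evalScaled hπm w).comp φ).comp (scalarGerm f (center y)) = RingHom.id 𝒪 := by
    rw [RingHom.comp_assoc, hφ.comp_eq]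
    ext1 r
    exact evalScaled_C (hπ := hπm) r
  refine ⟨ResidueDisk.ofHom hy _ hc, fun i => ?_⟩
  rw [ResidueDisk.eval_ofHom]
  have h2 := hφ.apply_eq i
  rw [map_sub, ← RingHom.comp_apply φ, hφ.comp_eq, sub_eq_iff_eq_add] at h2
  rw [RingHom.comp_apply, h2, map_add, evalScaled_C, evalScaled_X, ← h1]
  simp only [w]
  ring

/-- Expand germs around `c`. A point with the same parameters has displacement zero from `c`, so it
gives every germ the same value. -/
theorem eval_eq_of_eval_eq {c c' : ResidueDisk f y} (h : ∀ i, c.eval (s i) = c'.eval (s i)) :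
    c = c' := by
  apply ResidueDisk.ext_eval
  obtain ⟨hg, φ, hφ⟩ := exists_isExpansionHom_eval hπ hy hs c
  have hπm : π ∈ maximalIdeal 𝒪 := hπ.maximalIdeal_eq ▸ Ideal.mem_span_singleton_self π
  ext b
  have hker : ∀ a ∈ RingHom.ker c.eval, ∀ c' : ResidueDisk f y, c'.eval a ∈ maximalIdeal 𝒪 := by
    intro a ha c'
    rw [← Ideal.mem_comap, maximalIdeal_comap, ← maximalIdeal_comap c.eval, Ideal.mem_comap,
      RingHom.mem_ker.mp ha]
    exact zero_mem _
  have key : ∀ c' : ResidueDisk f y, (∀ i, c.eval (s i) = c'.eval (s i)) →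
      c'.eval b = evalScaled hπm 0 (MvPowerSeries.map (c'.eval.comp (scalarGerm f (center y))) (φ b)) := by
    intro c' h
    refine (hφ.isExpansion hg b).eq_evalScaled (fun a ha => hker a ha c') fun i => ?_
    rw [map_sub, c'.eval_scalarGerm, h, sub_self, Pi.zero_apply, mul_zero]
  rw [key c fun _ => rfl, key c' h, c.eval_comp_scalarGerm, c'.eval_comp_scalarGerm]

theorem bijective_coords : Function.Bijective (ResidueDisk.coords (f := f) (x := y) π s) := by
  have h1 := fun c : ResidueDisk f y => c.mul_coords hπ.maximalIdeal_eq hs.mem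
  refine ⟨fun c c' h => eval_eq_of_eval_eq hπ hy hs fun i => ?_, fun a => ?_⟩
  · rw [← h1, ← h1, h]
  · obtain ⟨c, hc⟩ := exists_eval_eq hπ hy hs a
    refine ⟨c, funext fun i => mul_left_cancel₀ hπ.ne_zero ?_⟩
    rw [h1, hc]

end SmoothDisk

/-! ### The residue disk along the identity section -/

section GroupDisk

open IsLocalRing

section Local

variable {𝒪 : Type u} [CommRing 𝒪] [IsLocalRing 𝒪] {Y G : Scheme.{u}} {q : G ⟶ Y}
  [GrpObj (Over.mk q)] {f : Y ⟶ Spec (.of 𝒪)} {y : Spec (.of (ResidueField 𝒪)) ⟶ Y}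

/-- The value at `g` of germs at the origin. -/
def GroupDisk.evalHom (g : GroupDisk q f y) : G.presheaf.stalk (idSection q (center y)) →+* 𝒪 :=
  (G.presheaf.stalkSpecializes (specializes_of_eq
    (show g.pt (closedPoint 𝒪) = idSection q (center y) from g.pt_closedPoint)) ≫
    Scheme.stalkClosedPointTo g.pt).hom

theorem GroupDisk.pt_eq (g : GroupDisk q f y) : g.pt = homPt (idSection q (center y)) g.evalHom :=
  ResidueDisk.pt_eq g

theorem GroupDisk.eval_proj (g : GroupDisk q f y) :
    g.proj.eval = g.evalHom.comp (structHom q (center y)) := by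
  apply homPt_injective
  rw [← ResidueDisk.pt_eq, ← homPt_comp, ← g.pt_eq]
  rfl

theorem GroupDisk.evalHom_mem (g : GroupDisk q f y) {a : G.presheaf.stalk (idSection q (center y))}
    (ha : a ∈ augIdeal q (center y)) : g.evalHom a ∈ maximalIdeal 𝒪 := by
  obtain ⟨φ, -, hφ⟩ := exists_homPt_center y
  have h1 : (residue 𝒪).comp g.evalHom = φ.comp (augHom q (center y)) := by
    apply homPt_injective
    refine (ResidueDisk.homPt_residue_eval g).trans ?_
    rw [← homPt_comp, ← hφ]
  rw [← residue_eq_zero_iff, ← RingHom.comp_apply, h1, RingHom.comp_apply,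
    show augHom q (center y) a = 0 from ha, map_zero]

/-- The point of the disk with given values of germs. -/
def GroupDisk.ofHom (c : ResidueDisk f y) (θ : G.presheaf.stalk (idSection q (center y)) →+* 𝒪)
    (hθ : θ.comp (structHom q (center y)) = c.eval)
    (hI : ∀ a ∈ augIdeal q (center y), θ a ∈ maximalIdeal 𝒪) : GroupDisk q f y where
  pt := homPt _ θ
  pt_comp := by
    rw [← Category.assoc, homPt_structure_comp θ hθ, ← ResidueDisk.pt_eq, c.pt_comp]
  red := by
    have h := comp_eq_of_augIdeal_le hθ hI
    refine (SpecMap_homPt _ _).trans ((congrArg (homPt _) h).trans ?_)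
    rw [← homPt_comp]
    congr 1
    exact c.homPt_residue_eval

theorem GroupDisk.evalHom_ofHom (c : ResidueDisk f y)
    (θ : G.presheaf.stalk (idSection q (center y)) →+* 𝒪)
    (hθ : θ.comp (structHom q (center y)) = c.eval)
    (hI : ∀ a ∈ augIdeal q (center y), θ a ∈ maximalIdeal 𝒪) :
    (GroupDisk.ofHom c θ hθ hI).evalHom = θ :=
  homPt_injective (GroupDisk.pt_eq (GroupDisk.ofHom c θ hθ hI)).symm

theorem GroupDisk.proj_ofHom (c : ResidueDisk f y)
    (θ : G.presheaf.stalk (idSection q (center y)) →+* 𝒪)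
    (hθ : θ.comp (structHom q (center y)) = c.eval)
    (hI : ∀ a ∈ augIdeal q (center y), θ a ∈ maximalIdeal 𝒪) :
    (GroupDisk.ofHom c θ hθ hI).proj = c :=
  ResidueDisk.ext_eval (by rw [GroupDisk.eval_proj, GroupDisk.evalHom_ofHom, hθ])

/-- The last coordinates of a point of the disk. -/
def GroupDisk.fibreCoords (π : 𝒪) {m : ℕ} (t : Fin m → G.presheaf.stalk (idSection q (center y)))
    (g : GroupDisk q f y) : Fin m → 𝒪 := ResidueDisk.coords (x := y ≫ idSection q) π t g

theorem GroupDisk.chart_eq {π : 𝒪} {n m : ℕ} (s : Fin n → Y.presheaf.stalk (center y))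
    (t : Fin m → G.presheaf.stalk (idSection q (center y))) (g : GroupDisk q f y) :
    g.chart π s t = Sum.elim (g.proj.coords π s) (g.fibreCoords π t) := rfl

theorem GroupDisk.mul_fibreCoords {π : 𝒪} {m : ℕ}
    {t : Fin m → G.presheaf.stalk (idSection q (center y))}
    (hπ : maximalIdeal 𝒪 = Ideal.span {π}) (ht : ∀ i, t i ∈ augIdeal q (center y))
    (g : GroupDisk q f y) (i : Fin m) : π * g.fibreCoords π t i = g.evalHom (t i) := by
  have h1 := g.evalHom_mem (ht i)
  rw [hπ, Ideal.mem_span_singleton'] at h1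
  obtain ⟨b, hb⟩ := h1
  exact Function.invFun_eq (f := fun b : 𝒪 => π * b) ⟨b, by rw [mul_comm, hb]; rfl⟩

/-- A point of the disk as a point of the group of sections over its image in the base. -/
def GroupDisk.toHom {c : ResidueDisk f y} (g : GroupDisk q f y) (h : g.proj = c) :
    Over.mk c.pt ⟶ Over.mk q := Over.homMk g.pt (congrArg ResidueDisk.pt h)

variable (q) in
/-- Reduction of sections over a point of the disk of the base. -/
def reductionHom (c : ResidueDisk f y) :
    (Over.mk c.pt ⟶ Over.mk q) →* (Over.mk (closedPt 𝒪 ≫ c.pt) ⟶ Over.mk q) where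
  toFun h := (Over.homMk (closedPt 𝒪) rfl : Over.mk (closedPt 𝒪 ≫ c.pt) ⟶ Over.mk c.pt) ≫ h
  map_one' := by rw [Hom.one_def, Hom.one_def, ← Category.assoc]; congr 1
  map_mul' a b := by rw [Hom.mul_def, Hom.mul_def, ← Category.assoc, comp_lift]

theorem mem_ker_reductionHom {c : ResidueDisk f y} {h : Over.mk c.pt ⟶ Over.mk q} :
    h ∈ (reductionHom q c).ker ↔ closedPt 𝒪 ≫ h.left = y ≫ idSection q := by
  have h1 : (1 : Over.mk (closedPt 𝒪 ≫ c.pt) ⟶ Over.mk q).left = y ≫ idSection q := by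
    rw [Hom.one_def, Over.comp_left]
    exact congrArg (fun k => k ≫ idSection q) c.red
  rw [MonoidHom.mem_ker, ← h1]
  exact ⟨fun h => congrArg (fun k => k.left) h, fun h => by ext1; exact h⟩

theorem GroupDisk.toHom_mem {c : ResidueDisk f y} (g : GroupDisk q f y) (h : g.proj = c) :
    g.toHom h ∈ (reductionHom q c).ker :=
  mem_ker_reductionHom.mpr g.red

/-- Sections with trivial reduction are points of the disk. -/
theorem exists_toHom_eq {c : ResidueDisk f y} {h : Over.mk c.pt ⟶ Over.mk q}
    (hh : h ∈ (reductionHom q c).ker) : ∃ g : GroupDisk q f y, ∃ e : g.proj = c, g.toHom e = h := by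
  have hw : h.left ≫ q = c.pt := Over.w h
  refine ⟨⟨h.left, ?_, mem_ker_reductionHom.mp hh⟩, ?_, rfl⟩
  · rw [← Category.assoc, hw, c.pt_comp]
  · cases c
    simp only [GroupDisk.proj, ResidueDisk.map]
    congr 1

/-- Multiples stay in the disk, since the sections reducing to the identity form the kernel of a
group homomorphism. -/
theorem GroupDisk.exists_zmul_eq (g : GroupDisk q f y) (a : ℤ) :
    ∃ g' : GroupDisk q f y, ∃ e : g'.proj = g.proj, g'.pt = g.zmul a ∧
      g'.toHom e = g.toHom rfl ^ a := by
  obtain ⟨g', e, h⟩ := exists_toHom_eq (zpow_mem (g.toHom_mem rfl) a)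
  exact ⟨g', e, congrArg (fun k => k.left) h, h⟩

end Local

variable {𝒪 : Type u} [CommRing 𝒪] [IsDomain 𝒪] [IsDiscreteValuationRing 𝒪]
  [IsAdicComplete (maximalIdeal 𝒪) 𝒪] {Y G : Scheme.{u}} {q : G ⟶ Y}
  [GrpObj (Over.mk q)] {f : Y ⟶ Spec (.of 𝒪)} {y : Spec (.of (ResidueField 𝒪)) ⟶ Y} {π : 𝒪}
  {n m : ℕ} {s : Fin n → Y.presheaf.stalk (center y)}
  {t : Fin m → G.presheaf.stalk (idSection q (center y))}

theorem IsFormalCoordinates.mem {κ : Type*} {y : Y} {t : κ → G.presheaf.stalk (idSection q y)}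
    (ht : IsFormalCoordinates q y t) (i : κ) : t i ∈ augIdeal q y := ht.1 i

variable (hπ : Irreducible π) (ht : IsFormalCoordinates q (center y) t)
include hπ ht

theorem GroupDisk.evalHom_eq_evalScaled (hπm : π ∈ maximalIdeal 𝒪)
    {a : G.presheaf.stalk (idSection q (center y))} {F : MvPowerSeries (Fin m) (Y.presheaf.stalk (center y))}
    (h : IsExpansion (structHom q (center y)) (augIdeal q (center y)) t a F) (g : GroupDisk q f y) :
    g.evalHom a = evalScaled hπm (g.fibreCoords π t) (MvPowerSeries.map g.proj.eval F) := by
  rw [g.eval_proj]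
  exact h.eq_evalScaled (fun a ha => g.evalHom_mem ha) fun i =>
    (g.mul_fibreCoords hπ.maximalIdeal_eq ht.mem i).symm

/-- Both points evaluate the same expansion along the identity section, with coefficients at the
same point of the base. Congruent coordinates therefore give congruent values on all germs. -/
theorem GroupDisk.evalHom_sub_mem [Smooth q] {g h : GroupDisk q f y} (e : g.proj = h.proj) {N : ℕ}
    (hx : ∀ i, g.fibreCoords π t i - h.fibreCoords π t i ∈ maximalIdeal 𝒪 ^ N)
    (a : G.presheaf.stalk (idSection q (center y))) :
    g.evalHom a - h.evalHom a ∈ maximalIdeal 𝒪 ^ N := by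
  have hπm : π ∈ maximalIdeal 𝒪 := hπ.maximalIdeal_eq ▸ Ideal.mem_span_singleton_self π
  obtain ⟨φ, hφ⟩ := ht.exists_isExpansionHom
  have ha := hφ.isExpansion ht.isGeneratedBy a
  rw [g.evalHom_eq_evalScaled hπ ht hπm ha, h.evalHom_eq_evalScaled hπ ht hπm ha, e]
  exact (convergesTo_evalScaled _).sub_mem (convergesTo_evalScaled _) hx

theorem GroupDisk.eq_of_fibreCoords_eq [Smooth q] {g h : GroupDisk q f y} (e : g.proj = h.proj)
    (hx : g.fibreCoords π t = h.fibreCoords π t) : g = h := by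
  refine ResidueDisk.ext_eval (RingHom.ext fun a => eq_of_forall_sub_mem_pow fun N => ?_)
  refine GroupDisk.evalHom_sub_mem hπ ht e (fun i => ?_) a
  rw [hx, sub_self]
  exact zero_mem _

theorem GroupDisk.exists_fibreCoords_eq [Smooth q] (c : ResidueDisk f y) (x : Fin m → 𝒪) :
    ∃ g : GroupDisk q f y, g.proj = c ∧ g.fibreCoords π t = x := by
  have hπm : π ∈ maximalIdeal 𝒪 := hπ.maximalIdeal_eq ▸ Ideal.mem_span_singleton_self π
  obtain ⟨φ, hφ⟩ := ht.exists_isExpansionHom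
  let θ := ((evalScaled hπm x).comp (MvPowerSeries.map c.eval)).comp φ
  have hθ : θ.comp (structHom q (center y)) = c.eval := by
    rw [RingHom.comp_assoc, hφ.comp_eq]
    ext1 r
    rw [RingHom.comp_apply, RingHom.comp_apply, MvPowerSeries.map_C, evalScaled_C]
  have hθt : ∀ i, θ (t i) = π * x i := fun i => by
    simp only [θ, RingHom.comp_apply]
    rw [hφ.apply_eq, MvPowerSeries.map_X, evalScaled_X]
  have hI : ∀ a ∈ augIdeal q (center y), θ a ∈ maximalIdeal 𝒪 := by
    intro a ha
    have h0 : MvPowerSeries.constantCoeff (φ a) = 0 :=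
      (RingHom.congr_fun hφ.constantCoeff_comp a).trans ha
    have h1 := evalScaled_sub_mem (hπ := hπm) (w := x) (MvPowerSeries.map c.eval (φ a)) 1
    have h2 : MvPowerSeries.truncTotal 1 (MvPowerSeries.map c.eval (φ a)) = 0 := by
      have := truncTotal_eq_of_sub_mem (N := 1) (f := MvPowerSeries.map c.eval (φ a)) (g := 0)
        (by rw [sub_zero, mem_ordIdeal_one]; simpa using congrArg c.eval h0)
      rw [this, map_zero]
    rwa [h2, map_zero, sub_zero, pow_one] at h1
  refine ⟨GroupDisk.ofHom c θ hθ hI, GroupDisk.proj_ofHom c θ hθ hI, funext fun i =>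
    mul_left_cancel₀ hπ.ne_zero ?_⟩
  rw [GroupDisk.mul_fibreCoords hπ.maximalIdeal_eq ht.mem, GroupDisk.evalHom_ofHom, hθt]

theorem GroupDisk.bijective_chart [Smooth q] [SmoothOfRelativeDimension n f]
    (hy : y ≫ f = closedPt 𝒪) (hs : IsParameterSystem f π (center y) s) :
    Function.Bijective (GroupDisk.chart (q := q) (f := f) (y := y) π s t) := by
  have hb := bijective_coords hπ hy hs
  refine ⟨fun g h e => ?_, fun w => ?_⟩
  · rw [GroupDisk.chart_eq, GroupDisk.chart_eq] at e
    have h1 := congrArg (fun k => k ∘ Sum.inl) e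
    have h2 := congrArg (fun k => k ∘ Sum.inr) e
    simp only [Sum.elim_comp_inl, Sum.elim_comp_inr] at h1 h2
    exact GroupDisk.eq_of_fibreCoords_eq hπ ht (hb.1 h1) h2
  · obtain ⟨c, hc⟩ := hb.2 (w ∘ Sum.inl)
    obtain ⟨g, hg, hx⟩ := GroupDisk.exists_fibreCoords_eq hπ ht c (w ∘ Sum.inr)
    exact ⟨g, by rw [GroupDisk.chart_eq, hg, hx, hc, Sum.elim_comp_inl_inr]⟩

/-- The coordinates of a product of points of the disk. -/
theorem GroupDisk.mul_fibreCoords_mul (hπm : π ∈ maximalIdeal 𝒪)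
    {F : Fin m → MvPowerSeries (Fin m ⊕ Fin m) (Y.presheaf.stalk (center y))}
    (hF : IsFormalGroupLawOf q (center y) t F) {c : ResidueDisk f y} {g₁ g₂ g : GroupDisk q f y}
    (e₁ : g₁.proj = c) (e₂ : g₂.proj = c) (e : g.proj = c)
    (h : g₁.toHom e₁ * g₂.toHom e₂ = g.toHom e) (i : Fin m) :
    π * g.fibreCoords π t i = evalScaled hπm
      (Sum.elim (g₁.fibreCoords π t) (g₂.fibreCoords π t)) (MvPowerSeries.map c.eval (F i)) := by
  -- `exists_mul` speaks of sections over `homPt`; generalising the base allows the equality with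
  -- `c.pt` to be eliminated.
  have key : ∀ {p : Spec (.of 𝒪) ⟶ Y} (_ : p = homPt (center y) c.eval)
      (k₁ k₂ k : Over.mk p ⟶ Over.mk q), k₁.left = g₁.pt → k₂.left = g₂.pt → k.left = g.pt →
      k₁ * k₂ = k → ∀ N, g.evalHom (t i) - MvPolynomial.eval₂ c.eval
        (Sum.elim (g₁.evalHom ∘ t) (g₂.evalHom ∘ t)) (MvPowerSeries.truncTotal N (F i)) ∈
          maximalIdeal 𝒪 ^ N := by
    rintro _ rfl k₁ k₂ k hk₁ hk₂ hk hm N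
    obtain ⟨θ, -, -, hθ, hθm⟩ := hF.exists_mul (c := c.eval) (Ideal.IsPrime.ne_top inferInstance)
      (e₁ ▸ g₁.eval_proj.symm) (e₂ ▸ g₂.eval_proj.symm) (fun a ha => g₁.evalHom_mem ha)
      (fun a ha => g₂.evalHom_mem ha)
    have h1 := hθm k₁ k₂ (hk₁.trans g₁.pt_eq) (hk₂.trans g₂.pt_eq)
    rw [hm, hk, g.pt_eq] at h1
    rw [homPt_injective h1]
    exact hθ i N
  rw [g.mul_fibreCoords hπ.maximalIdeal_eq ht.mem]
  refine eq_of_forall_sub_mem_pow fun N => ?_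
  have h1 := key c.pt_eq _ _ _ rfl rfl rfl h N
  have h2 := evalScaled_sub_mem (hπ := hπm)
    (w := Sum.elim (g₁.fibreCoords π t) (g₂.fibreCoords π t)) (MvPowerSeries.map c.eval (F i)) N
  have h3 : (fun i => π * Sum.elim (g₁.fibreCoords π t) (g₂.fibreCoords π t) i) =
      Sum.elim (g₁.evalHom ∘ t) (g₂.evalHom ∘ t) := by
    ext (j | j)
    · exact g₁.mul_fibreCoords hπ.maximalIdeal_eq ht.mem j
    · exact g₂.mul_fibreCoords hπ.maximalIdeal_eq ht.mem j
  rw [truncTotal_map, MvPolynomial.eval_map, h3] at h2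
  have := sub_mem h1 h2
  rwa [sub_sub_sub_cancel_right] at this

end GroupDisk

/-! ### Finite extensions of the ring of `p`-adic integers -/

section PadicExtension

open IsLocalRing

variable {p : ℕ} [Fact p.Prime]

theorem isUnit_natCast_of_not_dvd {u : ℕ} (hu : ¬p ∣ u) : IsUnit (u : ℤ_[p]) := by
  rw [← notMem_maximalIdeal, PadicInt.maximalIdeal_eq_span_p, Ideal.mem_span_singleton]
  rintro h
  have : (p : ℤ_[p]) ^ 1 ∣ ((u : ℤ) : ℤ_[p]) := by simpa using h
  rw [PadicInt.pow_p_dvd_int_iff] at this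
  exact hu (by simpa using Int.natCast_dvd_natCast.mp (by simpa using this))

variable (p) (𝒪 : Type*) [CommRing 𝒪] [IsDomain 𝒪] [IsDiscreteValuationRing 𝒪]
  [Algebra ℤ_[p] 𝒪] [FaithfulSMul ℤ_[p] 𝒪]

omit [IsDomain 𝒪] [IsDiscreteValuationRing 𝒪] in
include p in
theorem charZero_of_faithfulSMul : CharZero 𝒪 :=
  charZero_of_injective_algebraMap (FaithfulSMul.algebraMap_injective ℤ_[p] 𝒪)

/-- The ramification index of `𝒪` over `ℤ_p`. -/
abbrev ramification : ℕ := (maximalIdeal ℤ_[p]).ramificationIdx' (maximalIdeal 𝒪)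

omit [IsDomain 𝒪] [IsDiscreteValuationRing 𝒪] in
theorem natCast_prime_ne_zero : (p : 𝒪) ≠ 0 := by
  have := charZero_of_faithfulSMul p 𝒪
  exact_mod_cast (Fact.out : p.Prime).ne_zero

/-- The exponent in `p = u π ^ e` is the ramification index, which is defined through powers of
ideals. -/
theorem span_prime_eq : Ideal.span {(p : 𝒪)} = maximalIdeal 𝒪 ^ ramification p 𝒪 := by
  obtain ⟨π, hπ⟩ := IsDiscreteValuationRing.exists_irreducible 𝒪
  obtain ⟨e, u, he⟩ := IsDiscreteValuationRing.eq_unit_mul_pow_irreducible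
    (natCast_prime_ne_zero p 𝒪) hπ
  have h1 : Ideal.span {(p : 𝒪)} = maximalIdeal 𝒪 ^ e := by
    rw [hπ.maximalIdeal_eq, Ideal.span_singleton_pow, he,
      Ideal.span_singleton_mul_left_unit u.isUnit]
  have h2 : (maximalIdeal ℤ_[p]).map (algebraMap ℤ_[p] 𝒪) = maximalIdeal 𝒪 ^ e := by
    rw [PadicInt.maximalIdeal_eq_span_p, Ideal.map_span, Set.image_singleton, map_natCast, h1]
  rw [ramification, Ideal.ramificationIdx'_spec (n := e) h2.le, h1]
  rw [h2]
  intro h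
  have h3 : π ^ e ∈ maximalIdeal 𝒪 ^ (e + 1) :=
    h (Ideal.pow_mem_pow (hπ.maximalIdeal_eq ▸ Ideal.mem_span_singleton_self π) _)
  rw [hπ.maximalIdeal_eq, Ideal.span_singleton_pow, Ideal.mem_span_singleton,
    pow_dvd_pow_iff hπ.ne_zero hπ.not_isUnit] at h3
  omega

theorem span_prime_pow_eq (N : ℕ) :
    Ideal.span {(p : 𝒪) ^ N} = maximalIdeal 𝒪 ^ (ramification p 𝒪 * N) := by
  rw [← Ideal.span_singleton_pow, span_prime_eq, pow_mul]

variable [Module.Finite ℤ_[p] 𝒪]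

theorem natCast_prime_mem : (p : 𝒪) ∈ maximalIdeal 𝒪 := by
  rw [mem_maximalIdeal, mem_nonunits_iff, ← map_natCast (algebraMap ℤ_[p] 𝒪), isUnit_map_iff,
    ← mem_nonunits_iff, ← mem_maximalIdeal, PadicInt.maximalIdeal_eq_span_p]
  exact Ideal.mem_span_singleton_self _

theorem ramification_pos : 0 < ramification p 𝒪 := by
  rw [Nat.pos_iff_ne_zero]
  intro h
  have h1 := span_prime_eq p 𝒪
  rw [h, pow_zero, Ideal.one_eq_top, Ideal.span_singleton_eq_top] at h1
  exact natCast_prime_mem p 𝒪 h1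

variable {p 𝒪}

-- This power of `𝔪` is `p ^ N 𝒪`, where membership is tested on coordinates: the `𝔪`-adic topology
-- is the product of the `p`-adic ones.
omit [Module.Finite ℤ_[p] 𝒪] in
theorem mem_maximalIdeal_pow_iff_repr {ι' : Type*} [Fintype ι'] (b : Module.Basis ι' ℤ_[p] 𝒪) {x : 𝒪}
    {N : ℕ} : x ∈ maximalIdeal 𝒪 ^ (ramification p 𝒪 * N) ↔
      ∀ k, b.repr x k ∈ maximalIdeal ℤ_[p] ^ N := by
  simp only [← span_prime_pow_eq, PadicInt.maximalIdeal_eq_span_p, Ideal.span_singleton_pow,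
    Ideal.mem_span_singleton]
  constructor
  · rintro ⟨z, rfl⟩ k
    have : (p : 𝒪) ^ N * z = (p : ℤ_[p]) ^ N • z := by
      rw [Algebra.smul_def, map_pow, map_natCast]
    rw [this, map_smul]
    exact ⟨_, rfl⟩
  · intro h
    choose c hc using h
    refine ⟨∑ k, c k • b k, ?_⟩
    have : (p : 𝒪) ^ N = algebraMap ℤ_[p] 𝒪 ((p : ℤ_[p]) ^ N) := by
      rw [map_pow, map_natCast]
    rw [← b.sum_repr x, this, ← Algebra.smul_def, Finset.smul_sum]
    exact Finset.sum_congr rfl fun k _ => by rw [hc, mul_smul]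

variable (p 𝒪)

-- Along the indices `e N` a Cauchy sequence has Cauchy coordinates, so completeness comes from
-- `ℤ_p`; as `e > 0`, this subsequence controls the whole sequence.
include p in
theorem isAdicComplete_maximalIdeal : IsAdicComplete (maximalIdeal 𝒪) 𝒪 := by
  have hH : IsHausdorff (maximalIdeal 𝒪) 𝒪 := inferInstance
  refine { hH with prec' := fun f hf => ?_ }
  have hf' : ∀ {m n : ℕ}, m ≤ n → f n - f m ∈ maximalIdeal 𝒪 ^ m := fun h => by
    have := (SModEq.sub_mem.mp (hf h).symm)
    simpa using this
  let b := Module.finBasis ℤ_[p] 𝒪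
  have hl : ∀ k, ∃ l : ℤ_[p], ∀ N, b.repr (f (ramification p 𝒪 * N)) k - l ∈
      maximalIdeal ℤ_[p] ^ N := fun k => by
    obtain ⟨l, hl⟩ := IsPrecomplete.prec (IsAdicComplete.toIsPrecomplete (I := maximalIdeal ℤ_[p])
      (M := ℤ_[p])) (f := fun N => b.repr (f (ramification p 𝒪 * N)) k) (fun {m n} h => by
        rw [SModEq.comm, SModEq.sub_mem]
        have := (mem_maximalIdeal_pow_iff_repr b).mp (hf' (Nat.mul_le_mul_left _ h)) k
        simpa using this)
    exact ⟨l, fun N => by simpa using SModEq.sub_mem.mp (hl N)⟩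
  choose l hl using hl
  refine ⟨∑ k, l k • b k, fun N => ?_⟩
  have h1 : f (ramification p 𝒪 * N) - ∑ k, l k • b k ∈
      maximalIdeal 𝒪 ^ (ramification p 𝒪 * N) := by
    rw [mem_maximalIdeal_pow_iff_repr b]
    intro k
    rw [map_sub, Finsupp.sub_apply, b.repr_sum_self]
    exact hl k N
  have hN : N ≤ ramification p 𝒪 * N := Nat.le_mul_of_pos_left _ (ramification_pos p 𝒪)
  have h2 := sub_mem (Ideal.pow_le_pow_right hN h1) (hf' hN)
  rw [SModEq.sub_mem]
  rw [sub_sub_sub_cancel_left] at h2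
  simpa using h2

variable {p 𝒪}

omit [Module.Finite ℤ_[p] 𝒪] in
/-- For `e < p - 1`, the quotient of `π ^ (d - 1)` by a positive integer `N ≤ d` is integral, and
tends to `0` with `d`. -/
theorem exists_natCast_mul_eq_pow (he : ramification p 𝒪 < p - 1) {π : 𝒪} (hπ : Irreducible π)
    {d N : ℕ} (hN : N ≠ 0) (hNd : N ≤ d) :
    ∃ k x, (N : 𝒪) * k * π = π ^ d ∧ k ∈ maximalIdeal 𝒪 ^ x ∧ d - 1 ≤ (p - 1) * x := by
  have hp := (Fact.out : p.Prime)
  obtain ⟨v, u, hu, hv⟩ := Nat.exists_eq_pow_mul_and_not_dvd hN p hp.ne_one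
  have hupos : 0 < u := Nat.pos_of_ne_zero fun h => hN (by rw [hv, h, mul_zero])
  have h1 : p ^ v ≤ d := (Nat.le_mul_of_pos_right _ hupos).trans (hv ▸ hNd)
  -- Bernoulli's inequality, used as `v (p - 1) ≤ p ^ v - 1 ≤ d - 1`.
  have h2 : 1 + v * (p - 1) ≤ p ^ v := by
    have := one_add_mul_le_pow (R := ℤ) (a := p - 1) (by have := hp.pos; omega) v
    have h3 : ((1 + v * (p - 1) : ℕ) : ℤ) = 1 + v * (p - 1) := by
      push_cast [Nat.cast_sub hp.one_le]; ring
    zify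
    rw [← Nat.cast_one, ← Nat.cast_sub hp.one_le, Nat.cast_one] at *
    simpa [Nat.cast_sub hp.one_le] using this
  obtain ⟨e, w, hw⟩ := IsDiscreteValuationRing.eq_unit_mul_pow_irreducible
    (natCast_prime_ne_zero p 𝒪) hπ
  have hew : e = ramification p 𝒪 := by
    have h3 := span_prime_eq p 𝒪
    rw [hπ.maximalIdeal_eq, Ideal.span_singleton_pow, hw,
      Ideal.span_singleton_mul_left_unit w.isUnit, Ideal.span_singleton_eq_span_singleton] at h3
    exact le_antisymm ((pow_dvd_pow_iff hπ.ne_zero hπ.not_isUnit).mp h3.dvd)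
      ((pow_dvd_pow_iff hπ.ne_zero hπ.not_isUnit).mp h3.symm.dvd)
  have huu : IsUnit (u : 𝒪) := by
    simpa using (isUnit_natCast_of_not_dvd hu).map (algebraMap ℤ_[p] 𝒪)
  obtain ⟨u', hu'⟩ := huu
  have hd : e * v ≤ d - 1 := by
    have h4 : e * v ≤ v * (p - 1) := by
      rw [mul_comm]; exact Nat.mul_le_mul_left _ (by omega)
    omega
  obtain ⟨x, hx⟩ := Nat.exists_eq_add_of_le hd
  have hd0 : 0 < d := lt_of_lt_of_le (Nat.pos_of_ne_zero hN) hNd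
  -- Here `k = π ^ (d - 1) / N`, where `N = p ^ v u` and `p = w π ^ e`; its valuation is `x = d - 1
  -- - e v`.
  refine ⟨↑u'⁻¹ * ↑(w⁻¹ ^ v) * π ^ x, x, ?_, ?_, ?_⟩
  · have h5 : d = e * v + x + 1 := by omega
    rw [hv, h5]
    push_cast
    rw [hw, ← hu', pow_succ, pow_add, pow_mul, mul_pow]
    have h6 : (w : 𝒪) ^ v * (↑w⁻¹ : 𝒪) ^ v = 1 := by rw [← mul_pow, Units.mul_inv, one_pow]
    have h7 : (u' : 𝒪) * (↑u'⁻¹ : 𝒪) = 1 := Units.mul_inv _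
    linear_combination (π ^ e) ^ v * π ^ x * π * (h6 + (w : 𝒪) ^ v * (↑w⁻¹ : 𝒪) ^ v * (h7))
  · exact Ideal.mul_mem_left _ _
      (Ideal.pow_mem_pow (hπ.maximalIdeal_eq ▸ Ideal.mem_span_singleton_self π) _)
  -- From `v (p - 1) ≤ d - 1` and `e + 1 ≤ p - 1` follows `(p - 1) x ≥ (p - 1 - e) (d - 1) ≥ d - 1`.
  · have h8 : (e + 1) * v ≤ (p - 1) * v := Nat.mul_le_mul_right _ (by omega)
    obtain ⟨P, hP⟩ : ∃ P, p - 1 = e + 1 + P := Nat.exists_eq_add_of_le (by omega)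
    rw [hP] at h2 h8 ⊢
    rw [hx]
    have h9 : v * (e + 1 + P) ≤ e * v + x := by omega
    nlinarith [Nat.zero_le (P * x), Nat.zero_le (P * v), Nat.mul_le_mul_left e h9]

end PadicExtension

/-! ### Rescaling of power series -/

section Scaling

open MvPowerSeries

variable {A K σ τ : Type*} [CommRing A] [CommRing K] [Finite σ]

omit [Finite σ] in
theorem rescale_const_eq_subst (π : A) (f : MvPowerSeries σ A) :
    rescale (fun _ => π) f = subst (fun i => C π * X i : σ → MvPowerSeries σ A) f := by
  rw [rescale_eq_subst]
  congr 1
  funext i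
  rw [Pi.smul_apply', smul_eq_C_mul]

omit [Finite σ] in
theorem constantCoeff_C_mul_eq_zero {b : σ → MvPowerSeries τ A} (hb : ∀ i, constantCoeff (b i) = 0)
    (π : A) (i : σ) : constantCoeff (C π * b i) = 0 := by
  rw [map_mul, hb, mul_zero]

theorem subst_C_mul {b : σ → MvPowerSeries τ A} (hb : ∀ i, constantCoeff (b i) = 0) (a : A)
    (f : MvPowerSeries σ A) : subst b (C a * f) = C a * subst b f := by
  rw [← smul_eq_C_mul, subst_smul (hasSubst_of_zero hb), smul_eq_C_mul]

theorem subst_rescale_const [Finite τ] {b : σ → MvPowerSeries τ A} (hb : ∀ i, constantCoeff (b i) = 0)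
    (π : A) (f : MvPowerSeries σ A) :
    subst b (rescale (fun _ => π) f) = subst (fun i => C π * b i) f := by
  rw [rescale_const_eq_subst, subst_subst (constantCoeff_C_mul_eq_zero constantCoeff_X π) hb]
  congr 1
  funext i
  rw [subst_C_mul hb, subst_X (hasSubst_of_zero hb)]

theorem rescale_const_subst [Finite τ] {b : σ → MvPowerSeries τ A} (hb : ∀ i, constantCoeff (b i) = 0)
    (π : A) (f : MvPowerSeries σ A) :
    rescale (fun _ => π) (subst b f) = subst (fun i => rescale (fun _ => π) (b i)) f := by
  simp only [rescale_const_eq_subst]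
  rw [subst_subst hb (constantCoeff_C_mul_eq_zero constantCoeff_X π)]

theorem rescale_const_X (π : A) (i : σ) :
    rescale (fun _ => π) (X i : MvPowerSeries σ A) = C π * X i := by
  rw [rescale_const_eq_subst,
    subst_X (hasSubst_of_zero (constantCoeff_C_mul_eq_zero constantCoeff_X π))]

omit [Finite σ] in
theorem eq_of_C_mul_eq [IsDomain A] {π : A} (hπ : π ≠ 0) {f g : MvPowerSeries σ A}
    (h : C π * f = C π * g) : f = g := by
  ext J
  have := congrArg (coeff J) h
  rw [coeff_C_mul, coeff_C_mul] at this
  exact mul_left_cancel₀ hπ this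

/-- The series `f` is `π⁻¹ P(π X)`. -/
def IsScaling (ρ : A →+* K) (π : A) (f : MvPowerSeries σ A) (P : MvPowerSeries σ K) : Prop :=
  C (ρ π) * MvPowerSeries.map ρ f = rescale (fun _ => ρ π) P

omit [Finite σ] in
theorem IsScaling.map {A' K' : Type*} [CommRing A'] [CommRing K'] {ρ : A →+* K} {π : A}
    {f : MvPowerSeries σ A} {P : MvPowerSeries σ K} (h : IsScaling ρ π f P) {ρ' : A' →+* K'}
    {φ : A →+* A'} {ψ : K →+* K'} (hφ : ψ.comp ρ = ρ'.comp φ) :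
    IsScaling ρ' (φ π) (MvPowerSeries.map φ f) (MvPowerSeries.map ψ P) := by
  have h1 := congrArg (MvPowerSeries.map ψ) h
  have h2 : ∀ a, ψ (ρ a) = ρ' (φ a) := RingHom.congr_fun hφ
  ext J
  have h3 := congrArg (coeff J) h1
  rw [map_mul, map_C, coeff_C_mul, coeff_map, coeff_map, coeff_map, coeff_rescale_const, map_mul,
    map_pow, h2, h2] at h3
  rw [coeff_C_mul, coeff_map, coeff_map, coeff_rescale_const, coeff_map, h3]

/-- The series `π⁻¹ F(π X)`. -/
theorem exists_C_mul_eq_rescale [IsLocalRing A] {π : A} (hπ : π ∈ IsLocalRing.maximalIdeal A)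
    {f : MvPowerSeries σ A} (hf : constantCoeff f = 0) : ∃ g : MvPowerSeries σ A,
      constantCoeff g = 0 ∧ C π * g = rescale (fun _ => π) f ∧ IsConvergent g := by
  classical
  let g : MvPowerSeries σ A := fun J => if J = 0 then 0 else π ^ (J.degree - 1) * coeff J f
  have hg : ∀ J, coeff J g = if J = 0 then 0 else π ^ (J.degree - 1) * coeff J f := fun _ => rfl
  refine ⟨g, ?_, ?_, fun N => ?_⟩
  · rw [← coeff_zero_eq_constantCoeff_apply, hg, if_pos rfl]
  · ext J
    rw [coeff_C_mul, coeff_rescale_const, hg]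
    split_ifs with h
    · rw [h, coeff_zero_eq_constantCoeff_apply, hf, mul_zero, mul_zero]
    · rw [← mul_assoc, mul_pow_sub_one (by rwa [Ne, Finsupp.degree_eq_zero_iff])]
  · refine (Finsupp.finite_of_degree_le N).subset fun J hJ => ?_
    by_contra hc
    refine hJ ?_
    rw [hg]
    split_ifs
    · exact zero_mem _
    · have hc' : N < J.degree := not_le.mp hc
      exact Ideal.mul_mem_right _ _ (Ideal.pow_le_pow_right (by omega) (Ideal.pow_mem_pow hπ _))

/-- Additivity of the scaled logarithm. -/
theorem IsScaling.subst_eq [IsDomain A] {ρ : A →+* K} (hρ : Function.Injective ρ) {π : A}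
    (hπ : π ≠ 0) {f : MvPowerSeries σ A} {P : MvPowerSeries σ K} (h : IsScaling ρ π f P)
    {F F' : σ → MvPowerSeries (σ ⊕ σ) A} (hF : ∀ i, constantCoeff (F i) = 0)
    (hF' : ∀ i, constantCoeff (F' i) = 0) (hFF' : ∀ i, C π * F' i = rescale (fun _ => π) (F i))
    (hP : subst (fun j => MvPowerSeries.map ρ (F j)) P =
      subst (vars K (Sum.inl : σ → σ ⊕ σ)) P + subst (vars K (Sum.inr : σ → σ ⊕ σ)) P) :
    subst F' f = subst (vars A (Sum.inl : σ → σ ⊕ σ)) f +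
      subst (vars A (Sum.inr : σ → σ ⊕ σ)) f := by
  have hm : ∀ {b : σ → MvPowerSeries (σ ⊕ σ) A} (_ : ∀ i, constantCoeff (b i) = 0) i,
      constantCoeff (MvPowerSeries.map ρ (b i)) = 0 := fun hb i => by
    rw [constantCoeff_map, hb, map_zero]
  -- This says `π f(b) = P(π b)`. The additivity of `P` thus passes to `f` after multiplying by `π`
  -- and mapping injectively to `K`.
  have hr : ∀ (b : σ → MvPowerSeries (σ ⊕ σ) A) (_ : ∀ i, constantCoeff (b i) = 0),
      C (ρ π) * MvPowerSeries.map ρ (subst b f) =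
        subst (fun i => C (ρ π) * MvPowerSeries.map ρ (b i)) P := fun b hb => by
    rw [map_subst_of_zero hb, ← subst_C_mul (hm hb), h, subst_rescale_const (hm hb)]
  have hv : ∀ e : σ → σ ⊕ σ, subst (fun i => C (ρ π) * MvPowerSeries.map ρ (vars A e i)) P =
      rescale (fun _ => ρ π) (subst (vars K e) P) := fun e => by
    rw [rescale_const_subst (constantCoeff_vars e)]
    congr 1
    funext i
    simp only [vars, map_X, rescale_const_X]
  have e1 : (fun i => C (ρ π) * MvPowerSeries.map ρ (F' i)) =
      fun i => rescale (fun _ => ρ π) (MvPowerSeries.map ρ (F i)) := by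
    funext i
    have h1 := congrArg (MvPowerSeries.map ρ) (hFF' i)
    rw [map_mul, map_C] at h1
    rw [h1]
    ext J
    simp only [coeff_map, coeff_rescale_const, map_mul, map_pow]
  have hinj : Function.Injective (MvPowerSeries.map ρ : MvPowerSeries (σ ⊕ σ) A →+* _) :=
    fun f g h => by
      ext J
      exact hρ (by simpa using congrArg (coeff J) h)
  refine eq_of_C_mul_eq hπ (hinj ?_)
  rw [mul_add, map_add, map_mul, map_mul, map_mul, map_C, hr _ hF', hr _ (constantCoeff_vars _),
    hr _ (constantCoeff_vars _), hv, hv, ← map_add, ← hP, rescale_const_subst (hm hF), e1]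

/-- The scaled exponential is the inverse of the scaled logarithm. -/
theorem IsScaling.inverse {ρ : A →+* K} {π : A} {f g : σ → MvPowerSeries σ A}
    {P Q : σ → MvPowerSeries σ K} (hf : IsTangentToId f) (h : ∀ i, IsScaling ρ π (f i) (P i))
    (hP : ∀ i, constantCoeff (P i) = 0) (hPQ : ∀ i, subst P (Q i) = X i)
    (hfg : ∀ i, subst f (g i) = X i) (i : σ) : IsScaling ρ π (g i) (Q i) := by
  have hf' : IsTangentToId fun i => MvPowerSeries.map ρ (f i) := fun i => by
    have := map_mem_ordIdeal ρ (hf i)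
    rwa [map_sub, map_X] at this
  -- Compare after substituting `f`: the left side becomes `π X i`, the right side `Q(P(π X)) = π X
  -- i`.
  apply hf'.subst_injective
  rw [subst_C_mul hf'.constantCoeff, ← map_subst_of_zero hf.constantCoeff, hfg, map_X,
    subst_rescale_const hf'.constantCoeff,
    show (fun i => C (ρ π) * MvPowerSeries.map ρ (f i)) = fun i => rescale (fun _ => ρ π) (P i) from
      funext h, ← rescale_const_subst hP, hPQ, rescale_const_X]

-- Term by term, the series of `P` at `π w` is `π` times the series of `f` at `w`. Its terms come
-- from `A`, whatever the denominators of `P`.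
omit [Finite σ] in
theorem IsScaling.hasAdicSum [IsLocalRing A] [Algebra A K] {π : A} {f : MvPowerSeries σ A}
    {P : MvPowerSeries σ K} (h : IsScaling (algebraMap A K) π f P) {w : σ → A} {v : A}
    (hv : HasValue f w v) : HasAdicSum A (fun J : σ →₀ ℕ => coeff J P *
      algebraMap A K (J.prod fun j k => (π * w j) ^ k)) (algebraMap A K (π * v)) := by
  intro N
  obtain ⟨S, hS⟩ := hv N
  refine ⟨S, fun T hT => ?_⟩
  obtain ⟨r, hr, hr'⟩ := hS T hT
  refine ⟨π * r, Ideal.mul_mem_left _ _ hr, ?_⟩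
  have h1 : ∀ J : σ →₀ ℕ, coeff J P * algebraMap A K (J.prod fun j k => (π * w j) ^ k) =
      algebraMap A K (π * (coeff J f * J.prod fun j k => w j ^ k)) := fun J => by
    have h2 := congrArg (coeff J) h
    rw [coeff_C_mul, coeff_map, coeff_rescale_const] at h2
    have h3 : (J.prod fun j k => (π * w j) ^ k) = π ^ J.degree * J.prod fun j k => w j ^ k := by
      simp only [mul_pow, Finsupp.prod_mul]
      rw [Finsupp.prod, Finset.prod_pow_eq_pow_sum]
      rfl
    rw [h3, map_mul, map_mul, map_mul, map_pow, ← mul_assoc (algebraMap A K π), h2]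
    ring
  simp only [h1]
  rw [← map_sum, ← map_sub, ← Finset.mul_sum, ← mul_sub, hr']
  rfl

end Scaling

/-! ### Integrality of the scaled logarithm -/

section ScaledLog

open MvPowerSeries IsLocalRing

variable {p : ℕ} [Fact p.Prime] {𝒪 : Type*} [CommRing 𝒪] [IsDomain 𝒪] [IsDiscreteValuationRing 𝒪]
  [Algebra ℤ_[p] 𝒪] [FaithfulSMul ℤ_[p] 𝒪] {π : 𝒪} {R S κ : Type*} [CommRing R] [CommRing S]
  [Fintype κ] [DecidableEq κ]

/-- Choose `j` with `b j ≠ 0`. The coefficient of `L i` at `b`, times `b j`, is a coefficient of the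
integral form `dL_i`; the denominator `b j ≤ |b|` is absorbed by `π ^ (|b| - 1)` because `e < p -
1`. The quotient is kept as a factor `k` from `𝒪`, so that its divisibility survives evaluation of
the coefficients at points of the base. -/
theorem IsLogOver.exists_isScaling (he : ramification p 𝒪 < p - 1) (hπ : Irreducible π)
    (ε : 𝒪 →+* R) {ρ : R →+* S} {F : κ → MvPowerSeries (κ ⊕ κ) R} (hF : IsFormalGroup F)
    {L : κ → MvPowerSeries κ S} (hL : IsLogOver ρ F L) :
    ∃ ℓ : κ → MvPowerSeries κ R, IsTangentToId ℓ ∧ (∀ i, IsScaling ρ (ε π) (ℓ i) (L i)) ∧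
      ∀ i b, ∃ x k r, coeff b (ℓ i) = ε k * r ∧ k ∈ maximalIdeal 𝒪 ^ x ∧
        b.degree - 1 ≤ (p - 1) * x := by
  have key : ∀ (i : κ) (b : κ →₀ ℕ), ∃ a : R, (b = 0 → a = 0) ∧
      (∀ j, b = Finsupp.single j 1 → a = if i = j then 1 else 0) ∧
      ρ (ε π) * ρ a = ρ (ε π) ^ b.degree * coeff b (L i) ∧
      ∃ x k r, a = ε k * r ∧ k ∈ maximalIdeal 𝒪 ^ x ∧ b.degree - 1 ≤ (p - 1) * x := by
    intro i b
    by_cases hb : b = 0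
    · refine ⟨0, fun _ => rfl, fun j hj => ?_, ?_, 0, 0, 0, by simp, by simp, by simp [hb]⟩
      · rw [hb] at hj
        exact absurd hj.symm (by simp)
      · rw [hb, coeff_zero_eq_constantCoeff_apply, (hL i).1, map_zero, mul_zero, mul_zero]
    obtain ⟨j, hj⟩ : ∃ j, b j ≠ 0 := by
      by_contra! h
      exact hb (Finsupp.ext h)
    obtain ⟨b', rfl⟩ : ∃ b', b = b' + Finsupp.single j 1 := ⟨b - Finsupp.single j 1,
      (tsub_add_cancel_of_le (by simpa using Nat.one_le_iff_ne_zero.mpr hj)).symm⟩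
    set d := (b' + Finsupp.single j 1).degree with hd
    have hNd : (b' + Finsupp.single j 1 : κ →₀ ℕ) j ≤ d := Finsupp.le_degree j _
    obtain ⟨k, x, hk, hx, hdx⟩ := exists_natCast_mul_eq_pow he hπ hj hNd
    have h1 := congrArg (coeff b') ((hL i).2 j)
    rw [coeff_pderiv, coeff_map] at h1
    have hNj : (((b' + Finsupp.single j 1 : κ →₀ ℕ) j : ℕ) : S) = (b' j : S) + 1 := by simp
    rw [← hNj] at h1
    refine ⟨ε k * coeff b' (invariantForms F i j), fun h => absurd h hb, fun j' hj' => ?_, ?_,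
      x, k, _, rfl, hx, hdx⟩
    · have hjj : j = j' := by
        by_contra hne
        rw [hj'] at hj
        exact hj (by simp [Ne.symm hne])
      subst hjj
      have hb' : b' = 0 := by simpa using hj'
      subst hb'
      have hk1 : k = 1 := by
        have hd1 : d = 1 := by simp [hd]
        rw [hd1, pow_one] at hk
        refine mul_right_cancel₀ hπ.ne_zero ?_
        simpa using hk
      have e := congrFun (congrFun hF.constantCoeff_invariantForms i) j
      rw [Matrix.map_apply, Matrix.one_apply] at e
      rw [hk1, map_one, one_mul, coeff_zero_eq_constantCoeff_apply, e]
    · rw [map_mul, ← h1, ← map_pow, ← map_pow, ← hk]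
      simp only [map_mul, map_natCast]
      ring
  choose a h0 h1 h2 h3 using key
  let ℓ : κ → MvPowerSeries κ R := fun i b => a i b
  have hℓ : ∀ i b, coeff b (ℓ i) = a i b := fun _ _ => rfl
  refine ⟨ℓ, isTangentToId_iff.mpr fun i => ⟨?_, fun j => ?_⟩, fun i => ?_, fun i b => h3 i b⟩
  · rw [← coeff_zero_eq_constantCoeff_apply, hℓ, h0 i 0 rfl]
  · rw [hℓ, h1 i _ j rfl]
  · ext b
    rw [coeff_C_mul, coeff_map, coeff_rescale_const, hℓ, h2]

end ScaledLog

/-! ### Power series in two groups of variables -/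

section TotalSeries

open MvPowerSeries IsLocalRing

variable {A : Type*} [CommRing A] {σ τ : Type*}

/-- The series `∑ g_b(π S) T ^ b`. -/
def totalSeries (π : A) (g : (τ →₀ ℕ) → MvPowerSeries σ A) : MvPowerSeries (σ ⊕ τ) A :=
  fun J => π ^ (Finsupp.sumFinsuppEquivProdFinsupp J).1.degree *
    coeff (Finsupp.sumFinsuppEquivProdFinsupp J).1 (g (Finsupp.sumFinsuppEquivProdFinsupp J).2)

theorem coeff_totalSeries (π : A) (g : (τ →₀ ℕ) → MvPowerSeries σ A) (J : σ ⊕ τ →₀ ℕ) :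
    coeff J (totalSeries π g) = coeff (Finsupp.sumFinsuppEquivProdFinsupp J).1
      (rescale (fun _ => π) (g (Finsupp.sumFinsuppEquivProdFinsupp J).2)) := by
  rw [coeff_rescale_const]
  rfl

theorem sumFinsuppEquivProdFinsupp_zero :
    Finsupp.sumFinsuppEquivProdFinsupp (0 : σ ⊕ τ →₀ ℕ) = 0 := by
  ext <;> simp

theorem sumFinsuppEquivProdFinsupp_single_inl (i : σ) (k : ℕ) :
    Finsupp.sumFinsuppEquivProdFinsupp (Finsupp.single (Sum.inl i) k : σ ⊕ τ →₀ ℕ) =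
      (Finsupp.single i k, 0) := by
  classical
  ext <;> simp [Finsupp.single_apply]

theorem sumFinsuppEquivProdFinsupp_single_inr (i : τ) (k : ℕ) :
    Finsupp.sumFinsuppEquivProdFinsupp (Finsupp.single (Sum.inr i) k : σ ⊕ τ →₀ ℕ) =
      (0, Finsupp.single i k) := by
  classical
  ext <;> simp [Finsupp.single_apply]

theorem degree_eq_add_of_sum [Finite σ] [Finite τ] (J : σ ⊕ τ →₀ ℕ) :
    J.degree = (Finsupp.sumFinsuppEquivProdFinsupp J).1.degree +
      (Finsupp.sumFinsuppEquivProdFinsupp J).2.degree := by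
  cases nonempty_fintype σ
  cases nonempty_fintype τ
  simp [Finsupp.degree_eq_sum]

theorem prod_sumFinsuppEquivProdFinsupp_symm [Finite σ] [Finite τ] (a : σ →₀ ℕ) (b : τ →₀ ℕ)
    (y : σ → A) (x : τ → A) :
    ((Finsupp.sumFinsuppEquivProdFinsupp.symm (a, b)).prod fun i k => Sum.elim y x i ^ k) =
      (a.prod fun i k => y i ^ k) * b.prod fun i k => x i ^ k := by
  cases nonempty_fintype σ
  cases nonempty_fintype τ
  rw [Finsupp.prod_fintype _ _ (by simp), Finsupp.prod_fintype _ _ (by simp),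
    Finsupp.prod_fintype _ _ (by simp)]
  simp

variable [IsLocalRing A] [IsAdicComplete (maximalIdeal A) A] [Finite σ] [Finite τ] {π : A}

/-- The inner sums over the base variables are the values of the `g b` at `π y`. Modulo `𝔪 ^ N` both
summations are finite: the inner one because of the factors `π ^ |a|`, the outer one by the decay of
`g b`, uniform in `a`. -/
theorem convergesTo_totalSeries (hπ : π ∈ maximalIdeal A)
    {g : (τ →₀ ℕ) → MvPowerSeries σ A}
    (hg : ∀ N, ∃ D, ∀ b : τ →₀ ℕ, D < b.degree → ∀ a, coeff a (g b) ∈ maximalIdeal A ^ N)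
    {y : σ → A} {x : τ → A} {h : MvPowerSeries τ A} (hh : ∀ b, coeff b h = evalScaled hπ y (g b))
    {v : A} (hv : ConvergesTo h x v) : ConvergesTo (totalSeries π g) (Sum.elim y x) v := by
  classical
  refine ConvergesTo.of_finset fun N => ?_
  obtain ⟨D, hD⟩ := hg N
  let T₁ : Finset (σ →₀ ℕ) := (Finsupp.finite_of_degree_le N).toFinset
  let T₂ : Finset (τ →₀ ℕ) := (Finsupp.finite_of_degree_le D).toFinset
  have hT₁ : ∀ f : MvPowerSeries σ A, ∀ a ∉ T₁,
      coeff a (rescale (fun _ => π) f) ∈ maximalIdeal A ^ N := fun f a ha => by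
    have ha' : N < a.degree := by simpa [T₁] using ha
    rw [coeff_rescale_const]
    exact Ideal.mul_mem_right _ _ (Ideal.pow_le_pow_right ha'.le (Ideal.pow_mem_pow hπ _))
  have hT₂ : ∀ b ∉ T₂, ∀ a, coeff a (rescale (fun _ => π) (g b)) ∈ maximalIdeal A ^ N :=
    fun b hb a => by
      rw [coeff_rescale_const]
      exact Ideal.mul_mem_left _ _ (hD b (by simpa [T₂] using hb) a)
  have happ : ∀ b, IsApprox N (rescale (fun _ => π) (g b))
      (∑ a ∈ T₁, MvPolynomial.monomial a (coeff a (rescale (fun _ => π) (g b)))) := fun b =>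
    isApprox_sum_monomial (hT₁ _)
  have hval : ∀ b, evalScaled hπ y (g b) - ∑ a ∈ T₁, coeff a (rescale (fun _ => π) (g b)) *
      (a.prod fun i k => y i ^ k) ∈ maximalIdeal A ^ N := fun b => by
    have := (convergesTo_evalScaled (hπ := hπ) (w := y) (g b)).sub_eval_mem (happ b)
    simpa only [map_sum, MvPolynomial.eval_monomial] using this
  have hh₂ : IsApprox N h (∑ b ∈ T₂, MvPolynomial.monomial b (coeff b h)) :=
    isApprox_sum_monomial fun b hb => by
      rw [hh]
      have h1 := hval b
      refine (Submodule.sub_mem_iff_left _ ?_).mp h1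
      exact sum_mem fun a _ => Ideal.mul_mem_right _ _ (hT₂ b hb a)
  have hv₂ := hv.sub_eval_mem hh₂
  simp only [map_sum, MvPolynomial.eval_monomial] at hv₂
  refine ⟨(T₁ ×ˢ T₂).map Finsupp.sumFinsuppEquivProdFinsupp.symm.toEmbedding, fun J hJ => ?_, ?_⟩
  · rw [coeff_totalSeries]
    by_cases h1 : (Finsupp.sumFinsuppEquivProdFinsupp J).1 ∈ T₁
    · refine hT₂ _ (fun h2 => hJ ?_) _
      rw [Finset.mem_map_equiv, Equiv.symm_symm, Finset.mem_product]
      exact ⟨h1, h2⟩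
    · exact hT₁ _ _ h1
  · rw [Finset.sum_map, Finset.sum_product_right]
    simp only [Equiv.coe_toEmbedding, coeff_totalSeries, Equiv.apply_symm_apply,
      prod_sumFinsuppEquivProdFinsupp_symm]
    have h3 : ∑ b ∈ T₂, (evalScaled hπ y (g b) - ∑ a ∈ T₁, coeff a (rescale (fun _ => π) (g b)) *
      (a.prod fun i k => y i ^ k)) * (b.prod fun i k => x i ^ k) ∈ maximalIdeal A ^ N :=
      sum_mem fun b _ => Ideal.mul_mem_right _ _ (hval b)
    have := add_mem hv₂ h3
    simp only [sub_mul, Finset.sum_sub_distrib, hh, Finset.sum_mul, sub_add_sub_cancel,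
      mul_assoc] at this
    exact this

end TotalSeries

/-! ### Convergent changes of coordinates -/

section CoordinateChange

open MvPowerSeries IsLocalRing

variable {A R : Type*} [CommRing A] [IsLocalRing A] [CommRing R] {σ τ : Type*}

/-- A tuple of series which is tangent to the identity, congruent to the identity modulo `𝔪`, and
whose coefficients are uniformly divisible by elements of `A` which tend to `0`. -/
structure IsCoordinateChange (ε : A →+* R) (P : σ → MvPowerSeries σ R) : Prop where
  tangent : IsTangentToId P
  tendsto : ∀ N, ∃ D, ∀ i b, D < b.degree → ∃ k ∈ maximalIdeal A ^ N, ∃ r, coeff b (P i) = ε k * r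
  small : ∀ i b, 1 < b.degree → ∃ k ∈ maximalIdeal A, ∃ r, coeff b (P i) = ε k * r

variable {ε : A →+* R}

theorem IsCoordinateChange.map {P : σ → MvPowerSeries σ R} (h : IsCoordinateChange ε P)
    {c : R →+* A} (hc : c.comp ε = RingHom.id A) :
    IsCoordinateChange (RingHom.id A) fun i => MvPowerSeries.map c (P i) where
  tangent i := by
    have := map_mem_ordIdeal c (h.tangent i)
    rwa [map_sub, map_X] at this
  tendsto N := by
    obtain ⟨D, hD⟩ := h.tendsto N
    refine ⟨D, fun i b hb => ?_⟩
    obtain ⟨k, hk, r, hr⟩ := hD i b hb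
    refine ⟨k, hk, c r, ?_⟩
    rw [coeff_map, hr, map_mul, ← RingHom.comp_apply c, hc]
  small i b hb := by
    obtain ⟨k, hk, r, hr⟩ := h.small i b hb
    refine ⟨k, hk, c r, ?_⟩
    rw [coeff_map, hr, map_mul, ← RingHom.comp_apply c, hc]

variable [Finite σ] {P : σ → MvPowerSeries σ A}

theorem IsCoordinateChange.isConvergent (h : IsCoordinateChange (RingHom.id A) P) (i : σ) :
    IsConvergent (P i) := fun N => by
  obtain ⟨D, hD⟩ := h.tendsto N
  refine (Finsupp.finite_of_degree_le D).subset fun J hJ => ?_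
  by_contra hc
  obtain ⟨k, hk, r, hr⟩ := hD i J (not_le.mp hc)
  exact hJ (hr ▸ Ideal.mul_mem_right _ _ hk)

theorem IsCoordinateChange.exists_inverse (h : IsCoordinateChange (RingHom.id A) P) :
    ∃ Q : σ → MvPowerSeries σ A, IsTangentToId Q ∧ (∀ i, IsConvergent (Q i)) ∧
      (∀ i, subst P (Q i) = X i) ∧ ∀ i, subst Q (P i) = X i := by
  obtain ⟨Q, hQ, hPQ, hQP⟩ := h.tangent.exists_inverse
  refine ⟨Q, hQ, isConvergent_of_inverse hQ hQP h.isConvergent fun i J => ?_, hPQ, hQP⟩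
  rcases lt_or_ge J.degree 2 with hJ | hJ
  · rw [h.tangent i J hJ]
    exact zero_mem _
  · obtain ⟨k, hk, r, hr⟩ := h.small i J hJ
    have hX : coeff J (X i : MvPowerSeries σ A) = 0 := by
      classical
      rw [coeff_X, if_neg]
      rintro rfl
      simp at hJ
    rw [map_sub, hX, sub_zero, hr]
    exact Ideal.mul_mem_right _ _ hk

variable [Finite τ] {π : A}

/-- The coordinate change `(S, T) ↦ (S, ∑ ℓ_b(π S) T ^ b)`. -/
theorem IsCoordinateChange.total (hπ : π ∈ maximalIdeal A) {ℓ : τ → MvPowerSeries τ R}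
    (h : IsCoordinateChange ε ℓ) {φ : R →+* MvPowerSeries σ A} (hφ : φ.comp ε = C) :
    IsCoordinateChange (RingHom.id A) (Sum.elim (fun i => X (Sum.inl i))
      fun i => totalSeries π fun b => φ (coeff b (ℓ i)) : σ ⊕ τ → MvPowerSeries (σ ⊕ τ) A) := by
  classical
  have hX : ∀ (i : σ) (J : σ ⊕ τ →₀ ℕ), 1 < J.degree →
      coeff J (X (Sum.inl i) : MvPowerSeries (σ ⊕ τ) A) = 0 := fun i J hJ => by
    rw [coeff_X, if_neg]
    rintro rfl
    simp at hJ
  have hc : ∀ {a b i k r}, coeff b (ℓ i) = ε k * r →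
      coeff a (rescale (fun _ => π) (φ (coeff b (ℓ i)))) = k * (π ^ a.degree * coeff a (φ r)) :=
    fun {a b i k r} h => by
      rw [coeff_rescale_const, h, map_mul, ← RingHom.comp_apply φ, hφ, coeff_C_mul]
      ring
  constructor
  · rw [isTangentToId_iff]
    have h1 := isTangentToId_iff.mp h.tangent
    rintro (i | i)
    · refine ⟨constantCoeff_X _, fun j => ?_⟩
      rw [Sum.elim_inl, coeff_X]
      simp only [Finsupp.single_left_inj one_ne_zero, eq_comm]
    · refine ⟨?_, ?_⟩
      · rw [Sum.elim_inr, ← coeff_zero_eq_constantCoeff_apply, coeff_totalSeries,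
          sumFinsuppEquivProdFinsupp_zero, Prod.snd_zero, coeff_zero_eq_constantCoeff_apply,
          (h1 i).1, map_zero, map_zero, map_zero]
      rintro (j | j)
      · rw [Sum.elim_inr, coeff_totalSeries, sumFinsuppEquivProdFinsupp_single_inl]
        dsimp only
        rw [coeff_zero_eq_constantCoeff_apply,
          (h1 i).1, map_zero, map_zero, map_zero, if_neg (by simp)]
      · rw [Sum.elim_inr, coeff_totalSeries, sumFinsuppEquivProdFinsupp_single_inr]
        dsimp only
        rw [(h1 i).2, coeff_rescale_const]
        simp only [map_zero, pow_zero, one_mul, coeff_zero_eq_constantCoeff_apply, Sum.inr.injEq]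
        split_ifs <;> simp
  · intro N
    obtain ⟨D, hD⟩ := h.tendsto N
    -- In larger total degree either the fibre degree exceeds `D`, and the coefficient of `ℓ i` is
    -- small, or the base degree is at least `N`, and `π ^ N` divides.
    refine ⟨N + D + 1, ?_⟩
    rintro (i | i) J hJ
    · exact ⟨0, zero_mem _, 0, by rw [Sum.elim_inl, hX i J (by omega)]; simp⟩
    · rw [degree_eq_add_of_sum] at hJ
      rw [Sum.elim_inr, coeff_totalSeries]
      rcases lt_or_ge D (Finsupp.sumFinsuppEquivProdFinsupp J).2.degree with h2 | h2
      · obtain ⟨k, hk, r, hr⟩ := hD i _ h2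
        exact ⟨k, hk, _, hc hr⟩
      · refine ⟨_, Ideal.pow_le_pow_right (m := N) ?_ (Ideal.pow_mem_pow hπ _), _,
          coeff_rescale_const _ _⟩
        omega
  · rintro (i | i) J hJ
    · exact ⟨0, zero_mem _, 0, by rw [Sum.elim_inl, hX i J hJ]; simp⟩
    · rw [degree_eq_add_of_sum] at hJ
      rw [Sum.elim_inr, coeff_totalSeries]
      rcases lt_or_ge 1 (Finsupp.sumFinsuppEquivProdFinsupp J).2.degree with h2 | h2
      · obtain ⟨k, hk, r, hr⟩ := h.small i _ h2
        exact ⟨k, hk, _, hc hr⟩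
      · exact ⟨_, Ideal.pow_mem_of_mem _ hπ _ (by omega), _, coeff_rescale_const _ _⟩

end CoordinateChange

/-! ### Maps given by convergent power series -/

section LogExpMaps

open MvPowerSeries IsLocalRing

variable {A : Type*} [CommRing A] [IsLocalRing A] [IsAdicComplete (maximalIdeal A) A] {σ : Type*}
  [Finite σ]

/-- The self-map of `A ^ σ` given by a tuple of convergent power series. -/
def valueMap (P : σ → MvPowerSeries σ A) (hP : ∀ i, IsConvergent (P i)) (w : σ → A) (i : σ) : A :=
  valueHom w ⟨P i, hP i⟩

variable {P Q : σ → MvPowerSeries σ A} {hP : ∀ i, IsConvergent (P i)}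
  {hQ : ∀ i, IsConvergent (Q i)}

omit [Finite σ] in
theorem convergesTo_valueMap (w : σ → A) (i : σ) : ConvergesTo (P i) w (valueMap P hP w i) :=
  convergesTo_valueHom w ⟨P i, hP i⟩

theorem valueMap_valueMap (hP0 : ∀ i, constantCoeff (P i) = 0) (hPQ : ∀ i, subst P (Q i) = X i)
    (w : σ → A) : valueMap Q hQ (valueMap P hP w) = w := by
  funext i
  have h1 : ConvergesTo (Q i) (valueMap P hP w) (valueMap Q hQ (valueMap P hP w) i) :=
    convergesTo_valueMap _ i
  have h2 := h1.subst hP0 fun i => convergesTo_valueMap (hP := hP) w i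
  rw [hPQ] at h2
  exact h2.unique (convergesTo_X i w)

omit [Finite σ] in
theorem isGivenByConvergentSeries_valueMap : IsGivenByConvergentSeries (valueMap P hP) :=
  ⟨P, hP, fun w i => (convergesTo_valueMap w i).hasValue⟩

end LogExpMaps

/-! ### Values of germs on the base as power series in the disk coordinates -/

section EvalCenter

open MvPowerSeries IsLocalRing

variable {𝒪 : Type u} [CommRing 𝒪] [IsDomain 𝒪] [IsDiscreteValuationRing 𝒪]
  [IsAdicComplete (maximalIdeal 𝒪) 𝒪] {Y : Scheme.{u}} {f : Y ⟶ Spec (.of 𝒪)}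
  {y : Spec (.of (ResidueField 𝒪)) ⟶ Y} {π : 𝒪} {n : ℕ} [SmoothOfRelativeDimension n f]
  {s : Fin n → Y.presheaf.stalk (center y)}

/-- The values of germs are given by power series in the coordinates. -/
theorem exists_eval_eq_evalScaled (hπ : Irreducible π) (hy : y ≫ f = closedPt 𝒪)
    (hs : IsParameterSystem f π (center y) s) (hπm : π ∈ maximalIdeal 𝒪) :
    ∃ φ : Y.presheaf.stalk (center y) →+* MvPowerSeries (Fin n) 𝒪,
      φ.comp (scalarGerm f (center y)) = C ∧
        ∀ (c : ResidueDisk f y) b, c.eval b = evalScaled hπm (c.coords π s) (φ b) := by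
  obtain ⟨c₀, hc₀⟩ := exists_eval_eq hπ hy hs (fun _ => 0)
  -- All `s i` vanish at `c₀`, so the displacement of a point `c` from `c₀` is given by the
  -- coordinates of `c` themselves.
  simp only [mul_zero] at hc₀
  obtain ⟨hg, φ, hφ⟩ := exists_isExpansionHom_eval hπ hy hs c₀
  refine ⟨φ, hφ.comp_eq, fun c b => ?_⟩
  have h1 := (hφ.isExpansion hg b).eq_evalScaled (hπ := hπm) (θ := c.eval) (w := c.coords π s)
    (fun a ha => by
      rw [← Ideal.mem_comap, maximalIdeal_comap, ← maximalIdeal_comap c₀.eval, Ideal.mem_comap,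
        RingHom.mem_ker.mp ha]
      exact zero_mem _)
    (fun i => by rw [hc₀, map_zero, sub_zero, c.mul_coords hπ.maximalIdeal_eq hs.mem])
  rw [h1, c.eval_comp_scalarGerm, MvPowerSeries.map_id, RingHom.id_apply]

variable {κ : Type*} [Finite κ]

/-- A coordinate change along the fibres over the disk extends to a convergent coordinate change in
all coordinates. -/
theorem exists_total_coordinateChange (hπ : Irreducible π) (hy : y ≫ f = closedPt 𝒪)
    (hs : IsParameterSystem f π (center y) s)
    {ℓ : κ → MvPowerSeries κ (Y.presheaf.stalk (center y))}
    (hℓ : IsCoordinateChange (scalarGerm f (center y)) ℓ) :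
    ∃ P : Fin n ⊕ κ → MvPowerSeries (Fin n ⊕ κ) 𝒪, IsCoordinateChange (RingHom.id 𝒪) P ∧
      (∀ i, P (Sum.inl i) = X (Sum.inl i)) ∧ ∀ (c : ResidueDisk f y) x i v,
        ConvergesTo (MvPowerSeries.map c.eval (ℓ i)) x v →
          ConvergesTo (P (Sum.inr i)) (Sum.elim (c.coords π s) x) v := by
  have hπm : π ∈ maximalIdeal 𝒪 := hπ.maximalIdeal_eq ▸ Ideal.mem_span_singleton_self π
  obtain ⟨φ, hφ, hφc⟩ := exists_eval_eq_evalScaled hπ hy hs hπm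
  refine ⟨Sum.elim (fun i => X (Sum.inl i)) fun i => totalSeries π fun b => φ (coeff b (ℓ i)),
    hℓ.total hπm hφ, fun i => rfl, fun c x i v hv => ?_⟩
  change ConvergesTo (totalSeries π fun b => φ (coeff b (ℓ i))) _ _
  refine convergesTo_totalSeries hπm (fun N => ?_) (fun b => ?_) hv
  · obtain ⟨D, hD⟩ := hℓ.tendsto N
    refine ⟨D, fun b hb a => ?_⟩
    obtain ⟨k, hk, r, hr⟩ := hD i b hb
    rw [hr, map_mul, ← RingHom.comp_apply φ, hφ, coeff_C_mul]
    exact Ideal.mul_mem_right _ _ hk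
  · rw [coeff_map, hφc]

end EvalCenter

/-! ### The action of the `p`-adic integers -/

section Action

open IsLocalRing

section Local

variable {𝒪 : Type u} [CommRing 𝒪] [IsLocalRing 𝒪] {Y G : Scheme.{u}} {q : G ⟶ Y}
  [GrpObj (Over.mk q)] {f : Y ⟶ Spec (.of 𝒪)} {y : Spec (.of (ResidueField 𝒪)) ⟶ Y}

theorem GroupDisk.specMap_comp_pt_eq_iff {I : Ideal 𝒪} {g h : GroupDisk q f y} :
    Spec.map (CommRingCat.ofHom (Ideal.Quotient.mk I)) ≫ h.pt =
      Spec.map (CommRingCat.ofHom (Ideal.Quotient.mk I)) ≫ g.pt ↔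
    ∀ a, h.evalHom a - g.evalHom a ∈ I := by
  rw [g.pt_eq, h.pt_eq, SpecMap_homPt, SpecMap_homPt, homPt_injective.eq_iff, RingHom.ext_iff]
  simp only [RingHom.comp_apply, Ideal.Quotient.eq]

theorem GroupDisk.toHom_injective {c : ResidueDisk f y} {g h : GroupDisk q f y} (eg : g.proj = c)
    (eh : h.proj = c) (e : g.toHom eg = h.toHom eh) : g = h := by
  have : g.pt = h.pt := congrArg (fun k => k.left) e
  cases g; cases h
  cases this
  rfl

/-- Additive functions on the group of sections over a point of the disk of the base commute with
integer multiples. -/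
theorem GroupDisk.apply_zmul_eq {M : Type*} [AddCommGroup M] {c : ResidueDisk f y}
    (Λ : GroupDisk q f y → M) (hΛ : ∀ (g₁ g₂ g : GroupDisk q f y) (e₁ : g₁.proj = c)
      (e₂ : g₂.proj = c) (e : g.proj = c), g₁.toHom e₁ * g₂.toHom e₂ = g.toHom e →
        Λ g = Λ g₁ + Λ g₂)
    {g g' : GroupDisk q f y} (e : g.proj = c) (e' : g'.proj = c) {a : ℤ}
    (h : g'.toHom e' = g.toHom e ^ a) : Λ g' = a • Λ g := by
  -- The disk over `c` is the kernel of reduction; on it `Λ` is a group homomorphism, hence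
  -- compatible with integer powers.
  choose d hd hd' using fun k : (reductionHom q c).ker => exists_toHom_eq k.2
  let ψ : (reductionHom q c).ker →* Multiplicative M := MonoidHom.mk'
    (fun k => Multiplicative.ofAdd (Λ (d k))) fun k k' => by
      rw [← ofAdd_add, hΛ (d k) (d k') (d (k * k')) (hd _) (hd _) (hd _)]
      rw [hd', hd', hd']
      rfl
  have hψ : ∀ (g : GroupDisk q f y) (e : g.proj = c),
      ψ ⟨g.toHom e, g.toHom_mem e⟩ = Multiplicative.ofAdd (Λ g) := fun g e => by
    refine congrArg (fun k => Multiplicative.ofAdd (Λ k)) ?_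
    exact GroupDisk.toHom_injective (hd _) e (hd' _)
  have h1 : (⟨g'.toHom e', g'.toHom_mem e'⟩ : (reductionHom q c).ker) =
      ⟨g.toHom e, g.toHom_mem e⟩ ^ a := Subtype.ext h
  have h2 := congrArg ψ h1
  rw [map_zpow, hψ, hψ, ← ofAdd_zsmul] at h2
  exact Multiplicative.ofAdd.injective h2

end Local

variable {𝒪 : Type u} [CommRing 𝒪] [IsDomain 𝒪] [IsDiscreteValuationRing 𝒪]
  {Y G : Scheme.{u}} {q : G ⟶ Y}
  [GrpObj (Over.mk q)] {f : Y ⟶ Spec (.of 𝒪)} {y : Spec (.of (ResidueField 𝒪)) ⟶ Y} {π : 𝒪}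
  {n m : ℕ} {s : Fin n → Y.presheaf.stalk (center y)}
  {t : Fin m → G.presheaf.stalk (idSection q (center y))}

open MvPowerSeries in
/-- The logarithm is additive on the points of the disk over a point of the base. -/
theorem GroupDisk.log_mul [IsAdicComplete (maximalIdeal 𝒪) 𝒪] (hπ : Irreducible π)
    (ht : IsFormalCoordinates q (center y) t)
    {F : Fin m → MvPowerSeries (Fin m ⊕ Fin m) (Y.presheaf.stalk (center y))}
    (hF : IsFormalGroupLawOf q (center y) t F) (hF0 : ∀ i, constantCoeff (F i) = 0)
    {c : ResidueDisk f y} {ℓ : MvPowerSeries (Fin m) 𝒪}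
    (hℓ : ∀ F' : Fin m → MvPowerSeries (Fin m ⊕ Fin m) 𝒪, (∀ i, constantCoeff (F' i) = 0) →
      (∀ i, C π * F' i = rescale (fun _ => π) (MvPowerSeries.map c.eval (F i))) →
      subst F' ℓ = subst (vars 𝒪 Sum.inl) ℓ + subst (vars 𝒪 Sum.inr) ℓ)
    {g₁ g₂ g : GroupDisk q f y} (e₁ : g₁.proj = c) (e₂ : g₂.proj = c) (e : g.proj = c)
    (h : g₁.toHom e₁ * g₂.toHom e₂ = g.toHom e) {v₁ v₂ v : 𝒪}
    (h₁ : ConvergesTo ℓ (g₁.fibreCoords π t) v₁) (h₂ : ConvergesTo ℓ (g₂.fibreCoords π t) v₂)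
    (hv : ConvergesTo ℓ (g.fibreCoords π t) v) : v = v₁ + v₂ := by
  have hπm : π ∈ maximalIdeal 𝒪 := hπ.maximalIdeal_eq ▸ Ideal.mem_span_singleton_self π
  -- `F'` is `π⁻¹ F(π U, π V)` over `c`, the convergent group law in the scaled coordinates.
  choose F' hF'0 hF' hF'c using fun i => exists_C_mul_eq_rescale hπm
    (f := MvPowerSeries.map c.eval (F i)) (by rw [constantCoeff_map, hF0, map_zero])
  set w : Fin m ⊕ Fin m → 𝒪 := Sum.elim (g₁.fibreCoords π t) (g₂.fibreCoords π t)
  have hw : ∀ i, ConvergesTo (F' i) w (g.fibreCoords π t i) := fun i => by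
    obtain ⟨u, hu⟩ := (hF'c i).exists_convergesTo w
    have h1 := (convergesTo_C π w).mul hu
    rw [hF'] at h1
    have h2 := h1.unique (convergesTo_evalScaled (hπ := hπm) _)
    rw [← GroupDisk.mul_fibreCoords_mul hπ ht hπm hF e₁ e₂ e h] at h2
    rwa [← mul_left_cancel₀ hπ.ne_zero h2]
  have h3 := hv.subst hF'0 hw
  rw [hℓ F' hF'0 hF'] at h3
  refine h3.unique (ConvergesTo.add ?_ ?_)
  · exact h₁.subst (constantCoeff_vars _) fun i => convergesTo_X (Sum.inl i) w
  · exact h₂.subst (constantCoeff_vars _) fun i => convergesTo_X (Sum.inr i) w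

variable {p : ℕ} [Fact p.Prime] [Algebra ℤ_[p] 𝒪] [FaithfulSMul ℤ_[p] 𝒪] [Module.Finite ℤ_[p] 𝒪]

omit [FaithfulSMul ℤ_[p] 𝒪] [Module.Finite ℤ_[p] 𝒪] [IsDomain 𝒪] [IsDiscreteValuationRing 𝒪] in
theorem smul_sub_zsmul_mem {z : ℤ_[p]} {a : ℤ} {j : ℕ} (h : (p : ℤ_[p]) ^ j ∣ (a : ℤ_[p]) - z)
    (x : 𝒪) : z • x - a • x ∈ Ideal.span {(p : 𝒪) ^ j} := by
  obtain ⟨b, hb⟩ := h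
  have h1 : z = a - (p : ℤ_[p]) ^ j * b := by rw [← hb]; ring
  rw [Ideal.mem_span_singleton, h1, Algebra.smul_def, zsmul_eq_mul]
  refine ⟨-(algebraMap ℤ_[p] 𝒪 b * x), ?_⟩
  simp only [map_sub, map_mul, map_intCast, map_pow, map_natCast]
  ring

/-- The action is transported from scalar multiplication of logarithms. If `a ≡ z` modulo `p ^ j`,
then `log (a · g) = a log g` is congruent to `z log g` in the fibre coordinates, and `exp` preserves
the congruence. Conversely integers approximate `z` to any order, so separatedness of `𝒪` leaves
only one point. -/
theorem exists_action (hπ : Irreducible π)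
    (ht : IsFormalCoordinates q (center y) t) [Smooth q] [SmoothOfRelativeDimension n f]
    (hy : y ≫ f = closedPt 𝒪) (hs : IsParameterSystem f π (center y) s)
    {log exp : (Fin n ⊕ Fin m → 𝒪) → (Fin n ⊕ Fin m → 𝒪)}
    (hlog : ∀ w i, log w (Sum.inl i) = w (Sum.inl i))
    (hexp : ∀ w i, exp w (Sum.inl i) = w (Sum.inl i))
    (hel : Function.LeftInverse exp log)
    (hcong : ∀ w w' N, (∀ i, w i - w' i ∈ maximalIdeal 𝒪 ^ N) →
      ∀ i, exp w i - exp w' i ∈ maximalIdeal 𝒪 ^ N)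
    (hadd : ∀ (c : ResidueDisk f y) (g₁ g₂ g : GroupDisk q f y) (e₁ : g₁.proj = c)
      (e₂ : g₂.proj = c) (e : g.proj = c), g₁.toHom e₁ * g₂.toHom e₂ = g.toHom e → ∀ i : Fin m,
        log (g.chart π s t) (Sum.inr i) =
          log (g₁.chart π s t) (Sum.inr i) + log (g₂.chart π s t) (Sum.inr i)) :
    ∃ act : ℤ_[p] → GroupDisk q f y → GroupDisk q f y,
      (∀ z g h, IsPadicMultiple z g h ↔ h = act z g) ∧
      (∀ z g, (act z g).chart π s t = exp (fibreSMul z (log (g.chart π s t)))) := by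
  have := isAdicComplete_maximalIdeal p 𝒪
  choose act hact using fun (z : ℤ_[p]) (g : GroupDisk q f y) =>
    (GroupDisk.bijective_chart hπ ht hy hs).2 (exp (fibreSMul z (log (g.chart π s t))))
  have hproj : ∀ z g, (act z g).proj = g.proj := fun z g => by
    refine (bijective_coords hπ hy hs).1 (funext fun i => ?_)
    have h1 := congrFun (hact z g) (Sum.inl i)
    rw [hexp, fibreSMul, Sum.elim_inl, hlog] at h1
    exact h1
  have key : ∀ z g (j : ℕ) (a : ℤ), (p : ℤ_[p]) ^ j ∣ (a : ℤ_[p]) - z →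
      ∃ g' : GroupDisk q f y, g'.pt = g.zmul a ∧
        ∀ b, (act z g).evalHom b - g'.evalHom b ∈ Ideal.span {(p : 𝒪) ^ j} := by
    intro z g j a ha
    obtain ⟨g', e, hg', hpow⟩ := g.exists_zmul_eq a
    refine ⟨g', hg', ?_⟩
    rw [span_prime_pow_eq]
    refine GroupDisk.evalHom_sub_mem hπ ht ((hproj z g).trans e.symm) fun i => ?_
    have h1 : ∀ i, log (g'.chart π s t) (Sum.inr i) = a • log (g.chart π s t) (Sum.inr i) :=
      fun i => GroupDisk.apply_zmul_eq (fun g => log (g.chart π s t) (Sum.inr i))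
        (fun g₁ g₂ g e₁ e₂ e h => hadd _ g₁ g₂ g e₁ e₂ e h i) rfl e hpow
    have h2 : ∀ i, fibreSMul z (log (g.chart π s t)) i - log (g'.chart π s t) i ∈
        maximalIdeal 𝒪 ^ (ramification p 𝒪 * j) := by
      rintro (i | i)
      · rw [fibreSMul, Sum.elim_inl, hlog, hlog, GroupDisk.chart_eq, GroupDisk.chart_eq, e,
          Sum.elim_inl, Sum.elim_inl, sub_self]
        exact zero_mem _
      · rw [fibreSMul, Sum.elim_inr, h1, ← span_prime_pow_eq]
        exact smul_sub_zsmul_mem ha _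
    have h3 := hcong _ _ _ h2 (Sum.inr i)
    rw [hel, ← hact] at h3
    exact h3
  refine ⟨act, fun z g h => ⟨fun ⟨h1, h2⟩ => ?_, ?_⟩, hact⟩
  · refine ResidueDisk.ext_eval (RingHom.ext fun b => eq_of_forall_sub_mem_pow fun N => ?_)
    obtain ⟨a, ha⟩ : ∃ a : ℤ, (p : ℤ_[p]) ^ N ∣ (a : ℤ_[p]) - z := by
      refine ⟨(z.appr N : ℕ), ?_⟩
      have := PadicInt.appr_spec N z
      rw [Ideal.mem_span_singleton] at this
      rw [← dvd_neg, neg_sub]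
      exact_mod_cast this
    obtain ⟨g', hg', hb⟩ := key z g N a ha
    have h3 := h2 N a ha
    rw [← hg'] at h3
    have h4 := GroupDisk.specMap_comp_pt_eq_iff.mp h3 b
    have h5 := sub_mem h4 (hb b)
    rw [sub_sub_sub_cancel_right, span_prime_pow_eq] at h5
    exact Ideal.pow_le_pow_right (Nat.le_mul_of_pos_left _ (ramification_pos p 𝒪)) h5
  · rintro rfl
    refine ⟨congrArg ResidueDisk.pt (hproj z g), fun j a ha => ?_⟩
    obtain ⟨g', hg', hb⟩ := key z g j a ha
    rw [← hg']
    exact GroupDisk.specMap_comp_pt_eq_iff.mpr hb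

end Action

/-! ### The action in coordinates over the `p`-adic integers -/

section ActionSeries

open MvPowerSeries IsLocalRing

variable {p : ℕ} [Fact p.Prime] {𝒪 : Type*} [CommRing 𝒪] [IsDomain 𝒪] [IsDiscreteValuationRing 𝒪]
  [Algebra ℤ_[p] 𝒪] [FaithfulSMul ℤ_[p] 𝒪] {σ τ ι' : Type*}
  [Fintype ι'] (b : Module.Basis ι' ℤ_[p] 𝒪)

/-- The coordinates of the coefficients of a power series. -/
def reprSeries (f : MvPowerSeries σ 𝒪) (k : ι') : MvPowerSeries σ ℤ_[p] :=
  fun J => b.repr (coeff J f) k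

omit [IsDomain 𝒪] [IsDiscreteValuationRing 𝒪] [FaithfulSMul ℤ_[p] 𝒪] [Fintype ι'] in
theorem coeff_reprSeries (f : MvPowerSeries σ 𝒪) (k : ι') (J : σ →₀ ℕ) :
    coeff J (reprSeries b f k) = b.repr (coeff J f) k := rfl

theorem isConvergent_reprSeries {f : MvPowerSeries σ 𝒪} (hf : IsConvergent f) (k : ι') :
    IsConvergent (reprSeries b f k) := fun N => by
  refine (hf (ramification p 𝒪 * N)).subset fun J hJ hc => hJ ?_
  rw [coeff_reprSeries]
  exact (mem_maximalIdeal_pow_iff_repr b).mp hc k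

/-- The arguments lie in `ℤ_p`, so monomials act as scalars and pass through the `ℤ_p`-linear
coordinate functions. -/
theorem hasValue_reprSeries {f : MvPowerSeries σ 𝒪} {x : σ → ℤ_[p]} {v : 𝒪}
    (hf : HasValue f (fun i => algebraMap ℤ_[p] 𝒪 (x i)) v) (k : ι') :
    HasValue (reprSeries b f k) x (b.repr v k) := fun N => by
  obtain ⟨S, hS⟩ := hf (ramification p 𝒪 * N)
  refine ⟨S, fun T hT => ⟨_, ?_, rfl⟩⟩
  obtain ⟨r, hr, h⟩ := hS T hT
  have h1 := (mem_maximalIdeal_pow_iff_repr b).mp hr k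
  rw [Algebra.algebraMap_self, RingHom.id_apply] at h
  rw [← h, map_sub, map_sum, Finsupp.sub_apply, Finsupp.finsetSum_apply] at h1
  have h2 : ∀ J : σ →₀ ℕ, coeff J (reprSeries b f k) * (J.prod fun i k => x i ^ k) =
      b.repr (coeff J f * J.prod fun i k => algebraMap ℤ_[p] 𝒪 (x i) ^ k) k := fun J => by
    have h3 : (J.prod fun i k => algebraMap ℤ_[p] 𝒪 (x i) ^ k) =
        algebraMap ℤ_[p] 𝒪 (J.prod fun i k => x i ^ k) := by
      simp only [Finsupp.prod, map_prod, map_pow]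
    rw [coeff_reprSeries, h3, mul_comm (coeff J f), ← Algebra.smul_def, map_smul,
      Finsupp.smul_apply, smul_eq_mul, mul_comm]
  simp only [h2]
  exact h1

variable [IsAdicComplete (maximalIdeal 𝒪) 𝒪] [Finite σ] [Finite τ]
  {P Q : σ ⊕ τ → MvPowerSeries (σ ⊕ τ) 𝒪} {hP : ∀ i, IsConvergent (P i)}
  {hQ : ∀ i, IsConvergent (Q i)}

theorem exists_action_series (hP0 : ∀ i, constantCoeff (P i) = 0) :
    ∃ Ψ : (Option ((σ ⊕ τ) × ι') → ℤ_[p]) → ((σ ⊕ τ) × ι' → ℤ_[p]),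
      IsGivenByConvergentSeries Ψ ∧ ∀ (z : ℤ_[p]) (w : σ ⊕ τ → 𝒪),
        (fun c => b.repr (valueMap Q hQ (fibreSMul z (valueMap P hP w)) c.1) c.2) =
          Ψ fun c => c.elim z fun c => b.repr (w c.1) c.2 := by
  -- `W` is the generic point of `𝒪 ^ (σ ⊕ τ)` in `ℤ_p`-coordinates, and the variable `none` stands
  -- for `z`. Below, `M` is the fibrewise multiple by `z` of the image of `W` under `P`.
  let W : σ ⊕ τ → MvPowerSeries (Option ((σ ⊕ τ) × ι')) 𝒪 :=
    fun i => ∑ k, C (b k) * X (some (i, k))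
  have hW0 : ∀ i, constantCoeff (W i) = 0 := fun i => by simp [W]
  let M : σ ⊕ τ → MvPowerSeries (Option ((σ ⊕ τ) × ι')) 𝒪 :=
    Sum.elim (fun i => subst W (P (Sum.inl i))) fun i => X none * subst W (P (Sum.inr i))
  have hWP0 : ∀ i, constantCoeff (subst W (P i)) = 0 := fun i => by
    rw [constantCoeff_subst_of_zero hW0, hP0, map_zero]
  have hM0 : ∀ i, constantCoeff (M i) = 0 := by
    rintro (i | i)
    · exact hWP0 _
    · simp [M, hWP0]
  let w : (Option ((σ ⊕ τ) × ι') → ℤ_[p]) → σ ⊕ τ → 𝒪 := fun x i => ∑ k, x (some (i, k)) • b k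
  have hw : ∀ x i, ConvergesTo (W i) (fun c => algebraMap ℤ_[p] 𝒪 (x c)) (w x i) := fun x i => by
    have h1 := convergesTo_coe (∑ k, MvPolynomial.C (b k) * MvPolynomial.X (some (i, k)) :
      MvPolynomial (Option ((σ ⊕ τ) × ι')) 𝒪) fun c => algebraMap ℤ_[p] 𝒪 (x c)
    rw [← MvPolynomial.coeToMvPowerSeries.ringHom_apply] at h1
    simp only [map_sum, map_mul, MvPolynomial.coeToMvPowerSeries.ringHom_apply,
      MvPolynomial.coe_C, MvPolynomial.coe_X, MvPolynomial.eval_C, MvPolynomial.eval_X] at h1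
    simp only [w, Algebra.smul_def]
    simpa only [mul_comm (b _)] using h1
  have hM : ∀ x i, ConvergesTo (M i) (fun c => algebraMap ℤ_[p] 𝒪 (x c))
      (fibreSMul (x none) (valueMap P hP (w x)) i) := fun x => by
    have h1 : ∀ i, ConvergesTo (subst W (P i)) (fun c => algebraMap ℤ_[p] 𝒪 (x c))
      (valueMap P hP (w x) i) := fun i => (convergesTo_valueMap (hP := hP) (w x) i).subst hW0 (hw x)
    rintro (i | i)
    · exact h1 _
    · rw [fibreSMul, Sum.elim_inr, Algebra.smul_def]
      exact (convergesTo_X none _).mul (h1 _)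
  have hΘ : ∀ x i, ConvergesTo (subst M (Q i)) (fun c => algebraMap ℤ_[p] 𝒪 (x c))
      (valueMap Q hQ (fibreSMul (x none) (valueMap P hP (w x))) i) := fun x i =>
    (convergesTo_valueMap (hP := hQ) _ i).subst hM0 (hM x)
  refine ⟨fun x c => b.repr (valueMap Q hQ (fibreSMul (x none) (valueMap P hP (w x))) c.1) c.2,
    ⟨fun c => reprSeries b (subst M (Q c.1)) c.2, fun c => ?_, fun x c => ?_⟩, fun z v => ?_⟩
  · exact isConvergent_reprSeries b (hΘ 0 c.1).isConvergent c.2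
  · exact hasValue_reprSeries b (hΘ x c.1).hasValue c.2
  · have h1 : w (fun c => c.elim z fun c => b.repr (v c.1) c.2) = v :=
      funext fun i => b.sum_repr (v i)
    change _ = fun c : (σ ⊕ τ) × ι' => b.repr (valueMap Q hQ (fibreSMul z (valueMap P hP
      (w fun c => c.elim z fun c => b.repr (v c.1) c.2))) c.1) c.2
    rw [h1]

end ActionSeries

/-! ### Logarithm and exponential at a point of the base -/

section EvalLog

open MvPowerSeries IsLocalRing

/-- The bound `|b| - 1 ≤ (p - 1) x` makes `x` tend to infinity with `|b|` and positive for `|b| >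
1`: the decay and the congruence to the identity on which inversion rests. -/
theorem IsLogOver.exists_isCoordinateChange {p : ℕ} [Fact p.Prime] {𝒪 : Type*} [CommRing 𝒪]
    [IsDomain 𝒪] [IsDiscreteValuationRing 𝒪] [Algebra ℤ_[p] 𝒪] [FaithfulSMul ℤ_[p] 𝒪] {π : 𝒪}
    {R S κ : Type*} [CommRing R] [CommRing S] [Fintype κ] [DecidableEq κ]
    (he : ramification p 𝒪 < p - 1) (hπ : Irreducible π)
    (ε : 𝒪 →+* R) {ρ : R →+* S} {F : κ → MvPowerSeries (κ ⊕ κ) R} (hF : IsFormalGroup F)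
    {L : κ → MvPowerSeries κ S} (hL : IsLogOver ρ F L) :
    ∃ ℓ : κ → MvPowerSeries κ R, IsCoordinateChange ε ℓ ∧
      ∀ i, IsScaling ρ (ε π) (ℓ i) (L i) := by
  obtain ⟨ℓ, ht, hs, hc⟩ := hL.exists_isScaling he hπ ε hF
  refine ⟨ℓ, ⟨ht, fun N => ⟨(p - 1) * N + 1, fun i b hb => ?_⟩, fun i b hb => ?_⟩, hs⟩
  · obtain ⟨x, k, r, hr, hk, hx⟩ := hc i b
    have hNx : N < x := by
      by_contra! h
      have := Nat.mul_le_mul_left (p - 1) h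
      omega
    exact ⟨k, Ideal.pow_le_pow_right hNx.le hk, r, hr⟩
  · obtain ⟨x, k, r, hr, hk, hx⟩ := hc i b
    have hx0 : x ≠ 0 := by
      rintro rfl
      omega
    exact ⟨k, Ideal.pow_le_self hx0 hk, r, hr⟩

variable {𝒪 : Type u} [CommRing 𝒪] [IsLocalRing 𝒪] {X : Scheme.{u}} {f : X ⟶ Spec (.of 𝒪)}
  {x : Spec (.of (ResidueField 𝒪)) ⟶ X} (c : ResidueDisk f x)

theorem ResidueDisk.evalQ_comp : c.evalQ.comp Algebra.TensorProduct.includeLeftRingHom =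
    (algebraMap 𝒪 (𝒪 ⊗[ℤ] ℚ)).comp c.eval := by
  ext a
  simp [ResidueDisk.evalQ]

theorem algebraMap_tensor_rat_injective (A : Type*) [CommRing A] [IsDomain A] [CharZero A] :
    Function.Injective (algebraMap A (A ⊗[ℤ] ℚ)) :=
  Algebra.TensorProduct.includeLeft_injective (R := ℤ) (S := ℤ) (A := A) (B := ℚ)
    (RingHom.injective_int _)

variable {κ : Type*} [Fintype κ] [DecidableEq κ]

theorem IsFormalLog.subst_map_evalQ {F : κ → MvPowerSeries (κ ⊕ κ) (X.presheaf.stalk (center x))}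
    (hF : IsFormalGroup F) {L : κ → MvPowerSeries κ (X.presheaf.stalk (center x) ⊗[ℤ] ℚ)}
    (hL : IsFormalLog F L) (i : κ) :
    subst (fun j => MvPowerSeries.map (algebraMap 𝒪 (𝒪 ⊗[ℤ] ℚ))
        (MvPowerSeries.map c.eval (F j))) (MvPowerSeries.map c.evalQ (L i)) =
      subst (vars (𝒪 ⊗[ℤ] ℚ) (Sum.inl : κ → κ ⊕ κ)) (MvPowerSeries.map c.evalQ (L i)) +
        subst (vars (𝒪 ⊗[ℤ] ℚ) (Sum.inr : κ → κ ⊕ κ)) (MvPowerSeries.map c.evalQ (L i)) := by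
  let _ : Algebra ℚ (X.presheaf.stalk (center x) ⊗[ℤ] ℚ) := Algebra.TensorProduct.rightAlgebra
  have h := congrArg (MvPowerSeries.map c.evalQ) ((hF.isFormalLog_iff.mp hL).subst_eq hF i)
  have hv : ∀ e : κ → κ ⊕ κ, (fun i => MvPowerSeries.map c.evalQ (vars _ e i)) =
      vars (𝒪 ⊗[ℤ] ℚ) e := fun e => funext fun i => map_X _ _
  rw [map_add, map_subst_of_zero (fun j => by rw [constantCoeff_map, hF.zero, map_zero]),
    map_subst_of_zero (constantCoeff_vars _), map_subst_of_zero (constantCoeff_vars _), hv, hv] at h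
  rw [← h]
  congr 1

omit [DecidableEq κ] in
theorem IsFormalExp.subst_map_evalQ
    {L E : κ → MvPowerSeries κ (X.presheaf.stalk (center x) ⊗[ℤ] ℚ)}
    (hL : ∀ i, constantCoeff (L i) = 0) (hE : IsFormalExp L E) (i : κ) :
    subst (fun j => MvPowerSeries.map c.evalQ (L j)) (MvPowerSeries.map c.evalQ (E i)) =
      MvPowerSeries.X i := by
  rw [← map_subst_of_zero hL, hE, map_X]

end EvalLog

end LogExp

end

/-! ### Logarithm, exponential and action on the residue disk -/

theorem mainTheorem9 (p : ℕ) [Fact p.Prime]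
    -- `𝒪` is the ring of integers of a finite extension of `ℚ_p`
    (𝒪 : Type u) [CommRing 𝒪] [IsDomain 𝒪] [IsDiscreteValuationRing 𝒪]
    [Algebra ℤ_[p] 𝒪] [FaithfulSMul ℤ_[p] 𝒪] [Module.Finite ℤ_[p] 𝒪]
    (he : (IsLocalRing.maximalIdeal ℤ_[p]).ramificationIdx' (IsLocalRing.maximalIdeal 𝒪) < p - 1)
    (π : 𝒪) (hπ : Irreducible π) (n m : ℕ)
    -- the smooth base, the smooth commutative group scheme, and the point of the base
    {Y G : Scheme.{u}} (f : Y ⟶ Spec (.of 𝒪)) [SmoothOfRelativeDimension n f]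
    (q : G ⟶ Y) [SmoothOfRelativeDimension m q] [GrpObj (Over.mk q)] [IsCommMonObj (Over.mk q)]
    (y : Spec (.of (IsLocalRing.ResidueField 𝒪)) ⟶ Y)
    (hy : y ≫ f = closedPt 𝒪)
    -- the parameters
    (s : Fin n → Y.presheaf.stalk (center y)) (hs : IsParameterSystem f π (center y) s)
    (t : Fin m → G.presheaf.stalk (idSection q (center y)))
    (ht : IsFormalCoordinates q (center y) t) :
    -- the coordinates are bijective
    Function.Bijective (ResidueDisk.coords (f := f) (x := y) π s) ∧
    Function.Bijective (GroupDisk.chart (q := q) (f := f) (y := y) π s t) ∧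
    -- the formal group law, the formal logarithm and the formal exponential
    ∃ F L E, IsFormalGroupLawOf q (center y) t F ∧ IsFormalLog F L ∧ IsFormalExp L E ∧
      (∀ F' L' E', IsFormalGroupLawOf q (center y) t F' → IsFormalLog F' L' → IsFormalExp L' E' →
        F' = F ∧ L' = L ∧ E' = E) ∧
    -- the induced maps
    ∃ log exp : (Fin n ⊕ Fin m → 𝒪) → (Fin n ⊕ Fin m → 𝒪),
      IsInducedBy f y π s L log ∧ IsInducedBy f y π s E exp ∧
      IsGivenByConvergentSeries log ∧ IsGivenByConvergentSeries exp ∧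
      Function.LeftInverse exp log ∧ Function.RightInverse exp log ∧
    -- the action of `ℤ_p`
    ∃ act : ℤ_[p] → GroupDisk q f y → GroupDisk q f y,
      (∀ z g h, IsPadicMultiple z g h ↔ h = act z g) ∧
      (∀ z g, (act z g).chart π s t = exp (fibreSMul z (log (g.chart π s t)))) ∧
      ∀ (d : ℕ) (b : Module.Basis (Fin d) ℤ_[p] 𝒪),
        ∃ Ψ : (Option ((Fin n ⊕ Fin m) × Fin d) → ℤ_[p]) → ((Fin n ⊕ Fin m) × Fin d → ℤ_[p]),
          IsGivenByConvergentSeries Ψ ∧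
          ∀ z g, (fun c => b.repr ((act z g).chart π s t c.1) c.2) =
            Ψ (fun c => c.elim z fun c => b.repr (g.chart π s t c.1) c.2) := by
  have := isAdicComplete_maximalIdeal p 𝒪
  have := SmoothOfRelativeDimension.smooth m q
  obtain ⟨F, hF, hFq, hFu⟩ := ht.exists_isFormalGroupLawOf
  obtain ⟨L, E, hL, hE, hLt, hLE⟩ := hF.exists_formalLog_formalExp
  refine ⟨bijective_coords hπ hy hs, GroupDisk.bijective_chart hπ ht hy hs, F, L, E, hFq, hL, hE,
    fun F' L' E' hF' hL' hE' => ?_, ?_⟩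
  · obtain rfl := hFu F' hF'
    exact ⟨rfl, hLE L' E' hL' hE'⟩
  have hLo := hF.isFormalLog_iff.mp hL
  obtain ⟨ℓ, hℓ, hs1⟩ := hLo.exists_isCoordinateChange he hπ (scalarGerm f (center y)) hF
  -- `P` is the logarithm in all coordinates and `Q` below its formal inverse. As `Q` is not
  -- constructed from `E`, the two are compared over each point of the base.
  obtain ⟨P, hP, hPl, hPv⟩ := exists_total_coordinateChange hπ hy hs hℓ
  obtain ⟨Q, hQ, hQc, hPQ, hQP⟩ := hP.exists_inverse
  have hQl : ∀ i, Q (Sum.inl i) = MvPowerSeries.X (Sum.inl i) := fun i => by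
    rw [← hQP, hPl, MvPowerSeries.subst_X (hasSubst_of_zero hQ.constantCoeff)]
  let log := valueMap P hP.isConvergent
  let exp := valueMap Q hQc
  have hlog : ∀ w i, log w (Sum.inl i) = w (Sum.inl i) := fun w i => by
    have h1 := convergesTo_valueMap (hP := hP.isConvergent) w (Sum.inl i)
    rw [hPl] at h1
    exact h1.unique (convergesTo_X _ w)
  have hexp : ∀ w i, exp w (Sum.inl i) = w (Sum.inl i) := fun w i => by
    have h1 := convergesTo_valueMap (hP := hQc) w (Sum.inl i)
    rw [hQl] at h1
    exact h1.unique (convergesTo_X _ w)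
  have hel : Function.LeftInverse exp log := valueMap_valueMap hP.tangent.constantCoeff hPQ
  have hle : Function.RightInverse exp log := valueMap_valueMap hQ.constantCoeff hQP
  have hℓc : ∀ c : ResidueDisk f y, IsCoordinateChange (RingHom.id 𝒪)
      fun i => MvPowerSeries.map c.eval (ℓ i) := fun c => hℓ.map c.eval_comp_scalarGerm
  have hsc : ∀ (c : ResidueDisk f y) i, IsScaling (algebraMap 𝒪 (𝒪 ⊗[ℤ] ℚ)) π
      (MvPowerSeries.map c.eval (ℓ i)) (MvPowerSeries.map c.evalQ (L i)) := fun c i => by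
    have h1 := (hs1 i).map (ρ' := algebraMap 𝒪 (𝒪 ⊗[ℤ] ℚ)) c.evalQ_comp
    rwa [c.eval_scalarGerm] at h1
  have hlogv : ∀ (c : ResidueDisk f y) x i, ConvergesTo (MvPowerSeries.map c.eval (ℓ i)) x
      (log (Sum.elim (c.coords π s) x) (Sum.inr i)) := fun c x i => by
    obtain ⟨v, hv⟩ := ((hℓc c).isConvergent i).exists_convergesTo x
    have h1 : log (Sum.elim (c.coords π s) x) (Sum.inr i) = v :=
      (convergesTo_valueMap _ _).unique (hPv c x i v hv)
    rwa [h1]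
  refine ⟨log, exp, ⟨hlog, fun c x i => (hsc c i).hasAdicSum (hlogv c x i).hasValue⟩,
    ⟨hexp, fun c x i => ?_⟩, isGivenByConvergentSeries_valueMap,
    isGivenByConvergentSeries_valueMap, hel, hle, ?_⟩
  -- Over `c` the inverse `ε` of the scaled logarithm is the scaled exponential. The scaled
  -- logarithm takes the fibre coordinates of `w` to `x`, so the value of `ε` at `x` is the fibre
  -- part of `w`.
  · obtain ⟨ε, hε, hεc, hℓε, -⟩ := (hℓc c).exists_inverse
    set w := exp (Sum.elim (c.coords π s) x)
    have hw : Sum.elim (c.coords π s) (fun j => w (Sum.inr j)) = w := by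
      funext j
      rcases j with j | j
      · exact (hexp (Sum.elim (c.coords π s) x) j).symm
      · rfl
    have hu : ∀ j, ConvergesTo (MvPowerSeries.map c.eval (ℓ j)) (fun j => w (Sum.inr j)) (x j) :=
      fun j => by
        have h1 := hlogv c (fun j => w (Sum.inr j)) j
        rwa [hw, hle] at h1
    obtain ⟨v, hv⟩ := (hεc i).exists_convergesTo x
    have h2 := hv.subst (hℓc c).tangent.constantCoeff hu
    rw [hℓε] at h2
    rw [h2.unique (convergesTo_X _ _)] at hv
    refine (IsScaling.inverse (hℓc c).tangent (hsc c) (fun j => ?_)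
      (hE.subst_map_evalQ c hLt.constantCoeff) hℓε i).hasAdicSum hv.hasValue
    rw [MvPowerSeries.constantCoeff_map, hLt.constantCoeff, map_zero]
  · have := charZero_of_faithfulSMul p 𝒪
    have hchart : ∀ {c : ResidueDisk f y} {g : GroupDisk q f y}, g.proj = c → ∀ i,
        ConvergesTo (MvPowerSeries.map c.eval (ℓ i)) (g.fibreCoords π t)
          (log (g.chart π s t) (Sum.inr i)) := by
      rintro _ g rfl i
      exact hlogv _ _ i
    obtain ⟨act, hact, hact'⟩ := exists_action (p := p) hπ ht hy hs hlog hexp hel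
      (fun w w' N h i => (convergesTo_valueMap w i).sub_mem (convergesTo_valueMap w' i) h)
      fun c g₁ g₂ g e₁ e₂ e h i => GroupDisk.log_mul hπ ht hFq hF.zero
        (fun F' hF'0 hF' => (hsc c i).subst_eq (algebraMap_tensor_rat_injective 𝒪) hπ.ne_zero
          (fun j => by rw [MvPowerSeries.constantCoeff_map, hF.zero, map_zero]) hF'0 hF'
          (hL.subst_map_evalQ c hF i)) e₁ e₂ e h (hchart e₁ i) (hchart e₂ i) (hchart e i)
    refine ⟨act, hact, hact', fun d b => ?_⟩
    obtain ⟨Ψ, hΨ, hΨ'⟩ := exists_action_series b (hP := hP.isConvergent) (hQ := hQc)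
      hP.tangent.constantCoeff
    refine ⟨Ψ, hΨ, fun z g => ?_⟩
    rw [← hΨ', hact']
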